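/- Let $k$ be an algebraically closed field of characteristic $0$ and let $(H,\Delta,\varepsilon,\Phi,S,\alpha,\beta)$ be a quasi-Hopf algebra over $k$ with $\dim_k H=2$ (bijectivity of $S$ is not required as an axiom, and no normalization $\varepsilon(\alpha)=1$ is imposed). Write $\Phi^{-1}=x^1\otimes x^2\otimes x^3$ and $\Delta(h)=h_1\otimes h_2$. (1) Let $B$ be a $3$-dimensional braided Hopf algebra over $H$, i.e. a Hopf algebra in the braided monoidal category ${}_H^H\mathcal{YD}$ of left Yetter–Drinfeld modules over $H$. Then the $6$-dimensional biproduct quasi-Hopf algebra $B\times H$ is semisimple; that is, the associative unital algebra $B\otimes H$ with multiplication $$(b\times h)(b'\times h')=(x^1\cdot b)(x^2h_1\cdot b')\times x^3h_2h'$$ and unit $1_B\times 1$ is a semisimple algebra. (2) Up to twist, $H$ is $k[C_2]$ or $H(2)$. Here $k[C_2]$, with $C_2=\{1,g\}$, is the ordinary group Hopf algebra ($\Phi=1$, $S=\mathrm{Id}$, $\alpha=\beta=1$), and $H(2)$ is the algebra $k[C_2]$ with the same $\Delta$, $\varepsilon$ and $S=\mathrm{Id}$, reassociator $\Phi=1-2\,p_-\otimes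 p_-\otimes p_-$, where $p_-=\frac12(1-g)$, and distinguished elements $\alpha=g$, $\beta=1$. Precisely: there is $c\in k\setminus\{0\}$ such that, after replacing $(\alpha,\beta)$ by $(c\alpha,c^{-1}\beta)$, $H$ is twist equivalent, as a quasi-Hopf algebra, to $k[C_2]$ or to $H(2)$. (Quasi-Hopf algebras $H$ and $H'$ are twist equivalent if there is an invertible $F=F^1\otimes F^2\in H'\otimes H'$ with $\varepsilon(F^1)F^2=1=\varepsilon(F^2)F^1$ such that $H$ is isomorphic, compatibly with comultiplication, counit, reassociator, antipode, $\alpha$ and $\beta$, to $H'_F$, whose structure is $\Delta_F(h)=F\Delta(h)F^{-1}$, $\Phi_F=(1\otimes F)(\mathrm{Id}\otimes\Delta)(F)\,\Phi\,(\Delta\otimes\mathrm{Id})(F^{-1})(F^{-1}\otimes1)$, $\varepsilon_F=\varepsilon$, $S_F=S$, $\alpha_F=S(G^1)\alpha G^2$, $\beta_F=F^1\beta S(F^2)$, where $F^{-1}=G^1\otimes G^2$.) -/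

import Mathlib

open scoped TensorProduct

noncomputable section

namespace QuasiHopf

section Basics

variable {k : Type*} [Field k]

/-- The external tensor product of two representations: `(a ⊗ c)·(m ⊗ n) = (a·m) ⊗ (c·n)`. -/
def boxRep {A C M N : Type*} [Ring A] [Algebra k A] [Ring C] [Algebra k C]
    [AddCommGroup M] [Module k M] [AddCommGroup N] [Module k N]
    (ρ : A →ₐ[k] Module.End k M) (σ : C →ₐ[k] Module.End k N) :
    A ⊗[k] C →ₐ[k] Module.End k (M ⊗[k] N) :=
  (Module.endTensorEndAlgHom (R := k) (S := k) (A := k) (M := M) (N := N)).comp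
    (Algebra.TensorProduct.map ρ σ)

@[simp] theorem boxRep_tmul {A C M N : Type*} [Ring A] [Algebra k A] [Ring C] [Algebra k C]
    [AddCommGroup M] [Module k M] [AddCommGroup N] [Module k N]
    (ρ : A →ₐ[k] Module.End k M) (σ : C →ₐ[k] Module.End k N) (a : A) (c : C) (m : M) (n : N) :
    boxRep ρ σ (a ⊗ₜ[k] c) (m ⊗ₜ[k] n) = ρ a m ⊗ₜ[k] σ c n := rfl

variable (k) (H : Type*) [Ring H] [Algebra k H]

/-- The left regular representation `h·x = hx` of an algebra. -/
abbrev regRep : H →ₐ[k] Module.End k H := Algebra.lmul k H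

/-- A quasi-bialgebra structure on the `k`-algebra `H`. Triple tensor products are bracketed as
`H ⊗ (H ⊗ H)`, fourfold ones as `H ⊗ (H ⊗ (H ⊗ H))`. -/
structure QuasiBialgebra where
  /-- comultiplication `Δ` -/
  comul : H →ₐ[k] H ⊗[k] H
  /-- counit `ε` -/
  counit : H →ₐ[k] k
  /-- reassociator `Φ`, an invertible element -/
  reassoc : (H ⊗[k] (H ⊗[k] H))ˣ
  /-- `(Id ⊗ Δ)(Δ(h)) = Φ (Δ ⊗ Id)(Δ(h)) Φ⁻¹` -/
  quasi_coassoc : ∀ h : H,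
    TensorProduct.map LinearMap.id comul.toLinearMap (comul h) =
      (reassoc : H ⊗[k] (H ⊗[k] H)) *
        TensorProduct.assoc k H H H
          (TensorProduct.map comul.toLinearMap LinearMap.id (comul h)) *
        ((reassoc⁻¹ : (H ⊗[k] (H ⊗[k] H))ˣ) : H ⊗[k] (H ⊗[k] H))
  /-- `(Id ⊗ ε)(Δ(h)) = h` -/
  counit_right : ∀ h : H, TensorProduct.rid k H
    (TensorProduct.map LinearMap.id counit.toLinearMap (comul h)) = h
  /-- `(ε ⊗ Id)(Δ(h)) = h` -/
  counit_left : ∀ h : H, TensorProduct.lid k H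
    (TensorProduct.map counit.toLinearMap LinearMap.id (comul h)) = h
  /-- `(1 ⊗ Φ)(Id ⊗ Δ ⊗ Id)(Φ)(Φ ⊗ 1) = (Id ⊗ Id ⊗ Δ)(Φ)(Δ ⊗ Id ⊗ Id)(Φ)` -/
  pentagon :
    ((1 : H) ⊗ₜ[k] (reassoc : H ⊗[k] (H ⊗[k] H))) *
      TensorProduct.map LinearMap.id
        ((TensorProduct.assoc k H H H).toLinearMap ∘ₗ
          TensorProduct.map comul.toLinearMap LinearMap.id)
        (reassoc : H ⊗[k] (H ⊗[k] H)) *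
      TensorProduct.map LinearMap.id (TensorProduct.map LinearMap.id
        ((TensorProduct.mk k H H).flip 1)) (reassoc : H ⊗[k] (H ⊗[k] H)) =
    TensorProduct.map LinearMap.id (TensorProduct.map LinearMap.id comul.toLinearMap)
        (reassoc : H ⊗[k] (H ⊗[k] H)) *
      TensorProduct.assoc k H H (H ⊗[k] H)
        (TensorProduct.map comul.toLinearMap LinearMap.id (reassoc : H ⊗[k] (H ⊗[k] H)))
  /-- `(Id ⊗ ε ⊗ Id)(Φ) = 1 ⊗ 1` -/
  reassoc_normalized :
    TensorProduct.map LinearMap.id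
      ((TensorProduct.lid k H).toLinearMap ∘ₗ
        TensorProduct.map counit.toLinearMap LinearMap.id)
      (reassoc : H ⊗[k] (H ⊗[k] H)) = (1 : H) ⊗ₜ[k] (1 : H)

/-- A quasi-Hopf algebra structure on the `k`-algebra `H`: a quasi-bialgebra together with an
anti-morphism `S` of the algebra `H` and elements `α`, `β`. -/
structure QuasiHopfAlgebra extends QuasiBialgebra k H where
  /-- antipode `S` -/
  antipode : H →ₗ[k] H
  /-- distinguished element `α` -/
  alpha : H
  /-- distinguished element `β` -/
  beta : H
  antipode_one : antipode 1 = 1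
  antipode_mul : ∀ a b : H, antipode (a * b) = antipode b * antipode a
  /-- `S(h₁) α h₂ = ε(h) α` -/
  antipode_left : ∀ h : H, LinearMap.mul' k H
    (TensorProduct.map (LinearMap.mulRight k alpha ∘ₗ antipode) LinearMap.id (comul h)) =
      counit h • alpha
  /-- `h₁ β S(h₂) = ε(h) β` -/
  antipode_right : ∀ h : H, LinearMap.mul' k H
    (TensorProduct.map (LinearMap.mulRight k beta) antipode (comul h)) = counit h • beta
  /-- `X¹ β S(X²) α X³ = 1` where `Φ = X¹ ⊗ X² ⊗ X³` -/
  reassoc_antipode : LinearMap.mul' k H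
    (TensorProduct.map (LinearMap.mulRight k beta)
      (LinearMap.mul' k H ∘ₗ
        TensorProduct.map (LinearMap.mulRight k alpha ∘ₗ antipode) LinearMap.id)
      (reassoc : H ⊗[k] (H ⊗[k] H))) = 1
  /-- `S(x¹) α x² β S(x³) = 1` where `Φ⁻¹ = x¹ ⊗ x² ⊗ x³` -/
  reassoc_inv_antipode : LinearMap.mul' k H
    (TensorProduct.map (LinearMap.mulRight k alpha ∘ₗ antipode)
      (LinearMap.mul' k H ∘ₗ TensorProduct.map (LinearMap.mulRight k beta) antipode)
      ((reassoc⁻¹ : (H ⊗[k] (H ⊗[k] H))ˣ) : H ⊗[k] (H ⊗[k] H))) = 1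

end Basics

section Modules

variable {k : Type*} [Field k] {H : Type*} [Ring H] [Algebra k H]

namespace QuasiBialgebra

variable (Q : QuasiBialgebra k H)

/-- The diagonal representation on a tensor product: `h·(m ⊗ n) = h₁·m ⊗ h₂·n`. -/
def tensorRep {M N : Type*} [AddCommGroup M] [Module k M] [AddCommGroup N] [Module k N]
    (ρ : H →ₐ[k] Module.End k M) (σ : H →ₐ[k] Module.End k N) :
    H →ₐ[k] Module.End k (M ⊗[k] N) :=
  (boxRep ρ σ).comp Q.comul

/-- The associativity constraint `(m ⊗ n) ⊗ p ↦ X¹·m ⊗ (X²·n ⊗ X³·p)` of the monoidal category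
of left `H`-modules. -/
def assocMap {M N P : Type*} [AddCommGroup M] [Module k M] [AddCommGroup N] [Module k N]
    [AddCommGroup P] [Module k P] (ρ : H →ₐ[k] Module.End k M) (σ : H →ₐ[k] Module.End k N)
    (τ : H →ₐ[k] Module.End k P) : (M ⊗[k] N) ⊗[k] P →ₗ[k] M ⊗[k] (N ⊗[k] P) :=
  boxRep ρ (boxRep σ τ) (Q.reassoc : H ⊗[k] (H ⊗[k] H)) ∘ₗ
    (TensorProduct.assoc k M N P).toLinearMap

/-- The inverse associativity constraint `m ⊗ (n ⊗ p) ↦ (x¹·m ⊗ x²·n) ⊗ x³·p`. -/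
def assocInv {M N P : Type*} [AddCommGroup M] [Module k M] [AddCommGroup N] [Module k N]
    [AddCommGroup P] [Module k P] (ρ : H →ₐ[k] Module.End k M) (σ : H →ₐ[k] Module.End k N)
    (τ : H →ₐ[k] Module.End k P) : M ⊗[k] (N ⊗[k] P) →ₗ[k] (M ⊗[k] N) ⊗[k] P :=
  (TensorProduct.assoc k M N P).symm.toLinearMap ∘ₗ
    boxRep ρ (boxRep σ τ)
      ((Q.reassoc⁻¹ : (H ⊗[k] (H ⊗[k] H))ˣ) : H ⊗[k] (H ⊗[k] H))

end QuasiBialgebra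

/-- For a coaction `δ(m) = m₍₋₁₎ ⊗ m₍₀₎` on `M` and a left `H`-module `N`, the map
`M ⊗ N → N ⊗ M`, `m ⊗ n ↦ m₍₋₁₎·n ⊗ m₍₀₎`. -/
def braid {M N : Type*} [AddCommGroup M] [Module k M] [AddCommGroup N] [Module k N]
    (δ : M →ₗ[k] H ⊗[k] M) (σ : H →ₐ[k] Module.End k N) : M ⊗[k] N →ₗ[k] N ⊗[k] M :=
  (TensorProduct.lift σ.toLinearMap).rTensor M ∘ₗ
    (TensorProduct.rightComm k H M N).toLinearMap ∘ₗ δ.rTensor N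

/-- A left Yetter-Drinfeld module structure on the vector space `M` over a quasi-bialgebra. -/
structure YDModule (Q : QuasiBialgebra k H) (M : Type*) [AddCommGroup M] [Module k M] where
  /-- the left action `h·m` -/
  act : H →ₐ[k] Module.End k M
  /-- the left coaction `m ↦ m₍₋₁₎ ⊗ m₍₀₎` -/
  coact : M →ₗ[k] H ⊗[k] M
  /-- `ε(m₍₋₁₎) m₍₀₎ = m` -/
  counit_coact : ∀ m : M, TensorProduct.lid k M
    (TensorProduct.map Q.counit.toLinearMap LinearMap.id (coact m)) = m
  /-- `X¹m₍₋₁₎ ⊗ (X²·m₍₀₎)₍₋₁₎X³ ⊗ (X²·m₍₀₎)₍₀₎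
    = X¹(Y¹·m)₍₋₁₎₁Y² ⊗ X²(Y¹·m)₍₋₁₎₂Y³ ⊗ X³·(Y¹·m)₍₀₎` -/
  coact_coact : ∀ m : M,
    (braid coact (regRep k H)).lTensor H
      (Q.assocMap (regRep k H) act (regRep k H)
        ((braid coact (regRep k H)).rTensor H ((m ⊗ₜ[k] (1 : H)) ⊗ₜ[k] (1 : H)))) =
    Q.assocMap (regRep k H) (regRep k H) act
      (braid coact (Q.tensorRep (regRep k H) (regRep k H))
        (Q.assocMap act (regRep k H) (regRep k H) ((m ⊗ₜ[k] (1 : H)) ⊗ₜ[k] (1 : H))))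
  /-- `h₁m₍₋₁₎ ⊗ h₂·m₍₀₎ = (h₁·m)₍₋₁₎h₂ ⊗ (h₁·m)₍₀₎` -/
  coact_act : ∀ (h : H) (m : M),
    Q.tensorRep (regRep k H) act h (coact m) =
      braid coact (regRep k H) (Q.tensorRep act (regRep k H) h (m ⊗ₜ[k] (1 : H)))

/-- The coaction on a tensor product of Yetter-Drinfeld modules:
`m ⊗ n ↦ X¹(x¹Y¹·m)₍₋₁₎x²(Y²·n)₍₋₁₎Y³ ⊗ (X²·(x¹Y¹·m)₍₀₎ ⊗ X³x³·(Y²·n)₍₀₎)`. -/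
def YDModule.tensorCoact {Q : QuasiBialgebra k H} {M N : Type*} [AddCommGroup M] [Module k M]
    [AddCommGroup N] [Module k N] (U : YDModule Q M) (V : YDModule Q N) :
    M ⊗[k] N →ₗ[k] H ⊗[k] (M ⊗[k] N) :=
  Q.assocMap (regRep k H) U.act V.act ∘ₗ
    (braid U.coact (regRep k H)).rTensor N ∘ₗ
    Q.assocInv U.act (regRep k H) V.act ∘ₗ
    (braid V.coact (regRep k H)).lTensor M ∘ₗ
    Q.assocMap U.act V.act (regRep k H) ∘ₗ
    (TensorProduct.mk k (M ⊗[k] N) H).flip 1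

/-- For a Yetter-Drinfeld module `B` and left `H`-modules `P`, `R`, the middle-four interchange
`(B ⊗ B) ⊗ (P ⊗ R) → (B ⊗ P) ⊗ (B ⊗ R)`,
`(b ⊗ c) ⊗ (p ⊗ r) ↦ (y¹X¹·b ⊗ y²Y¹(x¹X²·c)₍₋₁₎x²X³₁·p) ⊗
  (y³₁Y²·(x¹X²·c)₍₀₎ ⊗ y³₂Y³x³X³₂·r)`. -/
def YDModule.interchange {Q : QuasiBialgebra k H} {B P R : Type*} [AddCommGroup B] [Module k B]
    [AddCommGroup P] [Module k P] [AddCommGroup R] [Module k R] (U : YDModule Q B)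
    (σ : H →ₐ[k] Module.End k P) (τ : H →ₐ[k] Module.End k R) :
    (B ⊗[k] B) ⊗[k] (P ⊗[k] R) →ₗ[k] (B ⊗[k] P) ⊗[k] (B ⊗[k] R) :=
  Q.assocInv U.act σ (Q.tensorRep U.act τ) ∘ₗ
    (Q.assocMap σ U.act τ ∘ₗ
      (braid U.coact σ).rTensor R ∘ₗ
      Q.assocInv U.act σ τ).lTensor B ∘ₗ
    Q.assocMap U.act U.act (Q.tensorRep σ τ)

/-- A Yetter-Drinfeld algebra: a unital algebra in the monoidal category of left
Yetter-Drinfeld modules. The multiplication is only associative up to the reassociator. -/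
structure YDAlgebra (Q : QuasiBialgebra k H) (B : Type*) [AddCommGroup B] [Module k B]
    extends YDModule Q B where
  /-- multiplication `b ⊗ b' ↦ bb'` -/
  mul : B ⊗[k] B →ₗ[k] B
  /-- unit `1_B` -/
  one : B
  one_mul : ∀ b : B, mul (one ⊗ₜ[k] b) = b
  mul_one : ∀ b : B, mul (b ⊗ₜ[k] one) = b
  /-- `h·(bb') = (h₁·b)(h₂·b')` -/
  act_mul : ∀ (h : H) (t : B ⊗[k] B), act h (mul t) = mul (Q.tensorRep act act h t)
  /-- `h·1_B = ε(h)1_B` -/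
  act_one : ∀ h : H, act h one = Q.counit h • one
  /-- `λ(1_B) = 1_H ⊗ 1_B` -/
  coact_one : coact one = (1 : H) ⊗ₜ[k] one
  /-- `(bb')b'' = (X¹·b)[(X²·b')(X³·b'')]` -/
  mul_assoc : ∀ t : (B ⊗[k] B) ⊗[k] B,
    mul (mul.rTensor B t) = mul (mul.lTensor B (Q.assocMap act act act t))
  /-- colinearity of the multiplication -/
  coact_mul : ∀ t : B ⊗[k] B,
    coact (mul t) = mul.lTensor H (toYDModule.tensorCoact toYDModule t)

/-- A Yetter-Drinfeld bialgebra: a bialgebra in the braided monoidal category of left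
Yetter-Drinfeld modules. -/
structure YDBialgebra (Q : QuasiBialgebra k H) (B : Type*) [AddCommGroup B] [Module k B]
    extends YDAlgebra Q B where
  /-- comultiplication `b ↦ b₁ ⊗ b₂` of `B` -/
  comul : B →ₗ[k] B ⊗[k] B
  /-- counit of `B` -/
  counit : B →ₗ[k] k
  /-- `Δ_B(h·b) = h₁·b₁ ⊗ h₂·b₂` -/
  comul_act : ∀ (h : H) (b : B), comul (act h b) = Q.tensorRep act act h (comul b)
  /-- `ε_B(h·b) = ε(h)ε_B(b)` -/
  counit_act : ∀ (h : H) (b : B), counit (act h b) = Q.counit h * counit b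
  /-- `ε_B(b₁)b₂ = b` -/
  counit_left : ∀ b : B, TensorProduct.lid k B (counit.rTensor B (comul b)) = b
  /-- `b₁ε_B(b₂) = b` -/
  counit_right : ∀ b : B, TensorProduct.rid k B (counit.lTensor B (comul b)) = b
  /-- `X¹·b₁₁ ⊗ X²·b₁₂ ⊗ X³·b₂ = b₁ ⊗ b₂₁ ⊗ b₂₂` -/
  coassoc : ∀ b : B,
    Q.assocMap act act act (comul.rTensor B (comul b)) = comul.lTensor B (comul b)
  /-- colinearity of the comultiplication -/
  coact_comul : ∀ b : B,
    comul.lTensor H (coact b) = toYDModule.tensorCoact toYDModule (comul b)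
  /-- colinearity of the counit: `ε_B(b₍₀₎)b₍₋₁₎ = ε_B(b)1` -/
  coact_counit : ∀ b : B,
    TensorProduct.rid k H (counit.lTensor H (coact b)) = counit b • (1 : H)
  /-- `Δ_B(1_B) = 1_B ⊗ 1_B` -/
  comul_one : comul one = one ⊗ₜ[k] one
  /-- `ε_B(1_B) = 1` -/
  counit_one : counit one = 1
  /-- `ε_B(bb') = ε_B(b)ε_B(b')` -/
  counit_mul : ∀ b b' : B, counit (mul (b ⊗ₜ[k] b')) = counit b * counit b'
  /-- `Δ_B` is multiplicative for the braided tensor product algebra `B ⊗ B` -/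
  comul_mul : ∀ b b' : B,
    comul (mul (b ⊗ₜ[k] b')) =
      TensorProduct.map mul mul (toYDModule.interchange act act (comul b ⊗ₜ[k] comul b'))

/-- A braided Hopf algebra: a Hopf algebra in the braided monoidal category of left
Yetter-Drinfeld modules. -/
structure YDHopfAlgebra (Q : QuasiBialgebra k H) (B : Type*) [AddCommGroup B] [Module k B]
    extends YDBialgebra Q B where
  /-- antipode of `B` -/
  antipode : B →ₗ[k] B
  antipode_act : ∀ (h : H) (b : B), antipode (act h b) = act h (antipode b)
  antipode_coact : ∀ b : B, coact (antipode b) = antipode.lTensor H (coact b)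
  /-- `S_B(b₁)b₂ = ε_B(b)1_B` -/
  antipode_left : ∀ b : B, mul (antipode.rTensor B (comul b)) = counit b • one
  /-- `b₁S_B(b₂) = ε_B(b)1_B` -/
  antipode_right : ∀ b : B, mul (antipode.lTensor B (comul b)) = counit b • one

end Modules

section Smash

variable {k : Type*} [Field k] {H : Type*} [Ring H] [Algebra k H] {Q : QuasiBialgebra k H}
  {B : Type*} [AddCommGroup B] [Module k B]

namespace YDAlgebra

/-- The action of `B` on `B ⊗ H`: `b ⊗ (b' ⊗ h) ↦ (x¹·b)(x²·b') ⊗ x³h`. -/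
def star (A : YDAlgebra Q B) : B ⊗[k] (B ⊗[k] H) →ₗ[k] B ⊗[k] H :=
  A.mul.rTensor H ∘ₗ Q.assocInv A.act A.act (regRep k H)

/-- The action of `H` on `B ⊗ H`: `h·(b' ⊗ h') = h₁·b' ⊗ h₂h'`. -/
def rep (A : YDAlgebra Q B) : H →ₐ[k] Module.End k (B ⊗[k] H) :=
  Q.tensorRep A.act (regRep k H)

/-- The multiplication of the smash product:
`(b ⊗ h)(b' ⊗ h') = (x¹·b)(x²h₁·b') ⊗ x³h₂h'`. -/
def smashMul (A : YDAlgebra Q B) : (B ⊗[k] H) ⊗[k] (B ⊗[k] H) →ₗ[k] B ⊗[k] H :=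
  A.star ∘ₗ (TensorProduct.lift A.rep.toLinearMap).lTensor B ∘ₗ
    (TensorProduct.assoc k B H (B ⊗[k] H)).toLinearMap

end YDAlgebra

end Smash

section Smash2

variable {k : Type*} [Field k] {H : Type*} [Ring H] [Algebra k H]

namespace QuasiBialgebra

/-- `Φ` -/
abbrev phi (Q : QuasiBialgebra k H) : H ⊗[k] (H ⊗[k] H) := (Q.reassoc : H ⊗[k] (H ⊗[k] H))

/-- `Φ⁻¹` -/
abbrev phiInv (Q : QuasiBialgebra k H) : H ⊗[k] (H ⊗[k] H) :=
  ((Q.reassoc⁻¹ : (H ⊗[k] (H ⊗[k] H))ˣ) : H ⊗[k] (H ⊗[k] H))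

theorem map_phi_mul {A : Type*} [Semiring A] [Algebra k A] (Q : QuasiBialgebra k H)
    (f : H ⊗[k] (H ⊗[k] H) →ₐ[k] A) : f Q.phi * f Q.phiInv = 1 := by
  rw [← map_mul, Units.mul_inv]; exact map_one f

theorem map_phiInv_mul {A : Type*} [Semiring A] [Algebra k A] (Q : QuasiBialgebra k H)
    (f : H ⊗[k] (H ⊗[k] H) →ₐ[k] A) : f Q.phiInv * f Q.phi = 1 := by
  rw [← map_mul, Units.inv_mul]; exact map_one f

/-- `t ↦ 1 ⊗ t` -/
def i1 (k H : Type*) [Field k] [Ring H] [Algebra k H] :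
    H ⊗[k] (H ⊗[k] H) →ₐ[k] H ⊗[k] (H ⊗[k] (H ⊗[k] H)) :=
  Algebra.TensorProduct.includeRight

/-- `t ↦ t ⊗ 1` -/
def i4 (k H : Type*) [Field k] [Ring H] [Algebra k H] :
    H ⊗[k] (H ⊗[k] H) →ₐ[k] H ⊗[k] (H ⊗[k] (H ⊗[k] H)) :=
  Algebra.TensorProduct.map (AlgHom.id k H)
    (Algebra.TensorProduct.map (AlgHom.id k H) Algebra.TensorProduct.includeLeft)

/-- `Δ ⊗ Id ⊗ Id` -/
def d1 (Q : QuasiBialgebra k H) : H ⊗[k] (H ⊗[k] H) →ₐ[k] H ⊗[k] (H ⊗[k] (H ⊗[k] H)) :=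
  (Algebra.TensorProduct.assoc k k k H H (H ⊗[k] H)).toAlgHom.comp
    (Algebra.TensorProduct.map Q.comul (AlgHom.id k _))

/-- `Id ⊗ Δ ⊗ Id` -/
def d2 (Q : QuasiBialgebra k H) : H ⊗[k] (H ⊗[k] H) →ₐ[k] H ⊗[k] (H ⊗[k] (H ⊗[k] H)) :=
  Algebra.TensorProduct.map (AlgHom.id k H)
    ((Algebra.TensorProduct.assoc k k k H H H).toAlgHom.comp
      (Algebra.TensorProduct.map Q.comul (AlgHom.id k _)))

/-- `Id ⊗ Id ⊗ Δ` -/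
def d3 (Q : QuasiBialgebra k H) : H ⊗[k] (H ⊗[k] H) →ₐ[k] H ⊗[k] (H ⊗[k] (H ⊗[k] H)) :=
  Algebra.TensorProduct.map (AlgHom.id k H) (Algebra.TensorProduct.map (AlgHom.id k H) Q.comul)

theorem pentagon' (Q : QuasiBialgebra k H) :
    i1 k H Q.phi * d2 Q Q.phi * i4 k H Q.phi = d3 Q Q.phi * d1 Q Q.phi := Q.pentagon

theorem inv_of_pentagon {M : Type*} [Monoid M] {a a' b b' c d d' e e' : M}
    (ha : a' * a = 1) (hb : b' * b = 1) (hd : d * d' = 1) (he : e * e' = 1)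
    (h : a * b * c = d * e) : b' * a' = c * (e' * d') := by
  have e1 : c = b' * a' * (d * e) := by
    rw [← h]
    calc c = b' * (a' * a) * b * c := by rw [ha, mul_one, hb, one_mul]
      _ = _ := by simp only [mul_assoc]
  rw [e1]
  calc b' * a' = b' * a' * (d * (e * e') * d') := by rw [he, mul_one, hd, mul_one]
    _ = _ := by simp only [mul_assoc]

theorem pentagon_inv (Q : QuasiBialgebra k H) :
    d2 Q Q.phiInv * i1 k H Q.phiInv = i4 k H Q.phi * (d1 Q Q.phiInv * d3 Q Q.phiInv) :=
  inv_of_pentagon (M := H ⊗[k] (H ⊗[k] (H ⊗[k] H))) (Q.map_phiInv_mul (i1 k H)) (Q.map_phiInv_mul (d2 Q)) (Q.map_phi_mul (d3 Q))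
    (Q.map_phi_mul (d1 Q)) Q.pentagon'

/-- `ε ⊗ Id ⊗ Id` -/
def e1 (Q : QuasiBialgebra k H) : H ⊗[k] (H ⊗[k] H) →ₐ[k] H ⊗[k] H :=
  (Algebra.TensorProduct.lid k (H ⊗[k] H)).toAlgHom.comp
    (Algebra.TensorProduct.map Q.counit (AlgHom.id k _))

/-- `Id ⊗ ε ⊗ Id` -/
def e2 (Q : QuasiBialgebra k H) : H ⊗[k] (H ⊗[k] H) →ₐ[k] H ⊗[k] H :=
  Algebra.TensorProduct.map (AlgHom.id k H)
    ((Algebra.TensorProduct.lid k H).toAlgHom.comp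
      (Algebra.TensorProduct.map Q.counit (AlgHom.id k _)))

/-- `Id ⊗ ε ⊗ Id ⊗ Id` -/
def f2 (Q : QuasiBialgebra k H) : H ⊗[k] (H ⊗[k] (H ⊗[k] H)) →ₐ[k] H ⊗[k] (H ⊗[k] H) :=
  Algebra.TensorProduct.map (AlgHom.id k H) (e1 Q)

theorem e2_reassoc (Q : QuasiBialgebra k H) : e2 Q Q.phi = 1 := Q.reassoc_normalized

theorem f2_i1 (Q : QuasiBialgebra k H) (t : H ⊗[k] (H ⊗[k] H)) :
    f2 Q (i1 k H t) = 1 ⊗ₜ e1 Q t := rfl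

theorem f2_i4 (Q : QuasiBialgebra k H) (t : H ⊗[k] (H ⊗[k] H)) :
    f2 Q (i4 k H t) = Algebra.TensorProduct.map (AlgHom.id k H)
      Algebra.TensorProduct.includeLeft (e2 Q t) := by
  refine TensorProduct.induction_on t (by simp) (fun a t => ?_) (fun x y hx hy => by simp [hx, hy])
  refine TensorProduct.induction_on t (by simp) (fun c d => ?_)
    (fun x y hx hy => by simp [hx, hy, TensorProduct.tmul_add])
  have h : (Q.counit c • (d ⊗ₜ[k] (1 : H))) = (Q.counit c • d) ⊗ₜ[k] (1 : H) := rfl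
  exact congrArg (fun z => a ⊗ₜ[k] z) h

theorem f2_d3 (Q : QuasiBialgebra k H) (t : H ⊗[k] (H ⊗[k] H)) :
    f2 Q (d3 Q t) = Algebra.TensorProduct.map (AlgHom.id k H) Q.comul (e2 Q t) := by
  refine TensorProduct.induction_on t (by simp) (fun a t => ?_) (fun x y hx hy => by simp [hx, hy])
  refine TensorProduct.induction_on t (by simp) (fun c d => ?_)
    (fun x y hx hy => by simp [hx, hy, TensorProduct.tmul_add])
  simp [f2, d3, e1, e2]

theorem e1_assoc (Q : QuasiBialgebra k H) (u : H ⊗[k] H) (d : H) :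
    e1 Q (TensorProduct.assoc k H H H (u ⊗ₜ d)) =
      (TensorProduct.lid k H (TensorProduct.map Q.counit.toLinearMap LinearMap.id u)) ⊗ₜ d := by
  refine TensorProduct.induction_on u (by simp) (fun a b => ?_)
    (fun x y hx hy => by simp [TensorProduct.add_tmul, hx, hy])
  simp [e1, TensorProduct.smul_tmul']

theorem f2_d2 (Q : QuasiBialgebra k H) (t : H ⊗[k] (H ⊗[k] H)) : f2 Q (d2 Q t) = t := by
  refine TensorProduct.induction_on t (by simp) (fun a t => ?_) (fun x y hx hy => by simp [hx, hy])
  refine TensorProduct.induction_on t (by simp) (fun c d => ?_)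
    (fun x y hx hy => by rw [TensorProduct.tmul_add, map_add, map_add, hx, hy])
  have : f2 Q (d2 Q (a ⊗ₜ (c ⊗ₜ d))) = a ⊗ₜ e1 Q (TensorProduct.assoc k H H H (Q.comul c ⊗ₜ d)) := rfl
  rw [this, e1_assoc, Q.counit_left]

theorem f2_d1 (Q : QuasiBialgebra k H) (t : H ⊗[k] (H ⊗[k] H)) : f2 Q (d1 Q t) = t := by
  refine TensorProduct.induction_on t (by simp) (fun a t => ?_) (fun x y hx hy => by simp [hx, hy])
  have h : ∀ u : H ⊗[k] H, f2 Q (TensorProduct.assoc k H H (H ⊗[k] H) (u ⊗ₜ t)) =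
      (TensorProduct.rid k H (TensorProduct.map LinearMap.id Q.counit.toLinearMap u)) ⊗ₜ t := by
    intro u
    refine TensorProduct.induction_on u (by simp) (fun a b => ?_)
      (fun x y hx hy => by simp [TensorProduct.add_tmul, hx, hy])
    simp [f2, e1, TensorProduct.smul_tmul']
  have h2 := h (Q.comul a)
  rw [Q.counit_right] at h2
  exact h2

theorem e1_reassoc (Q : QuasiBialgebra k H) : e1 Q Q.phi = 1 := by
  have h := congrArg (f2 Q) Q.pentagon'
  simp only [map_mul, f2_i1, f2_i4, f2_d1, f2_d2, f2_d3, e2_reassoc, map_one, mul_one,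
    one_mul] at h
  have h2 : (1 : H) ⊗ₜ[k] e1 Q Q.phi = 1 := by
    have := congrArg (· * Q.phiInv) h
    simpa [mul_assoc] using this
  have h3 := congrArg (e1 Q) h2
  simpa [e1] using h3

theorem e1_reassoc_inv (Q : QuasiBialgebra k H) : e1 Q Q.phiInv = 1 := by
  have h : e1 Q Q.phi * e1 Q Q.phiInv = 1 := Q.map_phi_mul _
  rwa [e1_reassoc, one_mul] at h

theorem e2_reassoc_inv (Q : QuasiBialgebra k H) : e2 Q Q.phiInv = 1 := by
  have h : e2 Q Q.phi * e2 Q Q.phiInv = 1 := Q.map_phi_mul _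
  rwa [e2_reassoc, one_mul] at h

end QuasiBialgebra
end Smash2

section Smash3

variable {k : Type*} [Field k] {H : Type*} [Ring H] [Algebra k H] {Q : QuasiBialgebra k H}
  {B : Type*} [AddCommGroup B] [Module k B]

theorem boxRep_comp {C D M N : Type*} [Ring C] [Algebra k C] [Ring D] [Algebra k D]
    [AddCommGroup M] [Module k M] [AddCommGroup N] [Module k N]
    (ρ : H →ₐ[k] Module.End k M) (σ : C →ₐ[k] Module.End k N) (f : D →ₐ[k] C)
    (u : H ⊗[k] D) :
    boxRep ρ (σ.comp f) u =
      boxRep ρ σ (Algebra.TensorProduct.map (AlgHom.id k H) f u) := by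
  refine TensorProduct.induction_on u (by simp) (fun a b => rfl) (fun x y hx hy => ?_)
  rw [map_add, map_add, map_add, hx, hy]

theorem boxRep_one_tmul {C M N : Type*} [Ring C] [Algebra k C]
    [AddCommGroup M] [Module k M] [AddCommGroup N] [Module k N]
    (ρ : H →ₐ[k] Module.End k M) (σ : C →ₐ[k] Module.End k N) (c : C) :
    boxRep ρ σ (1 ⊗ₜ c) = (σ c).lTensor M := by
  refine TensorProduct.ext' fun m n => ?_
  simp

namespace YDAlgebra

/-- `b ⊗ (b' ⊗ p) ↦ bb' ⊗ p` -/
def mulLeft (A : YDAlgebra Q B) (P : Type*) [AddCommGroup P] [Module k P] :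
    B ⊗[k] (B ⊗[k] P) →ₗ[k] B ⊗[k] P :=
  A.mul.rTensor P ∘ₗ (TensorProduct.assoc k B B P).symm.toLinearMap

theorem boxRep_mulLeft (A : YDAlgebra Q B) {C P : Type*} [Ring C] [Algebra k C]
    [AddCommGroup P] [Module k P] (τ : C →ₐ[k] Module.End k P) (u : H ⊗[k] C)
    (w : B ⊗[k] (B ⊗[k] P)) :
    boxRep A.act τ u (A.mulLeft P w) =
      A.mulLeft P (boxRep A.act (boxRep A.act τ)
        (TensorProduct.assoc k H H C (TensorProduct.map Q.comul.toLinearMap LinearMap.id u)) w) := by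
  have hB : ∀ (x : H ⊗[k] H) (c : C) (b b' : B) (p : P),
      A.mulLeft P (boxRep A.act (boxRep A.act τ) (TensorProduct.assoc k H H C (x ⊗ₜ c))
        (b ⊗ₜ (b' ⊗ₜ p))) = A.mul (boxRep A.act A.act x (b ⊗ₜ b')) ⊗ₜ τ c p := by
    intro x c b b' p
    refine TensorProduct.induction_on x (by simp) (fun y z => by simp [mulLeft]) ?_
    intro y z hy hz
    simp only [TensorProduct.add_tmul, map_add, LinearMap.add_apply, hy, hz]
  refine TensorProduct.induction_on u (by simp) (fun h c => ?_) ?_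
  · refine TensorProduct.induction_on w (by simp) (fun b w => ?_)
      (fun x y hx hy => by simp only [map_add, hx, hy])
    refine TensorProduct.induction_on w (by simp) (fun b' p => ?_)
      (fun x y hx hy => by simp only [TensorProduct.tmul_add, map_add, hx, hy])
    have h1 := A.act_mul h (b ⊗ₜ b')
    refine Eq.trans ?_ (hB (Q.comul h) c b b' p).symm
    simp only [mulLeft, LinearMap.comp_apply, LinearEquiv.coe_coe, TensorProduct.assoc_symm_tmul,
      LinearMap.rTensor_tmul, boxRep_tmul, h1]
    rfl
  · intro x y hx hy
    simp only [map_add, LinearMap.add_apply, hx, hy]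

theorem star_apply (A : YDAlgebra Q B) (t : B ⊗[k] (B ⊗[k] H)) :
    A.star t = A.mulLeft H (boxRep A.act (boxRep A.act (regRep k H)) Q.phiInv t) := rfl

theorem rep_star (A : YDAlgebra Q B) (h : H) (t : B ⊗[k] (B ⊗[k] H)) :
    A.rep h (A.star t) = A.star (Q.tensorRep A.act A.rep h t) := by
  have e1 : A.rep h (A.star t) = boxRep A.act (regRep k H) (Q.comul h) (A.star t) := rfl
  have e2 : Q.tensorRep A.act A.rep h t = boxRep A.act (boxRep A.act (regRep k H))
      (TensorProduct.map LinearMap.id Q.comul.toLinearMap (Q.comul h)) t :=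
    congrArg (fun f => f t) (boxRep_comp A.act (boxRep A.act (regRep k H)) Q.comul (Q.comul h))
  rw [e1, e2, star_apply, boxRep_mulLeft, star_apply, ← Module.End.mul_apply, ← map_mul,
    ← Module.End.mul_apply, ← map_mul, Q.quasi_coassoc]
  congr 3
  rw [← _root_.mul_assoc, ← _root_.mul_assoc, Units.inv_mul, _root_.one_mul]

theorem star_star (A : YDAlgebra Q B) (v : B ⊗[k] (B ⊗[k] (B ⊗[k] H))) :
    A.star (A.star.lTensor B v) =
      A.star (A.mul.rTensor (B ⊗[k] H) (Q.assocInv A.act A.act A.rep v)) := by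
  set R3 := boxRep A.act (boxRep A.act (regRep k H)) with hR3
  set R4 := boxRep A.act R3 with hR4
  have l1 : A.star.lTensor B v =
      (A.mulLeft H).lTensor B (R4 (QuasiBialgebra.i1 k H Q.phiInv) v) := by
    have : R4 (QuasiBialgebra.i1 k H Q.phiInv) = (R3 Q.phiInv).lTensor B :=
      boxRep_one_tmul A.act R3 Q.phiInv
    rw [this, ← LinearMap.lTensor_comp_apply]
    rfl
  have l2 : ∀ (t : H ⊗[k] (H ⊗[k] H)) (v : B ⊗[k] (B ⊗[k] (B ⊗[k] H))),
      R3 t ((A.mulLeft H).lTensor B v) = (A.mulLeft H).lTensor B (R4 (QuasiBialgebra.d2 Q t) v) := by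
    intro t v
    refine TensorProduct.induction_on t (by simp) (fun a u => ?_) ?_
    · refine TensorProduct.induction_on v (by simp) (fun b w => ?_)
        (fun x y hx hy => by simp only [map_add, hx, hy])
      exact congrArg (fun z => A.act a b ⊗ₜ[k] z) (A.boxRep_mulLeft (regRep k H) u w)
    · intro x y hx hy
      simp only [map_add, LinearMap.add_apply, hx, hy]
  have lhs : A.star (A.star.lTensor B v) = A.mulLeft H ((A.mulLeft H).lTensor B
      (R4 (QuasiBialgebra.d2 Q Q.phiInv * QuasiBialgebra.i1 k H Q.phiInv) v)) := by
    rw [l1, star_apply, l2]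
    congr 2
    exact (congrArg (fun f => f v) (map_mul R4 _ _)).symm
  have r1 : A.mul.rTensor (B ⊗[k] H) (Q.assocInv A.act A.act A.rep v) =
      A.mulLeft (B ⊗[k] H) (R4 (QuasiBialgebra.d3 Q Q.phiInv) v) := by
    have : boxRep A.act (boxRep A.act A.rep) Q.phiInv = R4 (QuasiBialgebra.d3 Q Q.phiInv) := by
      have h2 : boxRep A.act A.rep = R3.comp
          (Algebra.TensorProduct.map (AlgHom.id k H) Q.comul) :=
        AlgHom.ext fun u => boxRep_comp A.act (boxRep A.act (regRep k H)) Q.comul u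
      rw [h2]
      exact boxRep_comp A.act R3 _ _
    rw [← this]
    rfl
  have rhs : A.star (A.mul.rTensor (B ⊗[k] H) (Q.assocInv A.act A.act A.rep v)) =
      A.mulLeft H (A.mulLeft (B ⊗[k] H)
        (R4 (QuasiBialgebra.d1 Q Q.phiInv * QuasiBialgebra.d3 Q Q.phiInv) v)) := by
    rw [r1, star_apply, A.boxRep_mulLeft (boxRep A.act (regRep k H))]
    congr 2
    exact (congrArg (fun f => f v) (map_mul R4 _ _)).symm
  have m : ∀ v : B ⊗[k] (B ⊗[k] (B ⊗[k] H)),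
      A.mulLeft H (A.mulLeft (B ⊗[k] H) v) =
        A.mulLeft H ((A.mulLeft H).lTensor B (R4 (QuasiBialgebra.i4 k H Q.phi) v)) := by
    intro v
    refine TensorProduct.induction_on v (by simp) (fun b w => ?_)
      (fun x y hx hy => by simp only [map_add, hx, hy])
    refine TensorProduct.induction_on w (by simp) (fun b' w => ?_)
      (fun x y hx hy => by simp only [TensorProduct.tmul_add, map_add, hx, hy])
    refine TensorProduct.induction_on w (by simp) (fun b'' h => ?_)
      (fun x y hx hy => by simp only [TensorProduct.tmul_add, map_add, hx, hy])
    have g : ∀ t : H ⊗[k] (H ⊗[k] H),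
        A.mulLeft H ((A.mulLeft H).lTensor B (R4 (QuasiBialgebra.i4 k H t)
          (b ⊗ₜ (b' ⊗ₜ (b'' ⊗ₜ h))))) =
        A.mul (A.mul.lTensor B (boxRep A.act (boxRep A.act A.act) t (b ⊗ₜ (b' ⊗ₜ b'')))) ⊗ₜ h := by
      intro t
      refine TensorProduct.induction_on t (by simp) (fun a u => ?_)
        (fun x y hx hy => by
          simp only [map_add, LinearMap.add_apply, TensorProduct.add_tmul, hx, hy])
      refine TensorProduct.induction_on u (by simp) (fun c d => ?_)
        (fun x y hx hy => by
          simp only [TensorProduct.tmul_add, map_add, LinearMap.add_apply,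
            TensorProduct.add_tmul, hx, hy])
      simp [hR4, hR3, QuasiBialgebra.i4, mulLeft]
    rw [g]
    have := A.mul_assoc ((b ⊗ₜ b') ⊗ₜ b'')
    refine Eq.trans ?_ (congrArg (fun z => z ⊗ₜ[k] h) this)
    rfl
  rw [lhs, rhs, m, QuasiBialgebra.pentagon_inv]
  congr 2
  exact congrArg (fun f => f v) (map_mul R4 _ _)

theorem smashMul_tmul (A : YDAlgebra Q B) (b : B) (h : H) (w : B ⊗[k] H) :
    A.smashMul ((b ⊗ₜ h) ⊗ₜ w) = A.star (b ⊗ₜ A.rep h w) := rfl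

theorem smashMul_rep (A : YDAlgebra Q B) (h : H) (v w : B ⊗[k] H) :
    A.smashMul (A.rep h v ⊗ₜ w) = A.rep h (A.smashMul (v ⊗ₜ w)) := by
  refine TensorProduct.induction_on v (by simp) (fun b g => ?_)
    (fun x y hx hy => by simp only [TensorProduct.add_tmul, map_add, hx, hy])
  rw [smashMul_tmul, rep_star]
  have : ∀ u : H ⊗[k] H, A.smashMul (boxRep A.act (regRep k H) u (b ⊗ₜ g) ⊗ₜ w) =
      A.star (boxRep A.act A.rep u (b ⊗ₜ A.rep g w)) := by
    intro u
    refine TensorProduct.induction_on u (by simp) (fun x y => ?_)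
      (fun x y hx hy => by
        simp only [TensorProduct.add_tmul, map_add, LinearMap.add_apply, hx, hy])
    simp [smashMul_tmul]
  exact this (Q.comul h)

theorem smashMul_star (A : YDAlgebra Q B) (b : B) (v w : B ⊗[k] H) :
    A.smashMul (A.star (b ⊗ₜ v) ⊗ₜ w) = A.star (b ⊗ₜ A.smashMul (v ⊗ₜ w)) := by
  refine TensorProduct.induction_on v (by simp) (fun b' h => ?_)
    (fun x y hx hy => by
      simp only [TensorProduct.add_tmul, TensorProduct.tmul_add, map_add, hx, hy])
  rw [smashMul_tmul]
  have h1 := A.star_star (b ⊗ₜ (b' ⊗ₜ A.rep h w))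
  rw [LinearMap.lTensor_tmul] at h1
  rw [h1]
  have : ∀ t : H ⊗[k] (H ⊗[k] H),
      A.smashMul (A.mulLeft H (boxRep A.act (boxRep A.act (regRep k H)) t
        (b ⊗ₜ (b' ⊗ₜ h))) ⊗ₜ w) =
      A.star (A.mulLeft (B ⊗[k] H) (boxRep A.act (boxRep A.act A.rep) t
        (b ⊗ₜ (b' ⊗ₜ A.rep h w)))) := by
    intro t
    refine TensorProduct.induction_on t (by simp) (fun a u => ?_)
      (fun x y hx hy => by
        simp only [TensorProduct.add_tmul, map_add, LinearMap.add_apply, hx, hy])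
    refine TensorProduct.induction_on u (by simp) (fun c d => ?_)
      (fun x y hx hy => by
        simp only [TensorProduct.add_tmul, TensorProduct.tmul_add, map_add, LinearMap.add_apply,
          hx, hy])
    simp [mulLeft, smashMul_tmul]
  exact this Q.phiInv

theorem smashMul_assoc (A : YDAlgebra Q B) (u v w : B ⊗[k] H) :
    A.smashMul (A.smashMul (u ⊗ₜ v) ⊗ₜ w) = A.smashMul (u ⊗ₜ A.smashMul (v ⊗ₜ w)) := by
  refine TensorProduct.induction_on u (by simp) (fun b h => ?_)
    (fun x y hx hy => by simp only [TensorProduct.add_tmul, map_add, hx, hy])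
  rw [smashMul_tmul, smashMul_tmul, smashMul_star, smashMul_rep]

theorem one_smashMul (A : YDAlgebra Q B) (w : B ⊗[k] H) :
    A.smashMul ((A.one ⊗ₜ 1) ⊗ₜ w) = w := by
  rw [smashMul_tmul, map_one, Module.End.one_apply, star_apply]
  refine TensorProduct.induction_on w (by simp) (fun b h => ?_)
    (fun x y hx hy => by simp only [TensorProduct.tmul_add, map_add, hx, hy])
  have : ∀ t : H ⊗[k] (H ⊗[k] H),
      A.mulLeft H (boxRep A.act (boxRep A.act (regRep k H)) t (A.one ⊗ₜ (b ⊗ₜ h))) =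
        boxRep A.act (regRep k H) (QuasiBialgebra.e1 Q t) (b ⊗ₜ h) := by
    intro t
    refine TensorProduct.induction_on t (by simp) (fun a u => ?_)
      (fun x y hx hy => by simp only [map_add, LinearMap.add_apply, hx, hy])
    refine TensorProduct.induction_on u (by simp) (fun c d => ?_)
      (fun x y hx hy => by
        simp only [TensorProduct.tmul_add, map_add, LinearMap.add_apply, hx, hy])
    have e : QuasiBialgebra.e1 Q (a ⊗ₜ (c ⊗ₜ d)) = Q.counit a • (c ⊗ₜ d) := rfl
    rw [e]
    simp [mulLeft, A.act_one, A.one_mul, ← TensorProduct.smul_tmul']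
  rw [this, QuasiBialgebra.e1_reassoc_inv]
  simp

theorem smashMul_one (A : YDAlgebra Q B) (w : B ⊗[k] H) :
    A.smashMul (w ⊗ₜ (A.one ⊗ₜ 1)) = w := by
  refine TensorProduct.induction_on w (by simp) (fun b h => ?_)
    (fun x y hx hy => by simp only [TensorProduct.add_tmul, map_add, hx, hy])
  have h0 : A.rep h (A.one ⊗ₜ 1) = A.one ⊗ₜ h := by
    have : ∀ u : H ⊗[k] H, boxRep A.act (regRep k H) u (A.one ⊗ₜ 1) =
        A.one ⊗ₜ (TensorProduct.lid k H
          (TensorProduct.map Q.counit.toLinearMap LinearMap.id u)) := by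
      intro u
      refine TensorProduct.induction_on u (by simp) (fun x y => ?_)
        (fun x y hx hy => by
          simp only [TensorProduct.tmul_add, map_add, LinearMap.add_apply, hx, hy])
      simp [A.act_one, TensorProduct.smul_tmul]
    have h1 := this (Q.comul h)
    rw [Q.counit_left] at h1
    exact h1
  rw [smashMul_tmul, h0, star_apply]
  have : ∀ t : H ⊗[k] (H ⊗[k] H),
      A.mulLeft H (boxRep A.act (boxRep A.act (regRep k H)) t (b ⊗ₜ (A.one ⊗ₜ h))) =
        boxRep A.act (regRep k H) (QuasiBialgebra.e2 Q t) (b ⊗ₜ h) := by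
    intro t
    refine TensorProduct.induction_on t (by simp) (fun a u => ?_)
      (fun x y hx hy => by simp only [map_add, LinearMap.add_apply, hx, hy])
    refine TensorProduct.induction_on u (by simp) (fun c d => ?_)
      (fun x y hx hy => by
        simp only [TensorProduct.tmul_add, map_add, LinearMap.add_apply, hx, hy])
    have e : QuasiBialgebra.e2 Q (a ⊗ₜ (c ⊗ₜ d)) = a ⊗ₜ (Q.counit c • d) := rfl
    rw [e]
    simp [mulLeft, A.act_one, A.mul_one, ← TensorProduct.smul_tmul']
  rw [this, QuasiBialgebra.e2_reassoc_inv]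
  simp

end YDAlgebra

/-- The biproduct `B × H` of a braided Hopf algebra `B` in the category of left Yetter-Drinfeld
modules over `H`, as a `k`-algebra: the vector space `B ⊗ H` with the smash product
multiplication. -/
def Biproduct (_A : YDHopfAlgebra Q B) : Type _ := B ⊗[k] H

namespace Biproduct

variable (A : YDHopfAlgebra Q B)

instance : AddCommGroup (Biproduct A) := inferInstanceAs (AddCommGroup (B ⊗[k] H))

instance : Module k (Biproduct A) := inferInstanceAs (Module k (B ⊗[k] H))

/-- `(b × h)(b' × h') = (x¹·b)(x²h₁·b') × x³h₂h'`, with unit `1_B × 1`. -/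
instance : Ring (Biproduct A) :=
  { (inferInstance : AddCommGroup (Biproduct A)) with
    mul := fun u v => A.toYDAlgebra.smashMul (u ⊗ₜ v)
    one := (A.one ⊗ₜ (1 : H) : B ⊗[k] H)
    mul_assoc := A.toYDAlgebra.smashMul_assoc
    one_mul := A.toYDAlgebra.one_smashMul
    mul_one := A.toYDAlgebra.smashMul_one
    left_distrib := fun u v w =>
      (congrArg A.toYDAlgebra.smashMul (TensorProduct.tmul_add u v w)).trans (map_add _ _ _)
    right_distrib := fun u v w =>
      (congrArg A.toYDAlgebra.smashMul (TensorProduct.add_tmul u v w)).trans (map_add _ _ _)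
    zero_mul := fun u =>
      (congrArg A.toYDAlgebra.smashMul (TensorProduct.zero_tmul _ u)).trans (map_zero _)
    mul_zero := fun u =>
      (congrArg A.toYDAlgebra.smashMul (TensorProduct.tmul_zero _ u)).trans (map_zero _) }

instance : Algebra k (Biproduct A) :=
  Algebra.ofModule
    (fun r (u v : B ⊗[k] H) =>
      (congrArg A.toYDAlgebra.smashMul (TensorProduct.smul_tmul' r u v).symm).trans
        (LinearMap.map_smul A.toYDAlgebra.smashMul r (u ⊗ₜ v)))
    (fun r (u v : B ⊗[k] H) =>
      (congrArg A.toYDAlgebra.smashMul (TensorProduct.tmul_smul r u v)).trans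
        (LinearMap.map_smul A.toYDAlgebra.smashMul r (u ⊗ₜ v)))

end Biproduct
end Smash3

section Twist

variable {k : Type*} [Field k] {H : Type*} [Ring H] [Algebra k H]

namespace QuasiBialgebra

/-- A twist (gauge transformation): an invertible `F = F¹ ⊗ F²` with
`ε(F¹)F² = 1 = ε(F²)F¹`. -/
def IsTwist (Q : QuasiBialgebra k H) (F : (H ⊗[k] H)ˣ) : Prop :=
  TensorProduct.lid k H (TensorProduct.map Q.counit.toLinearMap LinearMap.id
    (F : H ⊗[k] H)) = 1 ∧
  TensorProduct.rid k H (TensorProduct.map LinearMap.id Q.counit.toLinearMap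
    (F : H ⊗[k] H)) = 1

/-- `Δ_F(h) = F Δ(h) F⁻¹` -/
def twistComul (Q : QuasiBialgebra k H) (F : (H ⊗[k] H)ˣ) (h : H) : H ⊗[k] H :=
  (F : H ⊗[k] H) * Q.comul h * ((F⁻¹ : (H ⊗[k] H)ˣ) : H ⊗[k] H)

/-- `Φ_F = (1 ⊗ F)(Id ⊗ Δ)(F) Φ (Δ ⊗ Id)(F⁻¹)(F⁻¹ ⊗ 1)` -/
def twistReassoc (Q : QuasiBialgebra k H) (F : (H ⊗[k] H)ˣ) : H ⊗[k] (H ⊗[k] H) :=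
  ((1 : H) ⊗ₜ[k] (F : H ⊗[k] H)) *
    TensorProduct.map LinearMap.id Q.comul.toLinearMap (F : H ⊗[k] H) *
    (Q.reassoc : H ⊗[k] (H ⊗[k] H)) *
    TensorProduct.assoc k H H H (TensorProduct.map Q.comul.toLinearMap LinearMap.id
      ((F⁻¹ : (H ⊗[k] H)ˣ) : H ⊗[k] H)) *
    TensorProduct.assoc k H H H (((F⁻¹ : (H ⊗[k] H)ˣ) : H ⊗[k] H) ⊗ₜ[k] (1 : H))

end QuasiBialgebra

namespace QuasiHopfAlgebra

/-- `α_F = S(G¹) α G²` where `F⁻¹ = G¹ ⊗ G²` -/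
def twistAlpha (Q : QuasiHopfAlgebra k H) (F : (H ⊗[k] H)ˣ) : H :=
  LinearMap.mul' k H (TensorProduct.map (LinearMap.mulRight k Q.alpha ∘ₗ Q.antipode)
    LinearMap.id ((F⁻¹ : (H ⊗[k] H)ˣ) : H ⊗[k] H))

/-- `β_F = F¹ β S(F²)` -/
def twistBeta (Q : QuasiHopfAlgebra k H) (F : (H ⊗[k] H)ˣ) : H :=
  LinearMap.mul' k H (TensorProduct.map (LinearMap.mulRight k Q.beta) Q.antipode
    (F : H ⊗[k] H))

/-- Twist equivalence of quasi-Hopf algebras: there are a twist `F` for `H'` and an isomorphism of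
quasi-Hopf algebras from `H` to `H'_F = (H', Δ'_F, ε', Φ'_F, S', α'_F, β'_F)`. -/
def TwistEquivalent (Q : QuasiHopfAlgebra k H) {H' : Type*} [Ring H'] [Algebra k H']
    (Q' : QuasiHopfAlgebra k H') : Prop :=
  ∃ (F : (H' ⊗[k] H')ˣ) (f : H ≃ₐ[k] H'),
    Q'.IsTwist F ∧
    (∀ h : H, TensorProduct.map f.toLinearMap f.toLinearMap (Q.comul h) =
      Q'.twistComul F (f h)) ∧
    (∀ h : H, Q'.counit (f h) = Q.counit h) ∧
    TensorProduct.map f.toLinearMap (TensorProduct.map f.toLinearMap f.toLinearMap)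
      (Q.reassoc : H ⊗[k] (H ⊗[k] H)) = Q'.twistReassoc F ∧
    (∀ h : H, f (Q.antipode h) = Q'.antipode (f h)) ∧
    f Q.alpha = Q'.twistAlpha F ∧
    f Q.beta = Q'.twistBeta F

/-- The quasi-Hopf algebra obtained by replacing `(α, β)` by `(cα, c⁻¹β)` for a nonzero
scalar `c`. -/
def rescale (Q : QuasiHopfAlgebra k H) (c : kˣ) : QuasiHopfAlgebra k H where
  toQuasiBialgebra := Q.toQuasiBialgebra
  antipode := Q.antipode
  alpha := (c : k) • Q.alpha
  beta := ((c⁻¹ : kˣ) : k) • Q.beta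
  antipode_one := Q.antipode_one
  antipode_mul := Q.antipode_mul
  antipode_left := fun h => by
    have e : LinearMap.mulRight k ((c : k) • Q.alpha) ∘ₗ Q.antipode =
        (c : k) • (LinearMap.mulRight k Q.alpha ∘ₗ Q.antipode) := by ext; simp
    rw [e, TensorProduct.map_smul_left, LinearMap.smul_apply, map_smul, Q.antipode_left,
      smul_comm]
  antipode_right := fun h => by
    have e : LinearMap.mulRight k (((c⁻¹ : kˣ) : k) • Q.beta) =
        ((c⁻¹ : kˣ) : k) • LinearMap.mulRight k Q.beta := by ext; simp
    rw [e, TensorProduct.map_smul_left, LinearMap.smul_apply, map_smul, Q.antipode_right,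
      smul_comm]
  reassoc_antipode := by
    have e : LinearMap.mulRight k ((c : k) • Q.alpha) ∘ₗ Q.antipode =
        (c : k) • (LinearMap.mulRight k Q.alpha ∘ₗ Q.antipode) := by ext; simp
    have e' : LinearMap.mulRight k (((c⁻¹ : kˣ) : k) • Q.beta) =
        ((c⁻¹ : kˣ) : k) • LinearMap.mulRight k Q.beta := by ext; simp
    rw [e, e', TensorProduct.map_smul_left, TensorProduct.map_smul_left, LinearMap.comp_smul,
      TensorProduct.map_smul_right, LinearMap.smul_apply, LinearMap.smul_apply, map_smul, map_smul,
      Q.reassoc_antipode, smul_smul, ← Units.val_mul, inv_mul_cancel, Units.val_one, one_smul]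
  reassoc_inv_antipode := by
    have e : LinearMap.mulRight k ((c : k) • Q.alpha) ∘ₗ Q.antipode =
        (c : k) • (LinearMap.mulRight k Q.alpha ∘ₗ Q.antipode) := by ext; simp
    have e' : LinearMap.mulRight k (((c⁻¹ : kˣ) : k) • Q.beta) =
        ((c⁻¹ : kˣ) : k) • LinearMap.mulRight k Q.beta := by ext; simp
    rw [e, e', TensorProduct.map_smul_left, TensorProduct.map_smul_left, LinearMap.comp_smul,
      TensorProduct.map_smul_right, LinearMap.smul_apply, LinearMap.smul_apply, map_smul, map_smul,
      Q.reassoc_inv_antipode, smul_smul, ← Units.val_mul, mul_inv_cancel, Units.val_one, one_smul]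

end QuasiHopfAlgebra

end Twist

section Idempotent

variable {k : Type*} [Field k] {H : Type*} [CommRing H] [Algebra k H]

theorem involution_of_idempotent {R : Type*} [Ring R] [Algebra k R] {e : R} (h : e * e = e) :
    (1 - (2 : k) • e) * (1 - (2 : k) • e) = 1 := by
  simp only [sub_mul, mul_sub, one_mul, mul_one, smul_mul_smul_comm, h]
  module

theorem eq_conj {R : Type*} [CommMonoid R] {a b : R} (h : a * b = 1) (x : R) : x = a * x * b := by
  rw [mul_comm a, mul_assoc, h, mul_one]

/-- `1 - 2 p ⊗ p ⊗ p` -/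
def phi2 (k : Type*) [Field k] {H : Type*} [CommRing H] [Algebra k H] (P : H) :
    H ⊗[k] (H ⊗[k] H) :=
  1 - (2 : k) • (P ⊗ₜ[k] (P ⊗ₜ[k] P))

theorem phi2_sq {P : H} (hP : P * P = P) : phi2 k P * phi2 k P = 1 :=
  involution_of_idempotent (R := H ⊗[k] (H ⊗[k] H)) (by
    simp only [Algebra.TensorProduct.tmul_mul_tmul, hP])

theorem quasi_coassoc_phi2 {P : H} (hP : P * P = P) {x y : H ⊗[k] (H ⊗[k] H)} (h : x = y) :
    x = phi2 k P * y * phi2 k P := by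
  subst h
  exact eq_conj (R := H ⊗[k] (H ⊗[k] H)) (phi2_sq hP) x

theorem pentagon_identity {R : Type*} [CommRing R] {p q r s : R} (hp : p * p = p)
    (hq : q * q = q) (hr : r * r = r) :
    (1 - 2 * (q * r * s)) * (1 - 2 * (p * (q + r - 2 * (q * r)) * s)) * (1 - 2 * (p * q * r)) =
      (1 - 2 * (p * q * (r + s - 2 * (r * s)))) * (1 - 2 * ((p + q - 2 * (p * q)) * r * s)) := by
  grind

/-- The algebra `H ⊗ H ⊗ H ⊗ H`. -/
def T4 (k H : Type*) [Field k] [CommRing H] [Algebra k H] : Type _ :=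
  H ⊗[k] (H ⊗[k] (H ⊗[k] H))

instance : CommRing (T4 k H) := inferInstanceAs (CommRing (H ⊗[k] (H ⊗[k] (H ⊗[k] H))))

instance : Algebra k (T4 k H) := inferInstanceAs (Algebra k (H ⊗[k] (H ⊗[k] (H ⊗[k] H))))

/-- The pure tensor `a ⊗ b ⊗ c ⊗ d`. -/
def t4 (k : Type*) [Field k] {H : Type*} [CommRing H] [Algebra k H] (a b c d : H) : T4 k H :=
  (a ⊗ₜ[k] (b ⊗ₜ[k] (c ⊗ₜ[k] d)) : H ⊗[k] (H ⊗[k] (H ⊗[k] H)))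

theorem t4_mul (a b c d a' b' c' d' : H) :
    t4 k a b c d * t4 k a' b' c' d' = t4 k (a * a') (b * b') (c * c') (d * d') :=
  (Algebra.TensorProduct.tmul_mul_tmul (R := k) (A := H) (B := H ⊗[k] (H ⊗[k] H)) a a'
    (b ⊗ₜ[k] (c ⊗ₜ[k] d)) (b' ⊗ₜ[k] (c' ⊗ₜ[k] d'))).trans
    (congrArg (fun z => (a * a') ⊗ₜ[k] z)
      ((Algebra.TensorProduct.tmul_mul_tmul (R := k) (A := H) (B := H ⊗[k] H) b b'
        (c ⊗ₜ[k] d) (c' ⊗ₜ[k] d')).trans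
        (congrArg (fun z => (b * b') ⊗ₜ[k] z)
          (Algebra.TensorProduct.tmul_mul_tmul (R := k) (A := H) (B := H) c c' d d'))))

theorem t4_one : (1 : T4 k H) = t4 k 1 1 1 1 := rfl

theorem two_T4 (x : T4 k H) : 2 * x = (2 : k) • x := by rw [two_mul, two_smul]

theorem pentagon_phi2 (D : H →ₐ[k] H ⊗[k] H) {P : H} (hPP : P * P = P)
    (hc : D P = P ⊗ₜ[k] 1 + 1 ⊗ₜ[k] P - (2 : k) • (P ⊗ₜ[k] P)) :
    ((1 : H) ⊗ₜ[k] phi2 k P) *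
      TensorProduct.map LinearMap.id
        ((TensorProduct.assoc k H H H).toLinearMap ∘ₗ
          TensorProduct.map D.toLinearMap LinearMap.id) (phi2 k P) *
      TensorProduct.map LinearMap.id (TensorProduct.map LinearMap.id
        ((TensorProduct.mk k H H).flip 1)) (phi2 k P) =
    TensorProduct.map LinearMap.id (TensorProduct.map LinearMap.id D.toLinearMap)
        (phi2 k P) *
      TensorProduct.assoc k H H (H ⊗[k] H)
        (TensorProduct.map D.toLinearMap LinearMap.id (phi2 k P)) := by
  have hD1 : D 1 = (1 : H) ⊗ₜ[k] (1 : H) := map_one D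
  have a1 : ((1 : H) ⊗ₜ[k] phi2 k P) =
      1 ⊗ₜ (1 ⊗ₜ (1 ⊗ₜ 1)) - (2 : k) • 1 ⊗ₜ (P ⊗ₜ (P ⊗ₜ P)) := by
    simp [phi2, Algebra.TensorProduct.one_def, TensorProduct.tmul_sub]
  have a2 : TensorProduct.map LinearMap.id
        ((TensorProduct.assoc k H H H).toLinearMap ∘ₗ
          TensorProduct.map D.toLinearMap LinearMap.id) (phi2 k P) =
      1 ⊗ₜ (1 ⊗ₜ (1 ⊗ₜ 1)) - (2 : k) • (P ⊗ₜ (P ⊗ₜ (1 ⊗ₜ P)) + P ⊗ₜ (1 ⊗ₜ (P ⊗ₜ P)) -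
        (2 : k) • P ⊗ₜ (P ⊗ₜ (P ⊗ₜ P))) := by
    simp [phi2, Algebra.TensorProduct.one_def, TensorProduct.tmul_sub,
      TensorProduct.tmul_add, TensorProduct.add_tmul, TensorProduct.sub_tmul, hc, hD1,
      ← TensorProduct.smul_tmul']
  have a3 : TensorProduct.map LinearMap.id (TensorProduct.map LinearMap.id
        ((TensorProduct.mk k H H).flip 1)) (phi2 k P) =
      1 ⊗ₜ (1 ⊗ₜ (1 ⊗ₜ 1)) - (2 : k) • P ⊗ₜ (P ⊗ₜ (P ⊗ₜ 1)) := by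
    simp [phi2, Algebra.TensorProduct.one_def]
  have a4 : TensorProduct.map LinearMap.id (TensorProduct.map LinearMap.id
        D.toLinearMap) (phi2 k P) =
      1 ⊗ₜ (1 ⊗ₜ (1 ⊗ₜ 1)) - (2 : k) • (P ⊗ₜ (P ⊗ₜ (P ⊗ₜ 1)) + P ⊗ₜ (P ⊗ₜ (1 ⊗ₜ P)) -
        (2 : k) • P ⊗ₜ (P ⊗ₜ (P ⊗ₜ P))) := by
    simp [phi2, Algebra.TensorProduct.one_def, TensorProduct.tmul_sub,
      TensorProduct.tmul_add, hc, hD1]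
  have a5 : TensorProduct.assoc k H H (H ⊗[k] H)
        (TensorProduct.map D.toLinearMap LinearMap.id (phi2 k P)) =
      1 ⊗ₜ (1 ⊗ₜ (1 ⊗ₜ 1)) - (2 : k) • (P ⊗ₜ (1 ⊗ₜ (P ⊗ₜ P)) + 1 ⊗ₜ (P ⊗ₜ (P ⊗ₜ P)) -
        (2 : k) • P ⊗ₜ (P ⊗ₜ (P ⊗ₜ P))) := by
    simp [phi2, Algebra.TensorProduct.one_def,
      TensorProduct.add_tmul, TensorProduct.sub_tmul, hc, hD1, ← TensorProduct.smul_tmul']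
  rw [a1, a2, a3, a4, a5]
  have key : ∀ p q r s : T4 k H, p = t4 k P 1 1 1 → q = t4 k 1 P 1 1 → r = t4 k 1 1 P 1 →
      s = t4 k 1 1 1 P →
      (1 - (2 : k) • t4 k 1 P P P) *
        (1 - (2 : k) • (t4 k P P 1 P + t4 k P 1 P P - (2 : k) • t4 k P P P P)) *
        (1 - (2 : k) • t4 k P P P 1) =
      (1 - (2 : k) • (t4 k P P P 1 + t4 k P P 1 P - (2 : k) • t4 k P P P P)) *
        (1 - (2 : k) • (t4 k P 1 P P + t4 k 1 P P P - (2 : k) • t4 k P P P P)) := by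
    intro p q r s ep eq er es
    have hp : p * p = p := by rw [ep, t4_mul, hPP, one_mul]
    have hq : q * q = q := by rw [eq, t4_mul, hPP, one_mul]
    have hr : r * r = r := by rw [er, t4_mul, hPP, one_mul]
    have h1 : t4 k 1 P P P = q * r * s := by
      rw [eq, er, es]; simp only [t4_mul, one_mul, mul_one]
    have h2 : t4 k P 1 P P = p * r * s := by
      rw [ep, er, es]; simp only [t4_mul, one_mul, mul_one]
    have h3 : t4 k P P 1 P = p * q * s := by
      rw [ep, eq, es]; simp only [t4_mul, one_mul, mul_one]
    have h4 : t4 k P P P 1 = p * q * r := by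
      rw [ep, eq, er]; simp only [t4_mul, one_mul, mul_one]
    have h5 : t4 k P P P P = p * q * r * s := by
      rw [ep, eq, er, es]; simp only [t4_mul, one_mul, mul_one]
    rw [h1, h2, h3, h4, h5]
    simp only [← two_T4]
    linear_combination pentagon_identity hp hq hr (s := s)
  exact key _ _ _ _ rfl rfl rfl rfl

theorem normalized_phi2 (e : H →ₐ[k] k) {P : H} (he : e P = 0) :
    TensorProduct.map LinearMap.id
      ((TensorProduct.lid k H).toLinearMap ∘ₗ TensorProduct.map e.toLinearMap LinearMap.id)
      (phi2 k P) = (1 : H) ⊗ₜ[k] (1 : H) := by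
  simp [phi2, Algebra.TensorProduct.one_def, he]

theorem antipode_phi2 {P a : H} (hPP : P * P = P) (ha : a * a = 1) (h : a = 1 - (2 : k) • P) :
    LinearMap.mul' k H (TensorProduct.map (LinearMap.mulRight k 1)
      (LinearMap.mul' k H ∘ₗ
        TensorProduct.map (LinearMap.mulRight k a ∘ₗ LinearMap.id) LinearMap.id)
      (phi2 k P)) = 1 := by
  have e : P * (P * a * P) = a * P := by
    linear_combination (a * P + a) * hPP
  simp only [phi2, map_sub, map_smul, Algebra.TensorProduct.one_def, TensorProduct.map_tmul,
    LinearMap.comp_apply, LinearMap.mul'_apply, LinearMap.mulRight_apply, LinearMap.id_apply,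
    one_mul, mul_one, e]
  rw [← mul_smul_comm, ← mul_one_sub, ← h, ha]

theorem antipode_phi2' {P a : H} (hPP : P * P = P) (ha : a * a = 1) (h : a = 1 - (2 : k) • P) :
    LinearMap.mul' k H (TensorProduct.map (LinearMap.mulRight k a ∘ₗ LinearMap.id)
      (LinearMap.mul' k H ∘ₗ TensorProduct.map (LinearMap.mulRight k 1) LinearMap.id)
      (phi2 k P)) = 1 := by
  have e : P * a * (P * P) = a * P := by
    linear_combination (a * P + a) * hPP
  simp only [phi2, map_sub, map_smul, Algebra.TensorProduct.one_def, TensorProduct.map_tmul,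
    LinearMap.comp_apply, LinearMap.mul'_apply, LinearMap.mulRight_apply, LinearMap.id_apply,
    one_mul, mul_one, e]
  rw [← mul_smul_comm, ← mul_one_sub, ← h, ha]

end Idempotent

section GroupAlgebra

variable (k : Type*) [Field k]

/-- The group algebra `k[C₂]` of the cyclic group of order two. -/
abbrev KC2 : Type _ := MonoidAlgebra k (Multiplicative (ZMod 2))

/-- The generator `g` of `C₂`, as an element of `k[C₂]`. -/
def g : KC2 k := MonoidAlgebra.of k _ (Multiplicative.ofAdd 1)

/-- The element `p₋ = ½(1 - g)` of `k[C₂]`. -/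
def pMinus : KC2 k := (2 : k)⁻¹ • (1 - g k)

theorem g_mul_g : g k * g k = 1 := by
  rw [g, ← map_mul]
  exact (congrArg _ (by decide)).trans (map_one _)

theorem comul_g : Coalgebra.comul (R := k) (g k) = g k ⊗ₜ[k] g k := by
  simp [g]

theorem counit_g : Coalgebra.counit (R := k) (g k) = 1 := by
  simp [g]

/-- Every element of `k[C₂]` has the form `a + bg`. -/
theorem exists_eq (x : KC2 k) : ∃ a b : k, x = a • 1 + b • g k := by
  refine MonoidAlgebra.induction_on (motive := fun x => ∃ a b : k, x = a • 1 + b • g k) x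
    (fun c => ?_) ?_ ?_
  · have : c = Multiplicative.ofAdd 0 ∨ c = Multiplicative.ofAdd 1 := by
      revert c; decide
    rcases this with rfl | rfl
    · exact ⟨1, 0, by simp [MonoidAlgebra.one_def]⟩
    · exact ⟨0, 1, by simp [g]⟩
  · rintro x y ⟨a, b, rfl⟩ ⟨c, d, rfl⟩
    exact ⟨a + c, b + d, by simp only [add_smul]; abel⟩
  · rintro r x ⟨a, b, rfl⟩
    exact ⟨r * a, r * b, by simp [mul_smul]⟩

theorem linearMap_eq {V : Type*} [AddCommGroup V] [Module k V] {f f' : KC2 k →ₗ[k] V}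
    (h1 : f 1 = f' 1) (hg : f (g k) = f' (g k)) (x : KC2 k) : f x = f' x := by
  obtain ⟨a, b, rfl⟩ := exists_eq k x
  simp [h1, hg]

/-- `Δ(g) = g ⊗ g` -/
abbrev comulC2 : KC2 k →ₐ[k] KC2 k ⊗[k] KC2 k := Bialgebra.comulAlgHom k (KC2 k)

/-- `ε(g) = 1` -/
abbrev counitC2 : KC2 k →ₐ[k] k := Bialgebra.counitAlgHom k (KC2 k)

theorem comulC2_g : comulC2 k (g k) = g k ⊗ₜ[k] g k := comul_g k

theorem counitC2_g : counitC2 k (g k) = 1 := counit_g k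

theorem coassocC2 (h : KC2 k) :
    TensorProduct.map LinearMap.id (comulC2 k).toLinearMap (comulC2 k h) =
      TensorProduct.assoc k _ _ _
        (TensorProduct.map (comulC2 k).toLinearMap LinearMap.id (comulC2 k h)) :=
  (Coalgebra.coassoc_apply h).symm

theorem counit_rightC2 (h : KC2 k) : TensorProduct.rid k (KC2 k)
    (TensorProduct.map LinearMap.id (counitC2 k).toLinearMap (comulC2 k h)) = h :=
  (congrArg (TensorProduct.rid k (KC2 k)) (Coalgebra.lTensor_counit_comul h)).trans (by simp)

theorem counit_leftC2 (h : KC2 k) : TensorProduct.lid k (KC2 k)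
    (TensorProduct.map (counitC2 k).toLinearMap LinearMap.id (comulC2 k h)) = h :=
  (congrArg (TensorProduct.lid k (KC2 k)) (Coalgebra.rTensor_counit_comul h)).trans (by simp)

/-- The ordinary group Hopf algebra `k[C₂]`, with trivial reassociator. -/
def groupC2 : QuasiHopfAlgebra k (KC2 k) where
  comul := comulC2 k
  counit := counitC2 k
  reassoc := 1
  quasi_coassoc := fun h => by simp only [inv_one, Units.val_one, one_mul, mul_one, coassocC2]
  counit_right := counit_rightC2 k
  counit_left := counit_leftC2 k
  pentagon := by simp [Algebra.TensorProduct.one_def]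
  reassoc_normalized := by simp [Algebra.TensorProduct.one_def]
  antipode := LinearMap.id
  alpha := 1
  beta := 1
  antipode_one := rfl
  antipode_mul := fun a b => mul_comm a b
  antipode_left := fun h => by
    obtain ⟨a, b, rfl⟩ := exists_eq k h
    simp only [map_add, map_smul, map_one, comulC2_g, counitC2_g]
    simp [Algebra.TensorProduct.one_def, g_mul_g, add_smul]
  antipode_right := fun h => by
    obtain ⟨a, b, rfl⟩ := exists_eq k h
    simp only [map_add, map_smul, map_one, comulC2_g, counitC2_g]
    simp [Algebra.TensorProduct.one_def, g_mul_g, add_smul]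
  reassoc_antipode := by simp [Algebra.TensorProduct.one_def]
  reassoc_inv_antipode := by simp [Algebra.TensorProduct.one_def]

theorem counit_pMinus : counitC2 k (pMinus k) = 0 := by
  rw [pMinus, map_smul, map_sub, map_one, counitC2_g, sub_self, smul_zero]

variable [CharZero k]

theorem two_smul_half (V : Type*) [AddCommGroup V] [Module k V] (v : V) :
    (2 : k) • (2 : k)⁻¹ • v = v := by
  rw [smul_smul, mul_inv_cancel₀ two_ne_zero, one_smul]

theorem pMinus_sq : pMinus k * pMinus k = pMinus k := by
  have h : (1 - g k) * (1 - g k) = (2 : k) • (1 - g k) := by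
    rw [two_smul]; linear_combination g_mul_g k
  rw [pMinus, smul_mul_smul_comm, h, smul_smul, mul_assoc, inv_mul_cancel₀ two_ne_zero, mul_one]

theorem g_eq : g k = 1 - (2 : k) • pMinus k := by
  rw [pMinus, two_smul_half]; abel

theorem comul_pMinus : comulC2 k (pMinus k) =
    pMinus k ⊗ₜ 1 + 1 ⊗ₜ pMinus k - (2 : k) • (pMinus k ⊗ₜ pMinus k) := by
  have h : comulC2 k (pMinus k) = (2 : k)⁻¹ • (1 ⊗ₜ 1 - g k ⊗ₜ g k) := by
    rw [pMinus, map_smul, map_sub, map_one, comulC2_g]; rfl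
  rw [h, g_eq]
  simp only [TensorProduct.tmul_sub, TensorProduct.sub_tmul, TensorProduct.tmul_smul,
    ← TensorProduct.smul_tmul', smul_sub, smul_smul]
  norm_num
  abel

/-- The quasi-Hopf algebra `H(2)`: the group algebra `k[C₂]` with its usual comultiplication and
counit, with reassociator `1 - 2 p₋ ⊗ p₋ ⊗ p₋`, identity antipode, `α = g` and `β = 1`. -/
def H2 : QuasiHopfAlgebra k (KC2 k) where
  comul := comulC2 k
  counit := counitC2 k
  reassoc := ⟨phi2 k (pMinus k), phi2 k (pMinus k), phi2_sq (pMinus_sq k), phi2_sq (pMinus_sq k)⟩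
  quasi_coassoc := fun h => quasi_coassoc_phi2 (pMinus_sq k) (coassocC2 k h)
  counit_right := counit_rightC2 k
  counit_left := counit_leftC2 k
  pentagon := pentagon_phi2 (comulC2 k) (pMinus_sq k) (comul_pMinus k)
  reassoc_normalized := normalized_phi2 (counitC2 k) (counit_pMinus k)
  antipode := LinearMap.id
  alpha := g k
  beta := 1
  antipode_one := rfl
  antipode_mul := fun a b => mul_comm a b
  antipode_left := fun h => by
    obtain ⟨a, b, rfl⟩ := exists_eq k h
    simp only [map_add, map_smul, map_one, comulC2_g, counitC2_g]
    simp [Algebra.TensorProduct.one_def, g_mul_g, add_smul]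
  antipode_right := fun h => by
    obtain ⟨a, b, rfl⟩ := exists_eq k h
    simp only [map_add, map_smul, map_one, comulC2_g, counitC2_g]
    simp [Algebra.TensorProduct.one_def, g_mul_g, add_smul]
  reassoc_antipode := antipode_phi2 (pMinus_sq k) (g_mul_g k) (g_eq k)
  reassoc_inv_antipode := antipode_phi2' (pMinus_sq k) (g_mul_g k) (g_eq k)

end GroupAlgebra

end QuasiHopf

end

/-! Everything rests on a normal form for `H` (`exists_isGenerator`). The kernel of the counit is a
line, and it contains an idempotent `p` with `H = k1 + kp`. The counit together with a second
character `π`, where `π p = 1`, identifies `H` with the functions on a two-element set. The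
comultiplication is then addition mod 2, and the reassociator is a normalized 3-cocycle on `C₂`,
determined by its value `w` at `(1,1,1)`. The pentagon forces `w = 1` or `w = -1`.

Classification: once `w` is fixed, the antipode is the identity, and `α`, `β` depend on two nonzero
scalars `c` and `t`. Rescaling absorbs `c`. The twist `1 + (t - 1) p ⊗ p` absorbs `t`, and it
changes neither `Δ` nor `Φ` because its coboundary is trivial (`twist_cocycle_identity`). The two
values of `w` give `k[C₂]` and `H(2)`.

Semisimplicity: the action of `p` grades `B` by degrees 0 and 1. On homogeneous elements each
structure map of the Yetter-Drinfeld category is the evident one up to a power of `w` and an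
operator `T` that encodes the coaction. `T` preserves degrees and satisfies `T² = w` in degree 1.
The Jacobson radical of `B × H` is cut into homogeneous pieces by the idempotents of `H`. It
therefore vanishes as soon as every nonzero homogeneous `b` has a homogeneous left multiple `cb`
that is a nonzero idempotent (`isSemisimpleRing_biproduct` in `IsGenerator`).

If `p` acts by zero, `B` is an ordinary three-dimensional Hopf algebra. It is semisimple in
characteristic zero, so the left ideal generated by `b` contains such an idempotent
(`isSemisimpleRing_of_finrank_eq_three`).

If `p` acts nontrivially, the augmentation ideal cannot be purely odd, and `B` has a basis `1, x, y`
with `x` even and `y` odd. Degrees force `x² = λx` and `y² = μx`. A few coefficients of the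
multiplicativity of `Δ_B`, with associativity, coassociativity and the antipode, exclude `λ = 0` and
`μ = 0` (`mul_xx_ne_zero`, `mul_yy_ne_zero`). The idempotents are then explicit. -/

noncomputable section

namespace QuasiHopf

/-! ### Normal form of a two-dimensional quasi-Hopf algebra -/

section Generator

variable {k : Type*} [Field k] {H : Type*} [Ring H] [Algebra k H]

/-- `p` is an idempotent spanning, together with `1`, a two-dimensional quasi-bialgebra with the
comultiplication of `k[C₂]` and the reassociator `1 + (w - 1) p ⊗ p ⊗ p`. -/
structure IsGenerator (Q : QuasiBialgebra k H) (p : H) (w : k) : Prop where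
  sq : p * p = p
  counit : Q.counit p = 0
  exists_character : ∃ π : H →ₐ[k] k, π p = 1
  span : ∀ h : H, ∃ a b : k, h = a • 1 + b • p
  comul : Q.comul p = p ⊗ₜ[k] 1 + 1 ⊗ₜ[k] p - (2 : k) • (p ⊗ₜ[k] p)
  scalar_sq : w * w = 1
  reassoc : Q.phi = 1 ⊗ₜ[k] (1 ⊗ₜ[k] 1) + (w - 1) • (p ⊗ₜ[k] (p ⊗ₜ[k] p))
  reassoc_inv : Q.phiInv = 1 ⊗ₜ[k] (1 ⊗ₜ[k] 1) + (w - 1) • (p ⊗ₜ[k] (p ⊗ₜ[k] p))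

theorem tmul_span {V : Type*} [AddCommGroup V] [Module k V] {p : H}
    (hs : ∀ h : H, ∃ a b : k, h = a • 1 + b • p) (t : H ⊗[k] V) :
    ∃ u v : V, t = 1 ⊗ₜ u + p ⊗ₜ v := by
  induction t using TensorProduct.induction_on with
  | zero => exact ⟨0, 0, by simp⟩
  | tmul h v =>
    obtain ⟨a, b, rfl⟩ := hs h
    exact ⟨a • v, b • v, by simp [TensorProduct.add_tmul, TensorProduct.smul_tmul]⟩
  | add x y hx hy =>
    obtain ⟨u, v, rfl⟩ := hx
    obtain ⟨u', v', rfl⟩ := hy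
    exact ⟨u + u', v + v', by simp only [TensorProduct.tmul_add]; abel⟩

theorem tmul_span_two {p : H} (hs : ∀ h : H, ∃ a b : k, h = a • 1 + b • p) (t : H ⊗[k] H) :
    ∃ a b c d : k, t = a • (1 ⊗ₜ 1) + b • (1 ⊗ₜ p) + c • (p ⊗ₜ 1) + d • (p ⊗ₜ p) := by
  obtain ⟨u, v, rfl⟩ := tmul_span hs t
  obtain ⟨a, b, rfl⟩ := hs u
  obtain ⟨c, d, rfl⟩ := hs v
  exact ⟨a, b, c, d, by simp [TensorProduct.tmul_add]; abel⟩

theorem exists_coord (Q : QuasiBialgebra k H) (hH : Module.finrank k H = 2) :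
    ∃ (x : H) (X : H →ₗ[k] k), x ≠ 0 ∧ Q.counit x = 0 ∧ X 1 = 0 ∧ X x = 1 ∧
      ∀ h : H, h = Q.counit h • 1 + X h • x := by
  have : Module.Finite k H := Module.finite_of_finrank_pos (by omega)
  have hsurj : Function.Surjective Q.counit.toLinearMap := fun c => ⟨c • 1, by simp⟩
  have hker : Module.finrank k (LinearMap.ker Q.counit.toLinearMap) = 1 := by
    have h := LinearMap.finrank_range_add_finrank_ker Q.counit.toLinearMap
    rw [LinearMap.range_eq_top.2 hsurj, finrank_top, Module.finrank_self] at h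
    omega
  obtain ⟨⟨x, hx⟩, hx0, hspan⟩ := finrank_eq_one_iff'.1 hker
  have hx0' : x ≠ 0 := fun h => hx0 (Subtype.ext h)
  have hxe : Q.counit x = 0 := hx
  obtain ⟨f, hf⟩ : ∃ f : Module.Dual k H, f x ≠ 0 := by
    by_contra! h
    exact hx0' ((Module.forall_dual_apply_eq_zero_iff k x).1 h)
  -- Subtracting a multiple of the counit kills the value at 1 without changing the value at `x`.
  let X : H →ₗ[k] k := (f x)⁻¹ • (f - f 1 • Q.counit.toLinearMap)
  have hX1 : X 1 = 0 := by simp [X]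
  have hXx : X x = 1 := by simp [X, hxe, hf]
  refine ⟨x, X, hx0', hxe, hX1, hXx, fun h => ?_⟩
  have hm : h - Q.counit h • 1 ∈ LinearMap.ker Q.counit.toLinearMap := by simp
  obtain ⟨c, hc⟩ := hspan ⟨_, hm⟩
  have hc' : c • x = h - Q.counit h • 1 := congrArg Subtype.val hc
  have := congrArg X hc'
  simp [hX1, hXx] at this
  rw [← this, hc']
  abel

/-- The linear functional `a ⊗ b ↦ f(a)g(b)`. -/
def pairing {V W : Type*} [AddCommGroup V] [Module k V] [AddCommGroup W] [Module k W]
    (f : V →ₗ[k] k) (g : W →ₗ[k] k) : V ⊗[k] W →ₗ[k] k :=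
  LinearMap.mul' k k ∘ₗ TensorProduct.map f g

@[simp] theorem pairing_tmul {V W : Type*} [AddCommGroup V] [Module k V] [AddCommGroup W]
    [Module k W] (f : V →ₗ[k] k) (g : W →ₗ[k] k) (v : V) (w : W) :
    pairing f g (v ⊗ₜ w) = f v * g w := by simp [pairing]

/-- The two counit axioms determine every coefficient except that of `x ⊗ x`. -/
theorem comul_of_coord (Q : QuasiBialgebra k H) {x : H} {X : H →ₗ[k] k} (hxe : Q.counit x = 0)
    (hX1 : X 1 = 0) (hXx : X x = 1) (hs : ∀ h : H, h = Q.counit h • 1 + X h • x) :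
    ∃ d : k, Q.comul x = x ⊗ₜ 1 + 1 ⊗ₜ x + d • (x ⊗ₜ x) := by
  obtain ⟨a, b, c, d, h⟩ := tmul_span_two (fun h => ⟨_, _, hs h⟩) (Q.comul x)
  have h1 := Q.counit_right x
  have h2 := Q.counit_left x
  rw [h] at h1 h2
  simp [hxe] at h1 h2
  have ha := congrArg Q.counit h1
  have hc := congrArg X h1
  have hb := congrArg X h2
  simp [hxe, hX1, hXx] at ha hb hc
  exact ⟨d, by rw [h, ha, hb, hc]; module⟩

/-- The character `χ₁ ⊗ χ₂` of a tensor product. -/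
def charTensor {A C : Type*} [Ring A] [Algebra k A] [Ring C] [Algebra k C] (a : A →ₐ[k] k)
    (c : C →ₐ[k] k) : A ⊗[k] C →ₐ[k] k :=
  (Algebra.TensorProduct.lmul' k).comp (Algebra.TensorProduct.map a c)

@[simp] theorem charTensor_tmul {A C : Type*} [Ring A] [Algebra k A] [Ring C] [Algebra k C]
    (a : A →ₐ[k] k) (c : C →ₐ[k] k) (x : A) (y : C) :
    charTensor a c (x ⊗ₜ y) = a x * c y := by simp [charTensor]

theorem exists_idempotent_generator [CharZero k] (Q : QuasiHopfAlgebra k H)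
    (hH : Module.finrank k H = 2) :
    ∃ p : H, p * p = p ∧ Q.counit p = 0 ∧ (∃ π : H →ₐ[k] k, π p = 1) ∧
      (∀ h : H, ∃ a b : k, h = a • 1 + b • p) ∧
      Q.comul p = p ⊗ₜ[k] 1 + 1 ⊗ₜ[k] p - (2 : k) • (p ⊗ₜ[k] p) := by
  obtain ⟨x, X, hx0, hxe, hX1, hXx, hs⟩ := exists_coord Q.toQuasiBialgebra hH
  have hxx : x * x = X (x * x) • x := by
    have := hs (x * x)
    rwa [map_mul, hxe, zero_mul, zero_smul, zero_add] at this
  -- If `x² = 0` then `Δ(x)² = 0`, but the cross terms give `x ⊗ x` the coefficient 2 in `Δ(x)²`.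
  have hl : X (x * x) ≠ 0 := by
    intro h0
    rw [h0, zero_smul] at hxx
    obtain ⟨d, hd⟩ := comul_of_coord Q.toQuasiBialgebra hxe hX1 hXx hs
    have h := congrArg (pairing X X) (map_mul Q.comul x x)
    rw [hd, hxx] at h
    simp [mul_add, add_mul, Algebra.TensorProduct.tmul_mul_tmul, hxx, hXx] at h
    norm_num at h
  set l := X (x * x) with hldef
  let p := l⁻¹ • x
  let Y := l • X
  have hpp : p * p = p := by
    simp only [p, smul_mul_smul_comm, hxx, smul_smul]
    congr 1; field_simp
  have hp0 : p ≠ 0 := smul_ne_zero (inv_ne_zero hl) hx0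
  have hpe : Q.counit p = 0 := by simp [p, hxe]
  have hY1 : Y 1 = 0 := by simp [Y, hX1]
  have hYp : Y p = 1 := by simp [Y, p, hXx, hl]
  have hsp : ∀ h : H, h = Q.counit h • 1 + Y h • p := by
    intro h
    simp only [Y, p, LinearMap.smul_apply, smul_eq_mul, smul_smul]
    rw [mul_comm l, mul_assoc, mul_inv_cancel₀ hl, mul_one]
    exact hs h
  have hsp' : ∀ h : H, ∃ a b : k, h = a • 1 + b • p := fun h => ⟨_, _, hsp h⟩
  have hcomm : ∀ h h' : H, h * h' = h' * h := by
    intro h h'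
    obtain ⟨a, b, rfl⟩ := hsp' h
    obtain ⟨c, d, rfl⟩ := hsp' h'
    simp only [mul_add, add_mul, smul_mul_smul_comm, hpp, one_mul, mul_one, mul_comm]
    module
  let π : H →ₐ[k] k := AlgHom.ofLinearMap (Q.counit.toLinearMap + Y) (by simp [hY1]) (by
    intro h h'
    obtain ⟨a, b, rfl⟩ := hsp' h
    obtain ⟨c, d, rfl⟩ := hsp' h'
    simp [mul_add, add_mul, hpp, hpe, hY1, hYp]
    ring)
  have hπ : π p = 1 := by simp [π, hpe, hYp]
  refine ⟨p, hpp, hpe, ⟨π, hπ⟩, hsp', ?_⟩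
  obtain ⟨d, hd⟩ := comul_of_coord Q.toQuasiBialgebra hpe hY1 hYp hsp
  -- The character `π ⊗ π` sends `Δ(p)` to `d + 2`, which must be idempotent.
  have hq : (d + 1) * (d + 2) = 0 := by
    have h := congrArg (charTensor π π)
      (map_mul Q.comul p p)
    rw [hpp, map_mul, hd] at h
    simp [hπ] at h
    linear_combination -h
  rcases mul_eq_zero.1 hq with h | h
  -- For `d = -1` the element `e = 1 - p` is group-like, so `S(e)αe = α` and hence `αp = 0`. As `H`
  -- is commutative, `p` then annihilates `X¹βS(X²)αX³ = 1`.
  · exfalso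
    have hd1 : d = -1 := by linear_combination h
    have he : Q.comul (1 - p) = (1 - p) ⊗ₜ (1 - p) := by
      rw [map_sub, map_one, hd, hd1, Algebra.TensorProduct.one_def]
      simp only [TensorProduct.tmul_sub, TensorProduct.sub_tmul]
      module
    have h1 := Q.antipode_left (1 - p)
    rw [he] at h1
    simp only [TensorProduct.map_tmul, LinearMap.mul'_apply, LinearMap.comp_apply,
      LinearMap.mulRight_apply, LinearMap.id_apply, map_sub, map_one, hpe, sub_zero,
      one_smul] at h1
    have hα : Q.alpha * p = 0 := by
      rw [← h1, mul_assoc, sub_mul 1 p p, one_mul, hpp, sub_self, mul_zero]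
    have key : ∀ t : H ⊗[k] (H ⊗[k] H), LinearMap.mul' k H
        (TensorProduct.map (LinearMap.mulRight k Q.beta) (LinearMap.mul' k H ∘ₗ
          TensorProduct.map (LinearMap.mulRight k Q.alpha ∘ₗ Q.antipode) LinearMap.id) t) * p
        = 0 := by
      intro t
      induction t using TensorProduct.induction_on with
      | zero => simp
      | add u v hu hv => rw [map_add, map_add, add_mul, hu, hv, add_zero]
      | tmul a t =>
        induction t using TensorProduct.induction_on with
        | zero => simp
        | add u v hu hv => rw [TensorProduct.tmul_add, map_add, map_add, add_mul, hu, hv, add_zero]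
        | tmul b c =>
          simp only [TensorProduct.map_tmul, LinearMap.mul'_apply, LinearMap.comp_apply,
            LinearMap.mulRight_apply, LinearMap.id_apply, mul_assoc]
          rw [hcomm c p, ← mul_assoc Q.alpha, hα]
          simp
    have h2 := key Q.reassoc
    rw [Q.reassoc_antipode, one_mul] at h2
    exact hp0 h2
  · rw [hd, show d = -2 by linear_combination h]
    module

/-- Of the eight coefficients of `Φ`, counit normalization in the first two slots leaves only those
of `p ⊗ p ⊗ 1` and `p ⊗ p ⊗ p` undetermined. Two values of the pentagon settle these. -/
theorem exists_isGenerator [CharZero k] (Q : QuasiHopfAlgebra k H)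
    (hH : Module.finrank k H = 2) : ∃ (p : H) (w : k), IsGenerator Q.toQuasiBialgebra p w := by
  obtain ⟨p, hpp, hpe, ⟨π, hπ⟩, hs, hc⟩ := exists_idempotent_generator Q hH
  obtain ⟨u, v, huv⟩ := tmul_span hs Q.phi
  obtain ⟨a, b, c, d, rfl⟩ := tmul_span_two hs u
  obtain ⟨a', b', c', d', rfl⟩ := tmul_span_two hs v
  have E1 := Q.e1_reassoc
  have E2 := Q.e2_reassoc
  have P := Q.pentagon'
  have U := Q.map_phi_mul (charTensor π (charTensor π π))
  rw [huv] at E1 E2 P U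
  simp only [TensorProduct.tmul_add, TensorProduct.tmul_smul] at E1 E2 P U
  have E100 := congrArg (charTensor Q.counit Q.counit) E1
  have E101 := congrArg (charTensor Q.counit π) E1
  have E110 := congrArg (charTensor π Q.counit) E1
  have E111 := congrArg (charTensor π π) E1
  have E201 := congrArg (charTensor Q.counit π) E2
  have E210 := congrArg (charTensor π Q.counit) E2
  have E211 := congrArg (charTensor π π) E2
  simp [QuasiBialgebra.e1, QuasiBialgebra.e2, hpe, hπ] at E100 E101 E110 E111 E201 E210 E211
  -- In terms of the cocycle `φ`, the degrees `(1,1,0,1)` give `φ(1,1,0) = 1` after cancelling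
  -- `φ(1,1,1)`, which is nonzero because `Φ` is invertible. The degrees `(1,1,1,1)` give `φ(1,1,1)²
  -- = 1`.
  have P1 := congrArg (charTensor π (charTensor π (charTensor Q.counit π))) P
  have P2 := congrArg (charTensor π (charTensor π (charTensor π π))) P
  simp [QuasiBialgebra.i1, QuasiBialgebra.i4, QuasiBialgebra.d1, QuasiBialgebra.d2,
    QuasiBialgebra.d3, hpe, hπ, hc, TensorProduct.add_tmul, TensorProduct.sub_tmul,
    TensorProduct.tmul_add, TensorProduct.tmul_sub,  ← TensorProduct.smul_tmul',
    Algebra.TensorProduct.one_def] at P1 P2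
  simp [hπ] at U
  have B : b = 0 := by linear_combination E101 - E100
  have C : c = 0 := by linear_combination E110 - E100
  have A' : a' = 0 := by linear_combination E210 - E100
  have D : d = 0 := by linear_combination E111 - E100 - B - C
  have B' : b' = 0 := by linear_combination E211 - E100 - B - A'
  subst B C A' D B' E100
  norm_num at P1 P2 U
  have U' : 1 + (c' + d') ≠ 0 := fun h => by simp [h] at U
  have C' : c' = 0 := by
    refine (mul_eq_zero.1 ?_).resolve_left U'
    linear_combination P1
  subst C'
  have W : (1 + d') * (1 + d') = 1 := by linear_combination P2
  have Φ : Q.phi = 1 ⊗ₜ[k] (1 ⊗ₜ[k] 1) + (1 + d' - 1) • (p ⊗ₜ[k] (p ⊗ₜ[k] p)) := by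
    rw [huv]
    simp
  have hz : ∀ z : H ⊗[k] (H ⊗[k] H), d' • z + d' • (z + d' • z) = 0 := by
    intro z
    calc d' • z + d' • (z + d' • z) = ((1 + d') * (1 + d') - 1) • z := by module
      _ = 0 := by rw [W, sub_self, zero_smul]
  have Φ2 : Q.phi * Q.phi = 1 := by
    rw [Φ]
    simp only [mul_add, add_mul, Algebra.TensorProduct.tmul_mul_tmul, hpp, one_mul, mul_one,
      mul_smul_comm, smul_mul_assoc, Algebra.TensorProduct.one_def, add_sub_cancel_left]
    rw [add_assoc, hz, add_zero]
  refine ⟨p, 1 + d', hpp, hpe, ⟨π, hπ⟩, hs, hc, W, Φ, ?_⟩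
  rw [← Φ]
  exact Units.inv_eq_of_mul_eq_one_right Φ2

end Generator

/-! ### Classification up to twist -/

section TwistClassification

/-- The idempotent `E = pq + qr + pr - 2pqr` says that at least two of `p, q, r` equal 1. The first
two factors multiply to `1 + (T - 1)E` and the last two to `1 + (T' - 1)E`, and these are mutually
inverse. -/
theorem twist_cocycle_identity {R : Type*} [CommRing R] {p q r T T' W : R} (hp : p * p = p)
    (hq : q * q = q) (hr : r * r = r) (hT : T * T' = 1) :
    (1 + (T - 1) * (q * r)) * (1 + (T - 1) * (p * (q + r - 2 * (q * r)))) *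
      (1 + (W - 1) * (p * q * r)) * (1 + (T' - 1) * ((p + q - 2 * (p * q)) * r)) *
      (1 + (T' - 1) * (p * q)) = 1 + (W - 1) * (p * q * r) := by
  have h1 : (1 + (T - 1) * (q * r)) * (1 + (T - 1) * (p * (q + r - 2 * (q * r)))) =
      1 + (T - 1) * (p * q + q * r + p * r - 2 * (p * q * r)) := by
    linear_combination (T - 1) ^ 2 * p * (r * hq + q * hr - 2 * (r ^ 2 * hq + q * hr))
  have h2 : (1 + (T' - 1) * ((p + q - 2 * (p * q)) * r)) * (1 + (T' - 1) * (p * q)) =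
      1 + (T' - 1) * (p * q + q * r + p * r - 2 * (p * q * r)) := by
    linear_combination (T' - 1) ^ 2 * r * (q * hp + p * hq - 2 * (q ^ 2 * hp + p * hq))
  have hE : (p * q + q * r + p * r - 2 * (p * q * r)) * (p * q + q * r + p * r - 2 * (p * q * r)) =
      p * q + q * r + p * r - 2 * (p * q * r) := by
    grind
  generalize p * q + q * r + p * r - 2 * (p * q * r) = E at *
  calc _ = (1 + (T - 1) * (q * r)) * (1 + (T - 1) * (p * (q + r - 2 * (q * r)))) *
      (1 + (W - 1) * (p * q * r)) * ((1 + (T' - 1) * ((p + q - 2 * (p * q)) * r)) *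
      (1 + (T' - 1) * (p * q))) := by ring
    _ = _ := by
      rw [h1, h2]
      linear_combination (1 + (W - 1) * (p * q * r)) * ((T - 1) * (T' - 1) * hE + E * hT)

variable {k : Type*} [Field k] {H : Type*} [Ring H] [Algebra k H]

/-- For an idempotent `q` and two characters, the algebra map `h ↦ χ₀(h)(1 - q) + χ₁(h)q`. -/
def characterPair {A : Type*} [Ring A] [Algebra k A] (χ₀ χ₁ : H →ₐ[k] k) {q : A}
    (hq : q * q = q) : H →ₐ[k] A :=
  AlgHom.ofLinearMap
    (χ₀.toLinearMap.smulRight (1 - q) + χ₁.toLinearMap.smulRight q) (by simp) (by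
      intro x y
      simp [mul_add, add_mul, mul_sub, sub_mul, hq, smul_smul, smul_sub, mul_comm])

theorem characterPair_apply {A : Type*} [Ring A] [Algebra k A] (χ₀ χ₁ : H →ₐ[k] k) {q : A}
    (hq : q * q = q) (h : H) : characterPair χ₀ χ₁ hq h = χ₀ h • (1 - q) + χ₁ h • q := rfl

namespace IsGenerator

variable {Q : QuasiBialgebra k H} {p : H} {w : k}

theorem algHom_ext (hQ : IsGenerator Q p w) {A : Type*} [Ring A] [Algebra k A] {f f' : H →ₐ[k] A}
    (h : f p = f' p) : f = f' := by
  ext x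
  obtain ⟨a, b, rfl⟩ := hQ.span x
  simp [h]

/-- Equations in `H` are thereby reduced to two scalar equations. -/
theorem ext_characters (hQ : IsGenerator Q p w) {π : H →ₐ[k] k} (hπ : π p = 1) {h h' : H}
    (h0 : Q.counit h = Q.counit h') (h1 : π h = π h') : h = h' := by
  obtain ⟨a, b, rfl⟩ := hQ.span h
  obtain ⟨c, d, rfl⟩ := hQ.span h'
  simp [hQ.counit, hπ] at h0 h1
  rw [h0] at h1 ⊢
  rw [add_left_cancel h1]

theorem exists_algEquiv (hQ : IsGenerator Q p w) {H' : Type*} [Ring H'] [Algebra k H']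
    {Q' : QuasiBialgebra k H'} {p' : H'} {w' : k} (hQ' : IsGenerator Q' p' w') :
    ∃ f : H ≃ₐ[k] H', f p = p' := by
  obtain ⟨π, hπ⟩ := hQ.exists_character
  obtain ⟨π', hπ'⟩ := hQ'.exists_character
  have e1 : characterPair Q.counit π hQ'.sq p = p' := by
    simp [characterPair_apply, hQ.counit, hπ]
  have e2 : characterPair Q'.counit π' hQ.sq p' = p := by
    simp [characterPair_apply, hQ'.counit, hπ']
  exact ⟨AlgEquiv.ofAlgHom (characterPair Q.counit π hQ'.sq) (characterPair Q'.counit π' hQ.sq)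
    (hQ'.algHom_ext (by simp [e1, e2])) (hQ.algHom_ext (by simp [e1, e2])), e1⟩

end IsGenerator

/-- The axiom `X¹βS(X²)αX³ = 1` makes `α` and `β` nonzero under both characters, so the antipode
axiom at `p` gives `ε(S(p)) = 0` and `π(S(p)) = 1`. The same axiom then reads `ε(β)ε(α) = 1` and
`wπ(β)π(α) = 1`. The scalars are `c = ε(β)` and `t = π(β)/ε(β)`. -/
theorem IsGenerator.distinguished {Q : QuasiHopfAlgebra k H} {p : H} {w : k}
    (hQ : IsGenerator Q.toQuasiBialgebra p w) :
    Q.antipode p = p ∧ ∃ c t : kˣ, Q.beta = (c : k) • (1 + ((t : k) - 1) • p) ∧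
      Q.alpha = ((c⁻¹ : kˣ) : k) • (1 + (w * ((t⁻¹ : kˣ) : k) - 1) • p) := by
  obtain ⟨π, hπ⟩ := hQ.exists_character
  have hS : Q.antipode p * Q.antipode p = Q.antipode p := by rw [← Q.antipode_mul, hQ.sq]
  have hL := Q.antipode_left p
  have hN := Q.reassoc_antipode
  rw [hQ.comul] at hL
  rw [show (Q.reassoc : H ⊗[k] (H ⊗[k] H)) = _ from hQ.reassoc] at hN
  simp only [map_add, map_sub, map_smul, TensorProduct.map_tmul, LinearMap.mul'_apply,
    LinearMap.comp_apply, LinearMap.mulRight_apply, LinearMap.id_apply, Q.antipode_one, one_mul,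
    mul_one, hQ.counit, zero_smul] at hL hN
  have hL0 := congrArg Q.counit hL
  have hL1 := congrArg π hL
  have hN0 := congrArg Q.counit hN
  have hN1 := congrArg π hN
  have hS0 := congrArg Q.counit hS
  have hS1 := congrArg π hS
  simp only [map_add, map_sub, map_smul, map_mul, map_one, map_zero, hQ.counit, hπ, smul_eq_mul,
    zero_mul, mul_zero, mul_one, one_mul, sub_zero, add_zero] at hL0 hL1 hN0 hN1 hS0 hS1
  have hα0 : Q.counit Q.alpha ≠ 0 := fun h => by simp [h] at hN0
  have hα1 : π Q.alpha ≠ 0 := fun h => by simp [h] at hN1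
  have hβ0 : Q.counit Q.beta ≠ 0 := fun h => by simp [h] at hN0
  have hβ1 : π Q.beta ≠ 0 := fun h => by simp [h] at hN1
  have s0 : Q.counit (Q.antipode p) = 0 := (mul_eq_zero.1 hL0).resolve_right hα0
  have s1 : π (Q.antipode p) = 1 := by
    have : (1 - π (Q.antipode p)) * π Q.alpha = 0 := by linear_combination hL1
    linear_combination -((mul_eq_zero.1 this).resolve_right hα1)
  rw [s1] at hN1
  have hw : w ≠ 0 := fun h => by simpa [h] using hQ.scalar_sq
  refine ⟨hQ.ext_characters hπ (by rw [s0, hQ.counit]) (by rw [s1, hπ]),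
    Units.mk0 _ hβ0, Units.mk0 _ hβ1 * (Units.mk0 _ hβ0)⁻¹, ?_, ?_⟩
  · apply hQ.ext_characters hπ
    · simp [hQ.counit]
    · simp [hπ]
      field_simp
      ring
  · apply hQ.ext_characters hπ
    · simp [hQ.counit]
      field_simp
      linear_combination hN0
    · simp [hπ]
      field_simp
      linear_combination Q.counit Q.beta * (w * hN1 - π Q.beta * π Q.alpha * hQ.scalar_sq)

theorem algebraMap_sub_one_mul {R : Type*} [CommRing R] [Algebra k R] (a : k) (z : R) :
    (algebraMap k R a - 1) * z = (a - 1) • z := by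
  rw [Algebra.smul_def, map_sub, map_one]

theorem IsGenerator.twistEquivalent {Q : QuasiHopfAlgebra k H} {p : H} {w : k}
    (hQ : IsGenerator Q.toQuasiBialgebra p w) {H' : Type*} [CommRing H'] [Algebra k H']
    {Q' : QuasiHopfAlgebra k H'} {p' : H'} (hQ' : IsGenerator Q'.toQuasiBialgebra p' w)
    (hS : Q'.antipode = LinearMap.id) (hα : Q'.alpha = 1 + (w - 1) • p') (hβ : Q'.beta = 1) :
    ∃ c : kˣ, (Q.rescale c).TwistEquivalent Q' := by
  obtain ⟨hSp, c, t, hb, ha⟩ := hQ.distinguished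
  obtain ⟨f, hf⟩ := hQ.exists_algEquiv hQ'
  have hmul : ∀ a b : k, a * b = 1 →
      ((1 : H' ⊗[k] H') + (a - 1) • (p' ⊗ₜ[k] p')) * (1 + (b - 1) • (p' ⊗ₜ[k] p')) = 1 := by
    intro a b hab
    simp only [mul_add, add_mul, one_mul, mul_one, smul_mul_smul_comm,
      Algebra.TensorProduct.tmul_mul_tmul, hQ'.sq]
    rw [add_assoc, ← add_smul, ← add_smul,
      show a - 1 + ((b - 1) + (a - 1) * (b - 1)) = 0 by linear_combination hab, zero_smul, add_zero]
  -- With `S = Id` and `β' = 1`, the twisted `β` is the product of the legs of `F`, namely `1 + (t -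
  -- 1)p'`. This is the rescaled `β`.
  let F : (H' ⊗[k] H')ˣ :=
    ⟨1 + ((t : k) - 1) • (p' ⊗ₜ[k] p'), 1 + (((t⁻¹ : kˣ) : k) - 1) • (p' ⊗ₜ[k] p'),
      hmul _ _ (by simp), hmul _ _ (by simp)⟩
  have hF : (F : H' ⊗[k] H') = 1 ⊗ₜ 1 + ((t : k) - 1) • (p' ⊗ₜ[k] p') := rfl
  have hF' : ((F⁻¹ : (H' ⊗[k] H')ˣ) : H' ⊗[k] H') =
    1 ⊗ₜ 1 + (((t⁻¹ : kˣ) : k) - 1) • (p' ⊗ₜ[k] p') := rfl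
  refine ⟨c, F, f, ⟨?_, ?_⟩, ?_, ?_, ?_, ?_, ?_, ?_⟩
  · rw [hF]; simp [hQ'.counit]
  · rw [hF]; simp [hQ'.counit]
  · intro h
    have e : Q'.twistComul F (f h) = Q'.comul (f h) := by
      rw [QuasiBialgebra.twistComul, mul_comm, ← mul_assoc, Units.inv_mul, one_mul]
    rw [e]
    have : (Algebra.TensorProduct.map f.toAlgHom f.toAlgHom).comp Q.comul =
        Q'.comul.comp f.toAlgHom := by
      apply hQ.algHom_ext
      simp [hQ.comul, hQ'.comul, hf]
    exact DFunLike.congr_fun this h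
  · intro h
    have : Q'.counit.comp f.toAlgHom = Q.counit := hQ.algHom_ext (by simp [hf, hQ.counit, hQ'.counit])
    exact DFunLike.congr_fun this h
  · have e1 : TensorProduct.map f.toLinearMap (TensorProduct.map f.toLinearMap f.toLinearMap)
        (Q.reassoc : H ⊗[k] (H ⊗[k] H)) = Q'.phi := by
      rw [show (Q.reassoc : H ⊗[k] (H ⊗[k] H)) = _ from hQ.reassoc, hQ'.reassoc]
      simp [hf]
    refine e1.trans ?_
    rw [QuasiBialgebra.twistReassoc, hF, hF', hQ'.reassoc,
      show (Q'.reassoc : H' ⊗[k] (H' ⊗[k] H')) = _ from hQ'.reassoc]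
    have hs : ∀ (a : k) (z : H' ⊗[k] (H' ⊗[k] H')), (algebraMap k _ a - 1) * z = (a - 1) • z :=
      algebraMap_sub_one_mul
    have h2 : ∀ z : H' ⊗[k] (H' ⊗[k] H'), 2 * z = (2 : k) • z := fun z => by
      rw [two_mul, two_smul]
    have ho : (1 : H') ⊗ₜ[k] ((1 : H') ⊗ₜ[k] (1 : H')) = 1 := rfl
    -- The three commuting idempotents are the copies of `p'` in the three tensor slots; `q + r -
    -- 2qr` is `Δ(p')` placed in the last two.
    have key := twist_cocycle_identity (R := H' ⊗[k] (H' ⊗[k] H')) (p := p' ⊗ₜ (1 ⊗ₜ 1))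
      (q := 1 ⊗ₜ (p' ⊗ₜ 1)) (r := 1 ⊗ₜ (1 ⊗ₜ p')) (T := algebraMap k _ (t : k))
      (T' := algebraMap k _ ((t⁻¹ : kˣ) : k)) (W := algebraMap k _ w)
      (by simp only [Algebra.TensorProduct.tmul_mul_tmul, one_mul, hQ'.sq])
      (by simp only [Algebra.TensorProduct.tmul_mul_tmul, one_mul, hQ'.sq])
      (by simp only [Algebra.TensorProduct.tmul_mul_tmul, one_mul, hQ'.sq])
      (by rw [← map_mul, Units.mul_inv, map_one])
    simp only [hs, h2, mul_add, mul_sub, add_mul, sub_mul, mul_smul_comm, smul_mul_assoc,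
      Algebra.TensorProduct.tmul_mul_tmul, one_mul, mul_one] at key
    simp only [TensorProduct.tmul_add, TensorProduct.tmul_sub, TensorProduct.tmul_smul,
      TensorProduct.add_tmul, TensorProduct.sub_tmul, ← TensorProduct.smul_tmul', map_add, map_sub,
      map_smul, TensorProduct.map_tmul, LinearMap.id_apply, AlgHom.toLinearMap_apply, hQ'.comul,
      map_one, Algebra.TensorProduct.one_def, TensorProduct.assoc_tmul]
    simp only [ho, mul_add, mul_sub, add_mul, sub_mul, mul_smul_comm, smul_mul_assoc,
      Algebra.TensorProduct.tmul_mul_tmul, one_mul, mul_one]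
    exact key.symm
  · intro h
    obtain ⟨a, b, rfl⟩ := hQ.span h
    simp only [QuasiHopfAlgebra.rescale, map_add, map_smul, Q.antipode_one, hSp, hS,
      LinearMap.id_apply]
  · rw [QuasiHopfAlgebra.twistAlpha, hF', hS, hα]
    simp [QuasiHopfAlgebra.rescale, ha, hf, mul_add, add_mul, hQ'.sq]
    module
  · rw [QuasiHopfAlgebra.twistBeta, hF, hS, hβ]
    simp [QuasiHopfAlgebra.rescale, hb, hf, hQ'.sq]

theorem isGenerator_groupC2 (k : Type*) [Field k] [CharZero k] :
    IsGenerator (groupC2 k).toQuasiBialgebra (pMinus k) (1 : k) where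
  sq := pMinus_sq k
  counit := counit_pMinus k
  exists_character := by
    -- The sign character, which sends `½(1 - g)` to 1.
    let e : KC2 k →ₐ[k] k := MonoidAlgebra.lift k k (Multiplicative (ZMod 2))
      { toFun := fun c => if c = 1 then 1 else -1, map_one' := by simp, map_mul' := by
          have h : ∀ a b : Multiplicative (ZMod 2), a ≠ 1 → b ≠ 1 → a * b = 1 := by decide
          intro a b
          by_cases ha : a = 1
          · simp [ha]
          by_cases hb : b = 1
          · simp [hb]
          rw [if_pos (h a b ha hb), if_neg ha, if_neg hb]
          ring }
    have he : e (g k) = -1 := by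
      have : Multiplicative.ofAdd (1 : ZMod 2) ≠ 1 := by decide
      simp [e, g, this]
    exact ⟨e, by simp [pMinus, he]; norm_num⟩
  span h := by
    obtain ⟨a, b, rfl⟩ := exists_eq k h
    exact ⟨a + b, -2 * b, by rw [g_eq]; module⟩
  comul := comul_pMinus k
  scalar_sq := one_mul 1
  reassoc := by simp [groupC2, QuasiBialgebra.phi, Algebra.TensorProduct.one_def]
  reassoc_inv := by simp [groupC2, QuasiBialgebra.phiInv, Algebra.TensorProduct.one_def]

theorem phi2_eq (k : Type*) [Field k] {H : Type*} [CommRing H] [Algebra k H] (P : H) :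
    phi2 k P = 1 ⊗ₜ[k] (1 ⊗ₜ[k] 1) + ((-1 : k) - 1) • (P ⊗ₜ[k] (P ⊗ₜ[k] P)) := by
  rw [phi2, Algebra.TensorProduct.one_def, Algebra.TensorProduct.one_def]
  module

theorem isGenerator_H2 (k : Type*) [Field k] [CharZero k] :
    IsGenerator (H2 k).toQuasiBialgebra (pMinus k) (-1 : k) where
  sq := pMinus_sq k
  counit := counit_pMinus k
  exists_character := (isGenerator_groupC2 k).exists_character
  span := (isGenerator_groupC2 k).span
  comul := comul_pMinus k
  scalar_sq := by ring
  reassoc := phi2_eq k (pMinus k)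
  reassoc_inv := phi2_eq k (pMinus k)

theorem exists_twistEquivalent [CharZero k] (Q : QuasiHopfAlgebra k H)
    (hH : Module.finrank k H = 2) :
    ∃ c : kˣ, (Q.rescale c).TwistEquivalent (groupC2 k) ∨ (Q.rescale c).TwistEquivalent (H2 k) := by
  obtain ⟨p, w, hQ⟩ := exists_isGenerator Q hH
  rcases mul_self_eq_one_iff.1 hQ.scalar_sq with rfl | rfl
  · obtain ⟨c, hc⟩ := hQ.twistEquivalent (isGenerator_groupC2 k) rfl
      (by simp [groupC2]) rfl
    exact ⟨c, Or.inl hc⟩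
  · obtain ⟨c, hc⟩ := hQ.twistEquivalent (isGenerator_H2 k) rfl
      ((g_eq k).trans (by module)) rfl
    exact ⟨c, Or.inr hc⟩

end TwistClassification

/-! ### Homogeneous elements and Yetter-Drinfeld modules -/

section Homogeneous

variable {k : Type*} [Field k] {H : Type*} [Ring H] [Algebra k H] {Q : QuasiBialgebra k H}
  {p : H} {w : k}

namespace IsGenerator

variable {M N R : Type*} [AddCommGroup M] [Module k M] [AddCommGroup N] [Module k N]
  [AddCommGroup R] [Module k R] {ρ : H →ₐ[k] Module.End k M} {σ : H →ₐ[k] Module.End k N}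
  {τ : H →ₐ[k] Module.End k R} {m : M} {n : N} {r : R} {i j l : k}

/-- Degrees are recorded as eigenvalues of `p`. On the values 0 and 1, the expression `i + j - 2ij`
is addition mod 2. -/
theorem tensorRep_tmul (hQ : IsGenerator Q p w) (hm : ρ p m = i • m) (hn : σ p n = j • n) :
    Q.tensorRep ρ σ p (m ⊗ₜ n) = (i + j - 2 * i * j) • (m ⊗ₜ[k] n) := by
  change boxRep ρ σ (Q.comul p) (m ⊗ₜ n) = _
  rw [hQ.comul]
  simp only [map_add, map_sub, map_smul, LinearMap.add_apply, LinearMap.sub_apply,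
    LinearMap.smul_apply, boxRep_tmul, hm, hn, map_one, Module.End.one_apply,
    TensorProduct.tmul_smul, ← TensorProduct.smul_tmul']
  module

/-- For degrees 0 and 1 the scalar is `w` when all three are 1, and 1 otherwise. It serves both `Φ`
and `Φ⁻¹`, which coincide. -/
theorem boxRep_reassoc (hm : ρ p m = i • m) (hn : σ p n = j • n) (hr : τ p r = l • r) :
    boxRep ρ (boxRep σ τ) (1 ⊗ₜ[k] (1 ⊗ₜ[k] 1) + (w - 1) • (p ⊗ₜ[k] (p ⊗ₜ[k] p)))
      (m ⊗ₜ (n ⊗ₜ r)) = (1 + (w - 1) * i * j * l) • (m ⊗ₜ[k] (n ⊗ₜ[k] r)) := by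
  simp only [map_add, map_smul, LinearMap.add_apply,
    LinearMap.smul_apply, boxRep_tmul, hm, hn, hr, map_one, Module.End.one_apply,
    TensorProduct.tmul_smul, ← TensorProduct.smul_tmul']
  module

theorem assocMap_tmul (hQ : IsGenerator Q p w) (hm : ρ p m = i • m) (hn : σ p n = j • n)
    (hr : τ p r = l • r) : Q.assocMap ρ σ τ ((m ⊗ₜ n) ⊗ₜ r) =
      (1 + (w - 1) * i * j * l) • (m ⊗ₜ[k] (n ⊗ₜ[k] r)) := by
  rw [← boxRep_reassoc hm hn hr, ← hQ.reassoc]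
  rfl

theorem assocInv_tmul (hQ : IsGenerator Q p w) (hm : ρ p m = i • m) (hn : σ p n = j • n)
    (hr : τ p r = l • r) : Q.assocInv ρ σ τ (m ⊗ₜ (n ⊗ₜ r)) =
      (1 + (w - 1) * i * j * l) • ((m ⊗ₜ[k] n) ⊗ₜ[k] r) := by
  rw [QuasiBialgebra.assocInv, LinearMap.comp_apply,
    show ((Q.reassoc⁻¹ : (H ⊗[k] (H ⊗[k] H))ˣ) : H ⊗[k] (H ⊗[k] H)) = _ from hQ.reassoc_inv,
    boxRep_reassoc hm hn hr]
  simp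

theorem assocMap_apply (hQ : IsGenerator Q p w) : Q.assocMap ρ σ τ ((m ⊗ₜ n) ⊗ₜ r) =
    m ⊗ₜ[k] (n ⊗ₜ[k] r) + (w - 1) • (ρ p m ⊗ₜ (σ p n ⊗ₜ τ p r)) := by
  rw [QuasiBialgebra.assocMap, LinearMap.comp_apply,
    show (Q.reassoc : H ⊗[k] (H ⊗[k] H)) = _ from hQ.reassoc]
  simp

/-- With `m' = Tm - m`, the braiding past an element of degree 0 or 1 applies `T` to `m` exactly
when the degree is 1. -/
theorem braid_tmul {δ : M →ₗ[k] H ⊗[k] M} {m' : M}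
    (hδ : δ m = 1 ⊗ₜ m + p ⊗ₜ m') (hn : σ p n = l • n) :
    braid δ σ (m ⊗ₜ n) = n ⊗ₜ (m + l • m') := by
  simp [braid, hδ, TensorProduct.add_tmul, hn, TensorProduct.smul_tmul, TensorProduct.tmul_add]

end IsGenerator

section YetterDrinfeld

variable {B : Type*} [AddCommGroup B] [Module k B]

/-- The endomorphism `m ↦ χ(m₍₋₁₎)m₍₀₎` of a Yetter-Drinfeld module defined by a character. -/
def YDModule.characterAct (U : YDModule Q B) (χ : H →ₐ[k] k) : B →ₗ[k] B :=
  (TensorProduct.lid k B).toLinearMap ∘ₗ TensorProduct.map χ.toLinearMap LinearMap.id ∘ₗ U.coact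

/-- A coaction is known from its images under the two characters: the counit gives the identity and
`π` gives `T`. -/
theorem IsGenerator.coact_eq (hQ : IsGenerator Q p w) (U : YDModule Q B) {π : H →ₐ[k] k}
    (hπ : π p = 1) (m : B) : U.coact m = 1 ⊗ₜ m + p ⊗ₜ (U.characterAct π m - m) := by
  obtain ⟨u, v, h⟩ := tmul_span hQ.span (U.coact m)
  have h1 := U.counit_coact m
  have h2 : U.characterAct π m = u + v := by simp [YDModule.characterAct, h, hπ]
  rw [h] at h1
  simp [hQ.counit] at h1
  rw [h, h2, h1]
  simp

/-- Applying `π` to the compatibility of action and coaction shows that `T` preserves degrees. -/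
theorem IsGenerator.act_characterAct (hQ : IsGenerator Q p w) (U : YDModule Q B) {π : H →ₐ[k] k}
    (hπ : π p = 1) {m : B} {i : k} (hm : U.act p m = i • m) :
    U.act p (U.characterAct π m) = i • U.characterAct π m := by
  have h := U.coact_act p m
  have h' : Q.tensorRep U.act (regRep k H) p (m ⊗ₜ[k] (1 : H)) =
      (i • m) ⊗ₜ 1 + m ⊗ₜ p - (2 : k) • (i • m) ⊗ₜ p := by
    change boxRep U.act (regRep k H) (Q.comul p) (m ⊗ₜ 1) = _
    rw [hQ.comul]
    simp [hm]
  have h'' : Q.tensorRep (regRep k H) U.act p (U.coact m) =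
      boxRep (regRep k H) U.act (Q.comul p) (U.coact m) := rfl
  have hb : ∀ h : H, braid U.coact (regRep k H) (m ⊗ₜ h) =
      h ⊗ₜ m + (p * h) ⊗ₜ (U.characterAct π m - m) := by
    intro h
    simp [braid, hQ.coact_eq U hπ, TensorProduct.add_tmul]
  rw [h', h'', hQ.comul, hQ.coact_eq U hπ] at h
  have h3 := congrArg ((TensorProduct.lid k B).toLinearMap ∘ₗ TensorProduct.map π.toLinearMap LinearMap.id) h
  simp [hb, hπ, ← TensorProduct.smul_tmul', hm] at h3
  have h4 : (i • U.characterAct π m : B) - U.act p (U.characterAct π m) = 0 := by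
    rw [← sub_eq_zero] at h3
    rw [← h3]
    module
  exact (sub_eq_zero.1 h4).symm

/-- Under `π ⊗ π` the coaction axiom becomes `wT²m = w²m`. One reassociator contributes on the left
and two on the right, while `Δ` sends the degree pair `(1,1)` to degree 0, where the coaction acts
as the identity. -/
theorem IsGenerator.characterAct_sq (hQ : IsGenerator Q p w) (U : YDModule Q B) {π : H →ₐ[k] k}
    (hπ : π p = 1) {m : B} (hm : U.act p m = m) :
    U.characterAct π (U.characterAct π m) = w • m := by
  have h := U.coact_coact m
  have hb : ∀ (h : H) (m : B), braid U.coact (regRep k H) (m ⊗ₜ h) =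
      h ⊗ₜ m + (p * h) ⊗ₜ (U.characterAct π m - m) := by
    intro h m
    simp [braid, hQ.coact_eq U hπ, TensorProduct.add_tmul]
  have hb2 : ∀ (z : H ⊗[k] H) (m : B),
      braid U.coact (Q.tensorRep (regRep k H) (regRep k H)) (m ⊗ₜ z) =
      z ⊗ₜ m + (boxRep (regRep k H) (regRep k H) (Q.comul p) z) ⊗ₜ (U.characterAct π m - m) := by
    intro z m
    simp [braid, hQ.coact_eq U hπ, TensorProduct.add_tmul]
    rfl
  have hT := hQ.act_characterAct U hπ (i := 1) (by rw [hm, one_smul])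
  rw [one_smul] at hT
  have h3 := congrArg ((TensorProduct.lid k B).toLinearMap ∘ₗ TensorProduct.map π.toLinearMap
    ((TensorProduct.lid k B).toLinearMap ∘ₗ TensorProduct.map π.toLinearMap LinearMap.id)) h
  simp [hb, hb2, hQ.assocMap_apply, hQ.comul, hπ, ← TensorProduct.smul_tmul', hm, hT,
    TensorProduct.add_tmul, TensorProduct.sub_tmul, TensorProduct.tmul_add,
    TensorProduct.tmul_sub, hQ.sq] at h3
  have h4 : w • U.characterAct π (U.characterAct π m) = (w * w) • m := by
    rw [← sub_eq_zero] at h3 ⊢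
    rw [← h3]
    module
  calc U.characterAct π (U.characterAct π m)
      = w • w • U.characterAct π (U.characterAct π m) := by
        rw [smul_smul, hQ.scalar_sq, one_smul]
    _ = w • m := by rw [h4, hQ.scalar_sq, one_smul]

end YetterDrinfeld
end Homogeneous

/-! ### Braided structures in homogeneous coordinates -/

section BraidedHopf

variable {k : Type*} [Field k] {H : Type*} [Ring H] [Algebra k H] {Q : QuasiBialgebra k H}
  {p : H} {w : k} {B : Type*} [AddCommGroup B] [Module k B]

namespace IsGenerator

/-- The four scalar factors come from the four reassociators of the interchange. The operator on `c`
comes from its single braiding, which moves `c` past `q`. -/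
theorem interchange_tmul (hQ : IsGenerator Q p w) (U : YDModule Q B) {π : H →ₐ[k] k}
    (hπ : π p = 1) {M N : Type*} [AddCommGroup M] [Module k M] [AddCommGroup N] [Module k N]
    {σ : H →ₐ[k] Module.End k M} {τ : H →ₐ[k] Module.End k N} {b c : B} {q : M} {r : N}
    {i j l n : k} (hb : U.act p b = i • b) (hc : U.act p c = j • c) (hq : σ p q = l • q)
    (hr : τ p r = n • r) :
    U.interchange σ τ ((b ⊗ₜ c) ⊗ₜ (q ⊗ₜ r)) =
      ((1 + (w - 1) * i * j * (l + n - 2 * l * n)) * (1 + (w - 1) * j * l * n) *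
        (1 + (w - 1) * l * j * n) * (1 + (w - 1) * i * l * (j + n - 2 * j * n))) •
      ((b ⊗ₜ q) ⊗ₜ ((c + l • (U.characterAct π c - c)) ⊗ₜ r)) := by
  have hc' : U.act p (c + l • (U.characterAct π c - c)) =
      j • (c + l • (U.characterAct π c - c)) := by
    rw [map_add, map_smul, map_sub, hQ.act_characterAct U hπ hc, hc]
    module
  have e1 := hQ.assocMap_tmul hb hc (hQ.tensorRep_tmul hq hr)
  have e2 := hQ.assocInv_tmul hc hq hr
  have e3 := braid_tmul (σ := σ) (hQ.coact_eq U hπ c) hq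
  have e4 := hQ.assocMap_tmul hq hc' hr
  have e5 := hQ.assocInv_tmul hb hq (hQ.tensorRep_tmul hc' hr)
  simp only [YDModule.interchange, LinearMap.comp_apply, e1, map_smul, LinearMap.lTensor_tmul, e2,
    LinearMap.rTensor_tmul, e3, e4, e5, TensorProduct.tmul_smul]
  module

variable {b c d : B} {i j l : k}

theorem act_mul (hQ : IsGenerator Q p w) (A : YDAlgebra Q B) (hb : A.act p b = i • b)
    (hc : A.act p c = j • c) :
    A.act p (A.mul (b ⊗ₜ c)) = (i + j - 2 * i * j) • A.mul (b ⊗ₜ c) := by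
  rw [A.act_mul, hQ.tensorRep_tmul hb hc, map_smul]

theorem mul_assoc (hQ : IsGenerator Q p w) (A : YDAlgebra Q B) (hb : A.act p b = i • b)
    (hc : A.act p c = j • c) (hd : A.act p d = l • d) :
    A.mul (A.mul (b ⊗ₜ c) ⊗ₜ d) =
      (1 + (w - 1) * i * j * l) • A.mul (b ⊗ₜ A.mul (c ⊗ₜ d)) := by
  have h := A.mul_assoc ((b ⊗ₜ c) ⊗ₜ d)
  rw [hQ.assocMap_tmul hb hc hd] at h
  simpa using h

theorem act_one (hQ : IsGenerator Q p w) (A : YDAlgebra Q B) : A.act p A.one = 0 := by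
  rw [A.act_one, hQ.counit, zero_smul]

theorem counit_act (hQ : IsGenerator Q p w) (A : YDBialgebra Q B) (b : B) :
    A.counit (A.act p b) = 0 := by
  rw [A.counit_act, hQ.counit, zero_mul]

/-- Dual form of the additivity of degrees, used to discard coefficients of coproducts that lie in
the wrong degree. -/
theorem pairing_comul_act (hQ : IsGenerator Q p w) (A : YDBialgebra Q B) {X Y : B →ₗ[k] k}
    (hX : ∀ b, X (A.act p b) = i * X b) (hY : ∀ b, Y (A.act p b) = j * Y b) (b : B) :
    pairing X Y (A.comul (A.act p b)) = (i + j - 2 * i * j) * pairing X Y (A.comul b) := by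
  rw [A.comul_act]
  change pairing X Y (boxRep A.act A.act (Q.comul p) (A.comul b)) = _
  rw [hQ.comul]
  generalize A.comul b = t
  induction t using TensorProduct.induction_on with
  | zero => simp
  | tmul x y =>
    simp [hX, hY]
    ring
  | add x y hx hy => rw [map_add, map_add, hx, hy, map_add, mul_add]

end IsGenerator

theorem YDBialgebra.pairing_counit_left (A : YDBialgebra Q B) (X : B →ₗ[k] k) (b : B) :
    pairing A.counit X (A.comul b) = X b := by
  conv_rhs => rw [← A.counit_left b]
  generalize A.comul b = t
  induction t using TensorProduct.induction_on with
  | zero => simp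
  | tmul x y => simp
  | add x y hx hy => rw [map_add, hx, hy, map_add, map_add, map_add]

theorem YDBialgebra.pairing_counit_right (A : YDBialgebra Q B) (X : B →ₗ[k] k) (b : B) :
    pairing X A.counit (A.comul b) = X b := by
  conv_rhs => rw [← A.counit_right b]
  generalize A.comul b = t
  induction t using TensorProduct.induction_on with
  | zero => simp
  | tmul x y => simp [mul_comm]
  | add x y hx hy => rw [map_add, hx, hy, map_add, map_add, map_add]

/-- The expansion of a coproduct in a three-dimensional braided bialgebra with respect to a basis
`1, x, y` adapted to the counit. -/
theorem YDBialgebra.comul_expansion (A : YDBialgebra Q B) {x y : B} {X Y : B →ₗ[k] k}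
    (hs : ∀ b, b = A.counit b • A.one + X b • x + Y b • y) (b : B) :
    A.comul b = A.counit b • (A.one ⊗ₜ A.one) + X b • (A.one ⊗ₜ x + x ⊗ₜ A.one) +
      Y b • (A.one ⊗ₜ y + y ⊗ₜ A.one) + pairing X X (A.comul b) • (x ⊗ₜ x) +
      pairing X Y (A.comul b) • (x ⊗ₜ y) + pairing Y X (A.comul b) • (y ⊗ₜ x) +
      pairing Y Y (A.comul b) • (y ⊗ₜ[k] y) := by
  have key : ∀ t : B ⊗[k] B, t = pairing A.counit A.counit t • (A.one ⊗ₜ A.one) +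
      (pairing A.counit X t • (A.one ⊗ₜ x) + pairing X A.counit t • (x ⊗ₜ A.one)) +
      (pairing A.counit Y t • (A.one ⊗ₜ y) + pairing Y A.counit t • (y ⊗ₜ A.one)) +
      pairing X X t • (x ⊗ₜ x) + pairing X Y t • (x ⊗ₜ y) + pairing Y X t • (y ⊗ₜ x) +
      pairing Y Y t • (y ⊗ₜ[k] y) := by
    intro t
    induction t using TensorProduct.induction_on with
    | zero => simp
    | tmul a c =>
      conv_lhs => rw [hs a, hs c]
      simp only [pairing_tmul, TensorProduct.tmul_add, TensorProduct.add_tmul,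
        TensorProduct.tmul_smul, ← TensorProduct.smul_tmul']
      module
    | add u v hu hv =>
      conv_lhs => rw [hu, hv]
      simp only [map_add]
      module
  conv_lhs => rw [key (A.comul b)]
  simp only [A.pairing_counit_left, A.pairing_counit_right, smul_add]

end BraidedHopf

/-! ### A criterion for semisimplicity of the biproduct -/

section Semisimplicity

/-- For `f` in the radical `1 - f` has a left inverse, and `(1 - f)f = 0`. -/
theorem Ideal.eq_zero_of_idempotent_mem_jacobson {R : Type*} [Ring R] {f : R} (hf : f * f = f)
    (h : f ∈ Ring.jacobson R) : f = 0 := by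
  rw [← Ideal.jacobson_bot, Ideal.mem_jacobson_iff] at h
  obtain ⟨z, hz⟩ := h (-1)
  have h1 : z * (1 - f) = 1 := by
    rw [Ideal.mem_bot] at hz
    rw [← sub_eq_zero, ← hz]
    noncomm_ring
  calc f = z * (1 - f) * f := by rw [h1, one_mul]
    _ = 0 := by rw [_root_.mul_assoc, sub_mul, one_mul, hf, sub_self, mul_zero]

variable {k : Type*} [Field k] {H : Type*} [Ring H] [Algebra k H] {Q : QuasiBialgebra k H}
  {p : H} {w : k} {B : Type*} [AddCommGroup B] [Module k B]

/-- The combination `(1 - s)(1 - p) + sp`; the idempotent of degree `s` if `s` is `0` or `1`. -/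
def degreeElement (p : H) (s : k) : H := (1 - s) • (1 - p) + s • p

/-- For degrees 0 and 1 the first factor is a Kronecker delta: the product survives only if `s` is
the degree of `c` plus `l`. This makes `B × H` a graded matrix-like algebra. -/
theorem IsGenerator.smashMul_tmul (hQ : IsGenerator Q p w) (A : YDAlgebra Q B) {b c : B}
    {i j : k} (s : k) {l : k} (hl : l * l = l) (hb : A.act p b = i • b) (hc : A.act p c = j • c) :
    A.smashMul ((b ⊗ₜ degreeElement p s) ⊗ₜ (c ⊗ₜ degreeElement p l)) =
      (((1 - s) * (1 - (j + l - 2 * j * l)) + s * (j + l - 2 * j * l)) *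
        (1 + (w - 1) * i * j * l)) • (A.mul (b ⊗ₜ c) ⊗ₜ degreeElement p l) := by
  have hp : regRep k H p (degreeElement p l) = l • degreeElement p l := by
    change p * degreeElement p l = _
    simp only [degreeElement, mul_add, mul_smul_comm, mul_sub, mul_one, hQ.sq,
      sub_self, smul_zero, zero_add, smul_add, smul_smul, hl,
      show l * (1 - l) = 0 by linear_combination -hl, zero_smul]
  have hr : A.rep (degreeElement p s) (c ⊗ₜ degreeElement p l) =
      ((1 - s) * (1 - (j + l - 2 * j * l)) + s * (j + l - 2 * j * l)) •
        (c ⊗ₜ[k] degreeElement p l) := by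
    have h1 : A.rep p (c ⊗ₜ degreeElement p l) = _ := hQ.tensorRep_tmul hc hp
    conv_lhs => rw [degreeElement]
    rw [map_add, map_smul, map_smul, map_sub, map_one, LinearMap.add_apply, LinearMap.smul_apply,
      LinearMap.smul_apply, LinearMap.sub_apply, h1, Module.End.one_apply]
    module
  rw [YDAlgebra.smashMul_tmul, hr, TensorProduct.tmul_smul, map_smul, YDAlgebra.star,
    LinearMap.comp_apply, hQ.assocInv_tmul hb hc hp, map_smul, LinearMap.rTensor_tmul, smul_smul]

theorem IsGenerator.exists_homogeneous_sum (hQ : IsGenerator Q p w) (U : YDModule Q B)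
    (t : B ⊗[k] H) : ∃ b₀ b₁ c₀ c₁ : B, U.act p b₀ = (0 : k) • b₀ ∧ U.act p b₁ = (1 : k) • b₁ ∧
      U.act p c₀ = (0 : k) • c₀ ∧ U.act p c₁ = (1 : k) • c₁ ∧
      t = b₀ ⊗ₜ degreeElement p (0 : k) + b₁ ⊗ₜ degreeElement p (0 : k) +
        (c₀ ⊗ₜ degreeElement p (1 : k) + c₁ ⊗ₜ degreeElement p (1 : k)) := by
  have hpp : ∀ b, U.act p (U.act p b) = U.act p b := fun b => by
    rw [← Module.End.mul_apply, ← map_mul, hQ.sq]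
  have h : ∃ b c : B, t = b ⊗ₜ degreeElement p (0 : k) + c ⊗ₜ degreeElement p (1 : k) := by
    induction t using TensorProduct.induction_on with
    | zero => exact ⟨0, 0, by simp⟩
    | tmul x h =>
      obtain ⟨a, b, rfl⟩ := hQ.span h
      refine ⟨a • x, (a + b) • x, ?_⟩
      rw [TensorProduct.smul_tmul, TensorProduct.smul_tmul, ← TensorProduct.tmul_add]
      congr 1
      simp only [degreeElement]
      module
    | add x y hx hy =>
      obtain ⟨b, c, rfl⟩ := hx
      obtain ⟨b', c', rfl⟩ := hy
      exact ⟨b + b', c + c', by simp only [TensorProduct.add_tmul]; abel⟩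
  obtain ⟨b, c, rfl⟩ := h
  exact ⟨b - U.act p b, U.act p b, c - U.act p c, U.act p c, by simp [hpp], by simp [hpp],
    by simp [hpp], by simp [hpp], by simp only [← TensorProduct.add_tmul, sub_add_cancel]⟩

theorem IsGenerator.isSemisimpleRing_biproduct (hQ : IsGenerator Q p w) [Module.Finite k H]
    [Module.Finite k B] (A : YDHopfAlgebra Q B)
    (hA : ∀ i : k, i * i = i → ∀ b, A.act p b = i • b → b ≠ 0 → ∃ c, A.act p c = i • c ∧
      A.mul (A.mul (c ⊗ₜ b) ⊗ₜ A.mul (c ⊗ₜ b)) = A.mul (c ⊗ₜ b) ∧ A.mul (c ⊗ₜ b) ≠ 0) :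
    IsSemisimpleRing (Biproduct A) := by
  have : Module.Finite k (Biproduct A) := inferInstanceAs (Module.Finite k (B ⊗[k] H))
  have : IsArtinianRing (Biproduct A) := IsArtinianRing.of_finite k _
  rw [IsArtinianRing.isSemisimpleRing_iff_jacobson]
  set J := Ring.jacobson (Biproduct A) with hJ
  let I : Submodule k (B ⊗[k] H) := (J.restrictScalars k : Submodule k (Biproduct A))
  have mul_mem_left : ∀ u v : B ⊗[k] H, v ∈ I → A.smashMul (u ⊗ₜ v) ∈ I :=
    fun u v hv => J.mul_mem_left (show Biproduct A from u) hv
  have mul_mem_right : ∀ u v : B ⊗[k] H, u ∈ I → A.smashMul (u ⊗ₜ v) ∈ I :=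
    fun u v hu => J.mul_mem_right (show Biproduct A from v) hu
  -- Its square is 1, because `ijl` is idempotent and `w² = 1`.
  have hw : ∀ i j l : k, i * i = i → j * j = j → l * l = l → 1 + (w - 1) * i * j * l ≠ 0 := by
    intro i j l hi hj hl h
    have hx : (i * j * l) * (i * j * l) = i * j * l := by
      linear_combination j * j * l * l * hi + i * l * l * hj + i * j * hl
    have : (1 : k) = 0 := by
      linear_combination (1 + (w - 1) * i * j * l) * h - (w - 1) ^ 2 * hx - i * j * l * hQ.scalar_sq
    exact one_ne_zero this
  have key : ∀ (i l : k), i * i = i → l * l = l → ∀ b, A.act p b = i • b →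
      b ⊗ₜ degreeElement p l ∈ I → b = 0 := by
    intro i l hi hl b hb hm
    by_contra hb0
    obtain ⟨c, hc, hf, hf0⟩ := hA i hi b hb hb0
    -- This degree makes the Kronecker delta equal 1, so the product is a nonzero multiple of `cb ⊗
    -- e_l`. Since `cb` is an even idempotent, `cb ⊗ e_l` is an idempotent in the radical.
    have h1 := mul_mem_left (c ⊗ₜ degreeElement p (i + l - 2 * i * l)) _ hm
    rw [hQ.smashMul_tmul A.toYDAlgebra _ hl hc hb,
      show (1 - (i + l - 2 * i * l)) * (1 - (i + l - 2 * i * l)) +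
        (i + l - 2 * i * l) * (i + l - 2 * i * l) = 1 by
          grind, one_mul] at h1
    have h2 := (I.smul_mem_iff (hw i i l hi hi hl)).1 h1
    have hf1 : A.act p (A.mul (c ⊗ₜ b)) = (0 : k) • A.mul (c ⊗ₜ b) := by
      rw [hQ.act_mul A.toYDAlgebra hc hb]
      congr 1
      linear_combination -2 * hi
    have h3 := hQ.smashMul_tmul A.toYDAlgebra l hl hf1 hf1
    rw [show ((1 - l) * (1 - (0 + l - 2 * 0 * l)) + l * (0 + l - 2 * 0 * l)) *
      (1 + (w - 1) * 0 * 0 * l) = 1 by linear_combination 2 * hl, one_smul, hf] at h3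
    have h4 := Ideal.eq_zero_of_idempotent_mem_jacobson (R := Biproduct A) h3 h2
    obtain ⟨π, hπ⟩ := hQ.exists_character
    -- The functional `π + ε` takes the value 1 on each of the two degree idempotents, so it
    -- recovers `cb`.
    have h5 := congrArg (TensorProduct.rid k B ∘ TensorProduct.map LinearMap.id
      (π.toLinearMap + Q.counit.toLinearMap)) (show (_ : B ⊗[k] H) = 0 from h4)
    simp only [degreeElement, Function.comp_apply, TensorProduct.map_tmul, LinearMap.id_apply,
      LinearMap.add_apply, AlgHom.toLinearMap_apply, map_add, map_smul, map_sub, map_one, hπ,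
      hQ.counit, TensorProduct.rid_tmul, map_zero, smul_eq_mul] at h5
    apply hf0
    rw [← h5]
    module
  rw [eq_bot_iff]
  intro a ha
  obtain ⟨b₀, b₁, c₀, c₁, hb₀, hb₁, hc₀, hc₁, e⟩ := hQ.exists_homogeneous_sum A.toYDModule a
  have h1 : A.act p A.one = (0 : k) • A.one := by rw [hQ.act_one, zero_smul]
  have hm : ∀ s l : k, A.smashMul ((A.one ⊗ₜ degreeElement p s) ⊗ₜ
      A.smashMul ((a : B ⊗[k] H) ⊗ₜ (A.one ⊗ₜ degreeElement p l))) ∈ I :=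
    fun s l => mul_mem_left _ _ (mul_mem_right _ _ ha)
  have z0 : (0 : k) * 0 = 0 := mul_zero 0
  have z1 : (1 : k) * 1 = 1 := mul_one 1
  have comp := fun (s l : k) (hl : l * l = l) (c : B) (i : k) (hc : A.act p c = i • c) =>
    hQ.smashMul_tmul A.toYDAlgebra s hl h1 hc
  have comp' := fun (s l : k) (hl : l * l = l) (c : B) (i : k) (hc : A.act p c = i • c) =>
    hQ.smashMul_tmul A.toYDAlgebra s hl hc h1
  -- Multiplying by `1 ⊗ e_s` on the left and `1 ⊗ e_l` on the right isolates the component `b ⊗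
  -- e_l` with `b` of degree `s + l`. The four choices yield all four components of `a`.
  have m00 := hm 0 0
  have m01 := hm 1 0
  have m10 := hm 1 1
  have m11 := hm 0 1
  rw [e] at m00 m01 m10 m11
  simp [TensorProduct.add_tmul, TensorProduct.tmul_add, comp' _ _ z0 _ _ hb₀, comp' _ _ z0 _ _ hb₁,
    comp' _ _ z0 _ _ hc₀, comp' _ _ z0 _ _ hc₁,comp' _ _ z1 _ _ hb₀, comp' _ _ z1 _ _ hb₁,
    comp' _ _ z1 _ _ hc₀, comp' _ _ z1 _ _ hc₁,
    comp _ _ z0 _ _ hb₀, comp _ _ z0 _ _ hb₁, comp _ _ z1 _ _ hc₀, comp _ _ z1 _ _ hc₁,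
    show (1 : k) + 1 - 2 = 0 by ring, A.one_mul, A.mul_one] at m00 m01 m10 m11
  rw [key _ _ z0 z0 _ hb₀ m00, key _ _ z1 z0 _ hb₁ m01, key _ _ z0 z1 _ hc₀ m10,
    key _ _ z1 z1 _ hc₁ m11] at e
  simp only [TensorProduct.zero_tmul, add_zero] at e
  exact e

end Semisimplicity

/-! ### Bases adapted to a functional on a three-dimensional space -/

section LinearAlgebra

variable {k : Type*} [Field k] {V : Type*} [AddCommGroup V] [Module k V]

/-- The kernel of `ε` has dimension at least 2, so it is not contained in the line through `y`. -/
theorem exists_linearIndependent_pair (hV : Module.finrank k V = 3) (ε : V →ₗ[k] k) {y : V}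
    (hy : y ≠ 0) : ∃ z, ε z = 0 ∧ LinearIndependent k ![z, y] := by
  have : Module.Finite k V := Module.finite_of_finrank_pos (by omega)
  have hker : 2 ≤ Module.finrank k (LinearMap.ker ε) := by
    have h := LinearMap.finrank_range_add_finrank_ker ε
    have h1 := Submodule.finrank_le (LinearMap.range ε)
    rw [Module.finrank_self] at h1
    omega
  obtain ⟨z, hz, hzy⟩ : ∃ z ∈ LinearMap.ker ε, z ∉ Submodule.span k {y} := by
    by_contra! h
    have h1 := Submodule.finrank_mono (show LinearMap.ker ε ≤ Submodule.span k {y} from h)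
    rw [finrank_span_singleton hy] at h1
    omega
  refine ⟨z, hz, ?_⟩
  rw [LinearIndependent.pair_symm_iff, LinearIndependent.pair_iff' hy]
  exact fun a ha => hzy (ha ▸ Submodule.smul_mem _ _ (Submodule.mem_span_singleton_self y))

theorem exists_coordinates (hV : Module.finrank k V = 3) {ε : V →ₗ[k] k} {e x y : V}
    (he : ε e = 1) (hx : ε x = 0) (hy : ε y = 0) (h : LinearIndependent k ![x, y]) :
    ∃ X Y : V →ₗ[k] k, X e = 0 ∧ X x = 1 ∧ X y = 0 ∧ Y e = 0 ∧ Y x = 0 ∧ Y y = 1 ∧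
      ∀ b, b = ε b • e + X b • x + Y b • y := by
  have hl : LinearIndependent k ![e, x, y] := by
    rw [LinearIndependent.pair_iff] at h
    rw [Fintype.linearIndependent_iff]
    intro g hg
    simp [Fin.sum_univ_three] at hg
    have h0 := congrArg ε hg
    simp [he, hx, hy] at h0
    rw [h0, zero_smul, zero_add] at hg
    obtain ⟨h1, h2⟩ := h _ _ hg
    intro i
    fin_cases i <;> assumption
  let b := basisOfLinearIndependentOfCardEqFinrank hl (by simp [hV])
  have b0 : b 0 = e := by simp [b]
  have b1 : b 1 = x := by simp [b]
  have b2 : b 2 = y := by simp [b]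
  have hc : ∀ i j, b.coord i (b j) = if j = i then 1 else 0 := fun i j => by
    simp [Finsupp.single_apply]
  have hsum : ∀ v, v = b.coord 0 v • e + b.coord 1 v • x + b.coord 2 v • y := fun v => by
    conv_lhs => rw [← b.sum_repr v]
    rw [Fin.sum_univ_three, b0, b1, b2]
    rfl
  refine ⟨b.coord 1, b.coord 2, ?_, ?_, ?_, ?_, ?_, ?_, fun v => ?_⟩
  · rw [← b0, hc]; simp
  · rw [← b1, hc]; simp
  · rw [← b2, hc]; simp
  · rw [← b0, hc]; simp
  · rw [← b1, hc]; simp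
  · rw [← b2, hc]; simp
  · have h1 := congrArg ε (hsum v)
    simp only [map_add, map_smul, he, hx, hy, smul_eq_mul, mul_one, mul_zero, add_zero] at h1
    rw [h1]
    exact hsum v

end LinearAlgebra

/-! ### Three-dimensional ordinary Hopf algebras -/

section OrdinaryHopf

open Coalgebra HopfAlgebra

variable {k : Type*} [Field k] {B : Type*} [Ring B] [HopfAlgebra k B]

/-- The right convolution operator `b ↦ b₁ f(b₂)`. -/
def convRight (f : B →ₗ[k] k) : B →ₗ[k] B :=
  (TensorProduct.rid k B).toLinearMap ∘ₗ f.lTensor B ∘ₗ comul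

theorem counit_convRight (f : B →ₗ[k] k) (b : B) :
    counit (R := k) (convRight f b) = f b := by
  have h := congrArg (fun t => f (TensorProduct.lid k B t)) (rTensor_counit_comul (R := k) b)
  simp only [TensorProduct.lid_tmul, one_smul] at h
  rw [← h, convRight, LinearMap.comp_apply, LinearMap.comp_apply]
  generalize (comul b : B ⊗[k] B) = t
  induction t using TensorProduct.induction_on with
  | zero => simp
  | tmul x y => simp [mul_comm]
  | add x y hx hy => simp only [map_add, hx, hy]

theorem convRight_counit (b : B) : convRight (counit (R := k)) b = b := by
  simp [convRight]

/-- Coassociativity: both sides are `b₁ f(b₂) f'(b₃)`. Composition of operators thus becomes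
convolution of functionals. -/
theorem convRight_convRight (f f' : B →ₗ[k] k) (b : B) :
    convRight f (convRight f' b) = convRight (f ∘ₗ convRight f') b := by
  have h := congrArg (TensorProduct.rid k B ∘ TensorProduct.map LinearMap.id (pairing f f'))
    (coassoc_apply (R := k) b)
  simp only [convRight, LinearMap.comp_apply, Function.comp_apply, LinearEquiv.coe_coe] at h ⊢
  have h1 : ∀ t : B ⊗[k] B, TensorProduct.rid k B (TensorProduct.map LinearMap.id (pairing f f')
      (TensorProduct.assoc k B B B (comul.rTensor B t))) = TensorProduct.rid k B (f.lTensor B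
        (comul (TensorProduct.rid k B (f'.lTensor B t)))) := by
    intro t
    induction t using TensorProduct.induction_on with
    | zero => simp
    | add x y hx hy => simp only [map_add, hx, hy]
    | tmul x y =>
      simp only [LinearMap.rTensor_tmul, LinearMap.lTensor_tmul, TensorProduct.rid_tmul, map_smul]
      generalize (comul x : B ⊗[k] B) = s
      induction s using TensorProduct.induction_on with
      | zero => simp
      | add x y hx hy => simp only [TensorProduct.add_tmul, map_add, hx, hy, smul_add]
      | tmul x z => simp [smul_smul, mul_comm]
  have h2 : ∀ t : B ⊗[k] B, TensorProduct.rid k B (TensorProduct.map LinearMap.id (pairing f f')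
      (comul.lTensor B t)) = TensorProduct.rid k B ((f ∘ₗ convRight f').lTensor B t) := by
    intro t
    induction t using TensorProduct.induction_on with
    | zero => simp
    | add x y hx hy => simp only [map_add, hx, hy]
    | tmul x y =>
      simp only [LinearMap.lTensor_tmul, TensorProduct.rid_tmul, TensorProduct.map_tmul,
        LinearMap.id_apply, LinearMap.comp_apply, convRight, LinearEquiv.coe_coe]
      congr 1
      generalize (comul y : B ⊗[k] B) = s
      induction s using TensorProduct.induction_on with
      | zero => simp
      | add x y hx hy => simp only [map_add, hx, hy]
      | tmul x z => simp [mul_comm]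
  rw [h1, h2] at h
  exact h

theorem convRight_mul (χ : B →ₐ[k] k) (b c : B) :
    convRight χ.toLinearMap (b * c) = convRight χ.toLinearMap b * convRight χ.toLinearMap c := by
  have h : ∀ b, convRight χ.toLinearMap b = (Algebra.TensorProduct.rid k k B).toAlgHom
      (Algebra.TensorProduct.map (AlgHom.id k B) χ (Bialgebra.comulAlgHom k B b)) := fun _ => rfl
  simp only [h, map_mul]

theorem convRight_derivation {ξ : B →ₗ[k] k}
    (hξ : ∀ b c, ξ (b * c) = ξ b * counit (R := k) c + counit (R := k) b * ξ c) (b c : B) :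
    convRight ξ (b * c) = convRight ξ b * c + b * convRight ξ c := by
  have h : ∀ u v : B ⊗[k] B, TensorProduct.rid k B (ξ.lTensor B (u * v)) =
      TensorProduct.rid k B (ξ.lTensor B u) * TensorProduct.rid k B (counit.lTensor B v) +
      TensorProduct.rid k B (counit.lTensor B u) * TensorProduct.rid k B (ξ.lTensor B v) := by
    intro u v
    induction u using TensorProduct.induction_on with
    | zero => simp
    | add x y hx hy => simp only [add_mul, map_add, hx, hy]; abel
    | tmul x y =>
      induction v using TensorProduct.induction_on with
      | zero => simp
      | add x y hx hy => simp only [mul_add, map_add, hx, hy]; abel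
      | tmul z t =>
        simp only [Algebra.TensorProduct.tmul_mul_tmul, LinearMap.lTensor_tmul,
          TensorProduct.rid_tmul, hξ, smul_mul_smul_comm, add_smul]
  have h1 := h (comul b) (comul c)
  rw [← Bialgebra.comul_mul] at h1
  refine h1.trans ?_
  congr 2
  · exact convRight_counit c
  · exact convRight_counit b

/-- Expanding gives `χ(S(b₁)b₂)`. This expresses that `χ` is invertible under convolution. -/
theorem antipode_convRight (χ : B →ₐ[k] k) (b : B) :
    χ (antipode k (convRight χ.toLinearMap b)) = counit (R := k) b := by
  have h := congrArg χ (mul_antipode_rTensor_comul_apply (R := k) b)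
  rw [AlgHom.commutes] at h
  refine Eq.trans ?_ h
  simp only [convRight, LinearMap.comp_apply]
  generalize (comul b : B ⊗[k] B) = t
  induction t using TensorProduct.induction_on with
  | zero => simp
  | tmul x y => simp [mul_comm]
  | add x y hx hy => simp only [map_add, hx, hy]

/-- A functional that kills `W` but not `x` yields an `ε`-derivation `ξ`, since `W` contains all
products from the augmentation ideal. The associated derivation `D` of `B` satisfies `ε(D³(x³)) =
6ξ(x)³`, which is nonzero in characteristic zero. -/
theorem mem_of_cube_eq_zero [CharZero k] (W : Submodule k B) {x : B}
    (hx : counit (R := k) x = 0)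
    (hW : ∀ a b : B, counit (R := k) a = 0 → counit (R := k) b = 0 → a * b ∈ W)
    (h3 : x * x * x = 0) : x ∈ W := by
  by_contra hxW
  obtain ⟨f, hf, hWf⟩ := Submodule.exists_le_ker_of_notMem hxW
  let ξ : B →ₗ[k] k := f - f 1 • counit
  have hξ : ∀ b c, ξ (b * c) = ξ b * counit (R := k) c + counit (R := k) b * ξ c := by
    intro b c
    have h := hWf (hW (b - counit (R := k) b • 1) (c - counit (R := k) c • 1)
      (by simp) (by simp))
    simp only [LinearMap.mem_ker, mul_sub, sub_mul, mul_smul_comm, smul_mul_assoc, mul_one,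
      one_mul, map_sub, map_smul, smul_eq_mul] at h
    simp only [ξ, LinearMap.sub_apply, LinearMap.smul_apply, smul_eq_mul, Bialgebra.counit_mul]
    linear_combination h
  have hξx : ξ x ≠ 0 := by simpa [ξ, hx] using hf
  have hD := convRight_derivation hξ
  have hε := counit_convRight ξ
  have h := congrArg (fun b => counit (R := k) (convRight ξ (convRight ξ (convRight ξ b)))) h3
  simp only [hD, map_add, map_zero, Bialgebra.counit_mul, hε, hx, mul_zero, zero_mul, add_zero,
    zero_add] at h
  have h6 : 6 * ξ x ^ 3 = 0 := by linear_combination h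
  exact absurd h6 (mul_ne_zero (by norm_num) (pow_ne_zero 3 hξx))

/-- Otherwise `f²` lies on the line of `w`. Then `w(ff) = 0` forces `σ = 0`, hence `f³ = 0`. All
products in the augmentation ideal lie on that line, so `mem_of_cube_eq_zero` would place `f` there
too. -/
theorem coord_square_ne_zero [CharZero k] {f w : B} {X Y : B →ₗ[k] k}
    (hf : counit (R := k) f = 0) (hXf : X f = 1) (hXw : X w = 0)
    (hs : ∀ b : B, b = counit (R := k) b • (1 : B) + X b • f + Y b • w) (hw0 : w ≠ 0)
    (hww : w * w = 0) {ρ σ : k} (hfw : f * w = ρ • w) (hwf : w * f = σ • w) : X (f * f) ≠ 0 := by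
  intro h0
  have hff : f * f = Y (f * f) • w := by
    have := hs (f * f)
    rwa [Bialgebra.counit_mul, hf, zero_mul, zero_smul, h0, zero_smul, zero_add, zero_add] at this
  have h3 : f * f * f = 0 := by
    have h : w * f * f = w * (f * f) := mul_assoc _ _ _
    rw [hff, hwf, smul_mul_assoc, hwf, mul_smul_comm, hww, smul_zero, smul_smul] at h
    have hσ : σ = 0 := mul_self_eq_zero.1 ((smul_eq_zero.1 h).resolve_right hw0)
    rw [hff, smul_mul_assoc, hwf, hσ, zero_smul, smul_zero]
  have hm := mem_of_cube_eq_zero (Submodule.span k {w}) hf (fun a b ha hb => by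
    rw [hs a, hs b, ha, hb]
    simp only [zero_smul, zero_add, mul_add, add_mul, smul_mul_smul_comm, hww, hfw, hwf, smul_smul,
      smul_zero, add_zero]
    rw [hff]
    simp only [smul_smul, ← add_smul]
    exact Submodule.smul_mem _ _ (Submodule.mem_span_singleton_self w)) h3
  obtain ⟨a, rfl⟩ := Submodule.mem_span_singleton.1 hm
  simp [hXw] at hXf

/-- Modulo `w` there are two characters, `ε` and `χ = ε + X`. Convolution with `χ` is an algebra
endomorphism `φ` preserving the line of `w`, and `χ ∘ φ`, the convolution square of `χ`, must be `ε`
or `χ`. Either case is contradictory. -/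
theorem false_of_nilpotent_line [CharZero k] {f w : B} {X Y : B →ₗ[k] k}
    (hf : counit (R := k) f = 0) (hw : counit (R := k) w = 0) (hX1 : X 1 = 0) (hXf : X f = 1)
    (hXw : X w = 0) (hYw : Y w = 1)
    (hs : ∀ b : B, b = counit (R := k) b • (1 : B) + X b • f + Y b • w) (hww : w * w = 0)
    {ρ σ κ : k} (hff : f * f = f + κ • w) (hfw : f * w = ρ • w) (hwf : w * f = σ • w) : False := by
  have hw0 : w ≠ 0 := fun h => by simp [h] at hYw
  have hσ : σ * σ = σ := by
    have h : w * f * f = w * (f * f) := mul_assoc _ _ _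
    rw [hff, mul_add, hwf, smul_mul_assoc, hwf, mul_smul_comm, hww, smul_zero, add_zero,
      smul_smul] at h
    simpa [hYw] using congrArg Y h
  let χ : B →ₐ[k] k := AlgHom.ofLinearMap (counit + X) (by simp [hX1]) (fun a b => by
    simp only [LinearMap.add_apply, Bialgebra.counit_mul]
    conv_lhs => rw [hs a, hs b]
    simp only [mul_add, add_mul, smul_mul_smul_comm, hww, hfw, hwf, hff, one_mul, mul_one,
      map_add, map_smul, hX1, hXf, hXw, hf, hw, map_zero, smul_eq_mul, Bialgebra.counit_one]
    ring)
  have hχ : ∀ b, χ b = counit (R := k) b + X b := fun b => rfl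
  set φ := convRight χ.toLinearMap with hφ
  have hφm : ∀ b c, φ (b * c) = φ b * φ c := convRight_mul χ
  have hεφ : ∀ b, counit (R := k) (φ b) = χ b := counit_convRight χ.toLinearMap
  have hS : ∀ b, χ (antipode k (φ b)) = counit (R := k) b := antipode_convRight χ
  have hφw : φ w = Y (φ w) • w := by
    have h0 : counit (R := k) (φ w) = 0 := by rw [hεφ, hχ, hw, hXw, add_zero]
    have h1 : χ (φ w) * χ (φ w) = 0 := by rw [← map_mul, ← hφm, hww, map_zero, map_zero]
    have h2 := mul_self_eq_zero.1 h1
    rw [hχ, h0, zero_add] at h2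
    conv_lhs => rw [hs (φ w), h0, h2]
    simp
  set ν := Y (φ w)
  have hχφw : χ (φ w) = 0 := by rw [hφw, map_smul, hχ, hw, hXw]; simp
  have hs2 : χ (φ f) * χ (φ f) = χ (φ f) := by
    rw [← map_mul, ← hφm, hff, map_add, map_smul, map_add, map_smul, hχφw, smul_zero, add_zero]
  have hφ1 : φ 1 = 1 := by simp [hφ, convRight, Algebra.TensorProduct.one_def]
  have ext : ∀ g g' : B →ₗ[k] k, g 1 = g' 1 → g f = g' f → g w = g' w → g = g' := by
    intro g g' h1 h2 h3
    ext b
    rw [hs b]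
    simp only [map_add, map_smul, h1, h2, h3]
  have hcases : χ (φ f) = 0 ∨ χ (φ f) = 1 := by
    have : χ (φ f) * (χ (φ f) - 1) = 0 := by linear_combination hs2
    exact (mul_eq_zero.1 this).imp id (fun h => by linear_combination h)
  rcases hcases with h | h
  -- If the square is `ε`, then `φ` is an involution sending `f` to `1 - f` modulo `w`. Applying it
  -- to `wf = σw` gives `2σ = 1`, against `σ² = σ`.
  · have hc : χ.toLinearMap ∘ₗ φ = counit (R := k) := by
      apply ext
      · simp [hφ1]
      · simpa [hf] using h
      · simpa [hw] using hχφw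
    have hinv : φ (φ w) = w := by rw [hφ, convRight_convRight, ← hφ, hc, convRight_counit]
    have hν : ν ≠ 0 := fun h0 => by
      rw [h0, zero_smul] at hφw
      rw [hφw, map_zero] at hinv
      exact hw0 hinv.symm
    have hφf : φ f = 1 - f + Y (φ f) • w := by
      have h1 : counit (R := k) (φ f) = 1 := by rw [hεφ, hχ, hf, hXf, zero_add]
      rw [hχ, h1] at h
      conv_lhs => rw [hs (φ f), h1, show X (φ f) = -1 by linear_combination h]
      module
    have h1 := hφm w f
    rw [hwf, map_smul, hφw, hφf] at h1
    simp only [mul_add, mul_sub, mul_one, smul_mul_assoc, hww, hwf, mul_smul_comm, smul_zero, add_zero] at h1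
    have h2 := congrArg Y h1
    simp only [map_sub, map_smul, hYw, smul_eq_mul, mul_one] at h2
    have h3 : ν * (2 * σ - 1) = 0 := by linear_combination h2
    have h4 : 2 * σ - 1 = 0 := (mul_eq_zero.1 h3).resolve_left hν
    have : (1 : k) = 0 := by linear_combination (2 * σ - 1) * h4 - 4 * hσ
    exact one_ne_zero this
  -- If the square is `χ`, then `φ` is idempotent, and the antipode identity at `f` and at `φ f`
  -- gives `ε(f) = χ(f)`, that is `0 = 1`.
  · have hc : χ.toLinearMap ∘ₗ φ = χ.toLinearMap := by
      apply ext
      · simp [hφ1]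
      · simp [h, hχ, hf, hXf]
      · simp [hχφw, hχ, hw, hXw]
    have h1 : φ (φ f) = φ f := by
      conv_lhs => rw [hφ, convRight_convRight, ← hφ, hc]
    have h2 := hS (φ f)
    rw [h1, hS, hεφ, hχ, hf, hXf] at h2
    simp at h2

/-- A three-dimensional Hopf algebra over a field of characteristic zero is semisimple. -/
theorem isSemisimpleRing_of_finrank_eq_three [CharZero k] (hB : Module.finrank k B = 3) :
    IsSemisimpleRing B := by
  have : Module.Finite k B := Module.finite_of_finrank_pos (by omega)
  have : IsArtinianRing B := IsArtinianRing.of_finite k B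
  rw [IsArtinianRing.isSemisimpleRing_iff_jacobson]
  by_contra hJ
  set J := Ring.jacobson B with hJdef
  have hnil : IsNilpotent J := by
    rw [hJdef, ← Ideal.jacobson_bot]; exact IsArtinianRing.isNilpotent_jacobson_bot
  have hJnil : ∀ a ∈ J, IsNilpotent a := by
    obtain ⟨n, hn⟩ := hnil
    intro a ha
    have := Ideal.pow_mem_pow ha n
    rw [hn] at this
    exact ⟨n, this⟩
  have hε : ∀ a ∈ J, counit (R := k) a = 0 := fun a ha =>
    ((hJnil a ha).map (Bialgebra.counitAlgHom k B)).eq_zero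
  -- Cayley-Hamilton: left multiplication by `a` is nilpotent on a three-dimensional space, so its
  -- characteristic polynomial is `X³`.
  have hcube : ∀ a ∈ J, a * a * a = 0 := by
    intro a ha
    have h1 : IsNilpotent (Algebra.lmul k B a) := (hJnil a ha).map (Algebra.lmul k B)
    have h2 := LinearMap.aeval_self_charpoly (Algebra.lmul k B a)
    rw [(LinearMap.isNilpotent_iff_charpoly _).1 h1, hB] at h2
    rw [map_pow, Polynomial.aeval_X, ← map_pow] at h2
    have h3 : Algebra.lmul k B (a ^ 3) 1 = 0 := by rw [h2]; rfl
    simpa [pow_succ] using h3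
  obtain ⟨w, hwJ, hw0⟩ := Submodule.exists_mem_ne_zero_of_ne_bot hJ
  have hw := hε w hwJ
  have h1 : counit (R := k) (1 : B) = 1 := Bialgebra.counit_one
  -- If the radical is a line, its generator `w` has `w² = 0`, and rescaling `f` by the coefficient
  -- of `f` in `f²` reduces to `false_of_nilpotent_line`.
  by_cases hline : ∀ a ∈ J, ∃ c : k, a = c • w
  · obtain ⟨f, hf, hli⟩ := exists_linearIndependent_pair hB (counit (R := k) (A := B)) hw0
    obtain ⟨X, Y, hX1, hXf, hXw, -, -, hYw, hs⟩ := exists_coordinates hB h1 hf hw hli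
    obtain ⟨ρ, hfw⟩ := hline _ (J.mul_mem_left f hwJ)
    obtain ⟨σ, hwf⟩ := hline _ (J.mul_mem_right f hwJ)
    obtain ⟨c, hww⟩ := hline _ (J.mul_mem_left w hwJ)
    have hc : c = 0 := by
      have h := hcube w hwJ
      rw [hww, smul_mul_assoc, hww, smul_smul] at h
      exact mul_self_eq_zero.1 ((smul_eq_zero.1 h).resolve_right hw0)
    rw [hc, zero_smul] at hww
    have hl := coord_square_ne_zero hf hXf hXw hs hw0 hww hfw hwf
    have hff : f * f = X (f * f) • f + Y (f * f) • w := by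
      have := hs (f * f)
      rwa [Bialgebra.counit_mul, hf, zero_mul, zero_smul, zero_add] at this
    set l := X (f * f)
    refine false_of_nilpotent_line (f := l⁻¹ • f) (X := l • X) (Y := Y) (ρ := l⁻¹ * ρ)
      (σ := l⁻¹ * σ) (κ := l⁻¹ * l⁻¹ * Y (f * f)) (w := w) ?_ hw ?_ ?_ ?_ hYw ?_ hww ?_ ?_ ?_
    · simp [hf]
    · simp [hX1]
    · simp [hXf, hl]
    · simp [hXw]
    · intro b
      conv_lhs => rw [hs b]
      rw [LinearMap.smul_apply, smul_smul, smul_eq_mul, mul_comm l, mul_assoc, mul_inv_cancel₀ hl,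
        mul_one]
    · rw [smul_mul_smul_comm]
      conv_lhs => rw [hff]
      rw [smul_add, smul_smul, smul_smul, mul_assoc, inv_mul_cancel₀ hl,
        mul_one]
    · rw [smul_mul_assoc, hfw, smul_smul]
    · rw [mul_smul_comm, hwf, smul_smul]
  -- Otherwise the radical is the whole augmentation ideal. Then `J ⊆ J²` by `mem_of_cube_eq_zero`,
  -- hence `J ⊆ Jⁿ` for all `n`, contradicting nilpotency.
  · push Not at hline
    obtain ⟨v, hvJ, hv⟩ := hline
    have hli : LinearIndependent k ![v, w] := by
      rw [LinearIndependent.pair_symm_iff, LinearIndependent.pair_iff' hw0]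
      exact fun a ha => hv a ha.symm
    obtain ⟨X, Y, -, -, -, -, -, -, hs⟩ := exists_coordinates hB h1 (hε v hvJ) hw hli
    have smul_mem : ∀ (I : Ideal B) (c : k) (a : B), a ∈ I → c • a ∈ I := fun I c a ha => by
      rw [Algebra.smul_def]; exact I.mul_mem_left _ ha
    have hNJ : ∀ a : B, counit (R := k) a = 0 → a ∈ J := fun a ha => by
      rw [hs a, ha, zero_smul, zero_add]
      exact J.add_mem (smul_mem J _ _ hvJ) (smul_mem J _ _ hwJ)
    have hJJ : J ≤ J * J := fun x hx =>
      mem_of_cube_eq_zero ((J * J).restrictScalars k) (hε x hx)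
        (fun a b ha hb => Ideal.mul_mem_mul (hNJ a ha) (hNJ b hb)) (hcube x hx)
    have hpow : ∀ n : ℕ, J ≤ J ^ (n + 1) := by
      intro n
      induction n with
      | zero => rw [zero_add, Submodule.pow_one]
      | succ n ih =>
        rw [Submodule.pow_succ]
        exact hJJ.trans (Ideal.mul_mono_left ih)
    obtain ⟨n, hn⟩ := hnil
    refine hJ (le_bot_iff.1 ((hpow n).trans ?_))
    rw [Submodule.pow_succ, hn]
    exact (Submodule.bot_mul J).le

end OrdinaryHopf

/-! ### Braided Hopf algebras concentrated in degree 0 -/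

section TrivialAction

variable {k : Type*} [Field k] {H : Type*} [Ring H] [Algebra k H] {Q : QuasiBialgebra k H}
  {p : H} {w : k} {B : Type*} [AddCommGroup B] [Module k B]

/-- The ring defined by a Yetter-Drinfeld algebra with a strictly associative multiplication. -/
abbrev YDAlgebra.ringOfAssoc (A : YDAlgebra Q B)
    (h : ∀ u v t : B, A.mul (A.mul (u ⊗ₜ v) ⊗ₜ t) = A.mul (u ⊗ₜ A.mul (v ⊗ₜ t))) : Ring B :=
  { (inferInstance : AddCommGroup B) with
    mul := fun u v => A.mul (u ⊗ₜ v)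
    one := A.one
    mul_assoc := h
    one_mul := A.one_mul
    mul_one := A.mul_one
    left_distrib := fun u v t =>
      (congrArg A.mul (TensorProduct.tmul_add u v t)).trans (map_add _ _ _)
    right_distrib := fun u v t =>
      (congrArg A.mul (TensorProduct.add_tmul u v t)).trans (map_add _ _ _)
    zero_mul := fun u => (congrArg A.mul (TensorProduct.zero_tmul _ u)).trans (map_zero _)
    mul_zero := fun u => (congrArg A.mul (TensorProduct.tmul_zero _ u)).trans (map_zero _) }

/-- In degree 0 the reassociator acts as the identity and the braiding is the flip, so `B` satisfies
the ordinary Hopf algebra axioms. -/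
theorem IsGenerator.exists_idempotent_of_act_eq_zero [CharZero k] (hQ : IsGenerator Q p w)
    (A : YDHopfAlgebra Q B) (hB : Module.finrank k B = 3) (hP : ∀ b, A.act p b = 0) {b : B}
    (hb : b ≠ 0) : ∃ c, A.mul (A.mul (c ⊗ₜ b) ⊗ₜ A.mul (c ⊗ₜ b)) = A.mul (c ⊗ₜ b) ∧
      A.mul (c ⊗ₜ b) ≠ 0 := by
  have hP0 : ∀ b, A.act p b = (0 : k) • b := fun b => by rw [hP, zero_smul]
  obtain ⟨π, hπ⟩ := hQ.exists_character
  let ring : Ring B := A.toYDAlgebra.ringOfAssoc fun u v t => by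
    have h := hQ.mul_assoc A.toYDAlgebra (hP0 u) (hP0 v) (hP0 t)
    rwa [mul_zero, add_zero, one_smul] at h
  let alg : Algebra k B := Algebra.ofModule
    (fun r (u v : B) => (congrArg A.mul (TensorProduct.smul_tmul' r u v).symm).trans
        (LinearMap.map_smul A.mul r (u ⊗ₜ v)))
    (fun r (u v : B) => (congrArg A.mul (TensorProduct.tmul_smul r u v)).trans
        (LinearMap.map_smul A.mul r (u ⊗ₜ v)))
  have mul_eq : ∀ u v : B, u * v = A.mul (u ⊗ₜ v) := fun _ _ => rfl
  have hassoc : ∀ t : (B ⊗[k] B) ⊗[k] B,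
      Q.assocMap A.act A.act A.act t = TensorProduct.assoc k B B B t := by
    intro t
    induction t using TensorProduct.induction_on with
    | zero => simp
    | add u v hu hv => simp only [map_add, hu, hv]
    | tmul s d =>
      induction s using TensorProduct.induction_on with
      | zero => simp
      | add u v hu hv => simp only [TensorProduct.add_tmul, map_add, hu, hv]
      | tmul b c => rw [hQ.assocMap_tmul (hP0 b) (hP0 c) (hP0 d)]; simp
  let coalg : Coalgebra k B :=
    { comul := A.comul
      counit := A.counit
      coassoc := LinearMap.ext fun b => (hassoc _).symm.trans (A.coassoc b)
      rTensor_counit_comp_comul := LinearMap.ext fun b =>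
        (TensorProduct.lid k B).injective (by simpa using A.counit_left b)
      lTensor_counit_comp_comul := LinearMap.ext fun b =>
        (TensorProduct.rid k B).injective (by simpa using A.counit_right b) }
  have hmul : ∀ u v : B ⊗[k] B,
      TensorProduct.map A.mul A.mul (A.interchange A.act A.act (u ⊗ₜ v)) = u * v := by
    intro u v
    induction u using TensorProduct.induction_on with
    | zero => simp
    | add x y hx hy => simp only [TensorProduct.add_tmul, add_mul, map_add, hx, hy]
    | tmul x y =>
      induction v using TensorProduct.induction_on with
      | zero => simp
      | add x y hx hy => simp only [TensorProduct.tmul_add, mul_add, map_add, hx, hy]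
      | tmul z t =>
        rw [hQ.interchange_tmul A.toYDModule hπ (hP0 x) (hP0 y) (hP0 z) (hP0 t)]
        simp [mul_eq]
  let bialg : Bialgebra k B := Bialgebra.mk' k B A.counit_one (fun {b c} => A.counit_mul b c)
    A.comul_one (fun {b c} => (A.comul_mul b c).trans (hmul _ _))
  have hmul' : ∀ t : B ⊗[k] B, LinearMap.mul' k B t = A.mul t := by
    intro t
    induction t using TensorProduct.induction_on with
    | zero => simp
    | add u v hu hv => simp only [map_add, hu, hv]
    | tmul s d => rfl
  let hopf : HopfAlgebra k B :=
    { antipode := A.antipode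
      mul_antipode_rTensor_comul := LinearMap.ext fun b => by
        refine (hmul' _).trans ((A.antipode_left b).trans ?_)
        exact (Algebra.algebraMap_eq_smul_one _).symm
      mul_antipode_lTensor_comul := LinearMap.ext fun b => by
        refine (hmul' _).trans ((A.antipode_right b).trans ?_)
        exact (Algebra.algebraMap_eq_smul_one _).symm }
  have hss : IsSemisimpleRing B := isSemisimpleRing_of_finrank_eq_three (k := k) hB
  -- In a semisimple ring the left ideal generated by `b` is generated by an idempotent, which is
  -- therefore a left multiple of `b`.
  obtain ⟨e, he, hI⟩ := IsSemisimpleRing.ideal_eq_span_idempotent (Ideal.span {b})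
  obtain ⟨c, hc⟩ := Ideal.mem_span_singleton'.1 (hI.symm ▸ Ideal.mem_span_singleton_self e)
  refine ⟨c, ?_, ?_⟩
  · change c * b * (c * b) = c * b
    rw [hc]
    exact he
  · change c * b ≠ 0
    rw [hc]
    rintro rfl
    rw [Ideal.span_singleton_zero, Ideal.span_singleton_eq_bot] at hI
    exact hb hI

end TrivialAction

/-! ### Adapted bases in the presence of odd elements -/

section AdaptedBasis

variable {k : Type*} [Field k] {H : Type*} [Ring H] [Algebra k H] {Q : QuasiBialgebra k H}
  {p : H} {w : k} {B : Type*} [AddCommGroup B] [Module k B]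

/-- The braided multiplication of `B ⊗ B` on homogeneous tensors. -/
theorem IsGenerator.braidedMul_tmul (hQ : IsGenerator Q p w) (A : YDAlgebra Q B) {π : H →ₐ[k] k}
    (hπ : π p = 1) (i j l n : k) {b c q r : B} (hb : A.act p b = i • b) (hc : A.act p c = j • c)
    (hq : A.act p q = l • q) (hr : A.act p r = n • r) :
    TensorProduct.map A.mul A.mul (A.interchange A.act A.act ((b ⊗ₜ c) ⊗ₜ (q ⊗ₜ r))) =
      ((1 + (w - 1) * i * j * (l + n - 2 * l * n)) * (1 + (w - 1) * j * l * n) *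
        (1 + (w - 1) * l * j * n) * (1 + (w - 1) * i * l * (j + n - 2 * j * n))) •
      (A.mul (b ⊗ₜ q) ⊗ₜ A.mul ((c + l • (A.characterAct π c - c)) ⊗ₜ r)) := by
  rw [hQ.interchange_tmul A.toYDModule hπ hb hc hq hr, map_smul, TensorProduct.map_tmul]

/-- A basis `1, x, y` of a three-dimensional braided bialgebra, adapted to the counit, with
coordinate functions `ε, X, Y`. -/
structure IsCoordinates (A : YDBialgebra Q B) (x y : B) (X Y : B →ₗ[k] k) : Prop where
  counit_x : A.counit x = 0
  counit_y : A.counit y = 0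
  X_one : X A.one = 0
  X_x : X x = 1
  X_y : X y = 0
  Y_one : Y A.one = 0
  Y_x : Y x = 0
  Y_y : Y y = 1
  span : ∀ b, b = A.counit b • A.one + X b • x + Y b • y

variable {x y : B} {X Y : B →ₗ[k] k}

/-- The even part would be `k1`, so a product of two odd elements, being even of counit 0, vanishes.
By degrees odd elements are primitive, so `x ⊗ y` has coefficient 1 in `Δ(x)Δ(y) = Δ(xy) = 0`. -/
theorem IsGenerator.false_of_odd_basis (hQ : IsGenerator Q p w) (A : YDBialgebra Q B)
    (hc : IsCoordinates A x y X Y) (hx : A.act p x = (1 : k) • x) (hy : A.act p y = (1 : k) • y) :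
    False := by
  obtain ⟨π, hπ⟩ := hQ.exists_character
  have h1 : A.act p A.one = (0 : k) • A.one := by rw [hQ.act_one, zero_smul]
  have hP : ∀ b, A.act p b = X b • x + Y b • y := fun b => by
    conv_lhs => rw [hc.span b]
    simp [hx, hy, hQ.act_one]
  have hX : ∀ b, X (A.act p b) = 1 * X b := fun b => by rw [hP]; simp [hc.X_x, hc.X_y]
  have hY : ∀ b, Y (A.act p b) = 1 * Y b := fun b => by rw [hP]; simp [hc.Y_x, hc.Y_y]
  have hm : ∀ {b c : B}, A.act p b = (1 : k) • b → A.act p c = (1 : k) • c →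
      A.counit b = 0 → A.mul (b ⊗ₜ c) = 0 := by
    intro b c hb hc' he
    have h := hQ.act_mul A.toYDAlgebra hb hc'
    rw [hP, show (1 : k) + 1 - 2 * 1 * 1 = 0 by ring, zero_smul] at h
    rw [hc.span (A.mul (b ⊗ₜ c)), A.counit_mul, he, zero_mul, zero_smul, add_assoc, h, add_zero]
  have hz : ∀ {F G : B →ₗ[k] k}, (∀ b, F (A.act p b) = 1 * F b) → (∀ b, G (A.act p b) = 1 * G b) →
      ∀ b, A.act p b = (1 : k) • b → pairing F G (A.comul b) = 0 := by
    intro F G hF hG b hb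
    have h := hQ.pairing_comul_act A hF hG b
    rwa [hb, one_smul, show (1 : k) + 1 - 2 * 1 * 1 = 0 by ring, zero_mul] at h
  have hΔ : ∀ b, A.act p b = (1 : k) • b → A.comul b = X b • (A.one ⊗ₜ x + x ⊗ₜ A.one) +
      Y b • (A.one ⊗ₜ y + y ⊗ₜ A.one) := by
    intro b hb
    have hεb : A.counit b = 0 := by
      rw [← one_smul k b, ← hb]; exact hQ.counit_act A b
    rw [A.comul_expansion hc.span b, hz hX hX b hb, hz hX hY b hb, hz hY hX b hb, hz hY hY b hb,
      hεb]
    module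
  have h := A.comul_mul x y
  rw [hm hx hy hc.counit_x, hΔ x hx, hΔ y hy, hc.X_x, hc.X_y, hc.Y_x, hc.Y_y] at h
  simp only [one_smul, zero_smul, add_zero, zero_add, map_zero, TensorProduct.add_tmul,
    TensorProduct.tmul_add, map_add, hQ.braidedMul_tmul A.toYDAlgebra hπ 0 1 0 1 h1 hx h1 hy,
    hQ.braidedMul_tmul A.toYDAlgebra hπ 0 1 1 0 h1 hx hy h1,
    hQ.braidedMul_tmul A.toYDAlgebra hπ 1 0 0 1 hx h1 h1 hy,
    hQ.braidedMul_tmul A.toYDAlgebra hπ 1 0 1 0 hx h1 hy h1] at h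
  have h' := congrArg (pairing X Y) h
  simp [A.one_mul, A.mul_one, hm hx hy hc.counit_x, hc.X_x, hc.X_y, hc.Y_y] at h'

/-- A basis `1, x, y` of a three-dimensional braided bialgebra with `x` even and `y` odd. -/
structure IsMixedBasis (p : H) (A : YDBialgebra Q B) (x y : B) (X Y : B →ₗ[k] k) : Prop
    extends IsCoordinates A x y X Y where
  act_x : A.act p x = (0 : k) • x
  act_y : A.act p y = (1 : k) • y

namespace IsMixedBasis

variable {A : YDBialgebra Q B}

theorem act_one (hQ : IsGenerator Q p w) (_ : IsMixedBasis p A x y X Y) :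
    A.act p A.one = (0 : k) • A.one := by rw [hQ.act_one, zero_smul]

theorem act_eq (hQ : IsGenerator Q p w) (hc : IsMixedBasis p A x y X Y)
    (b : B) : A.act p b = Y b • y := by
  conv_lhs => rw [hc.span b]
  simp [hc.act_x, hc.act_y, hQ.act_one]

theorem eq_of_odd (hQ : IsGenerator Q p w) (hc : IsMixedBasis p A x y X Y) {b : B}
    (hb : A.act p b = (1 : k) • b) : b = Y b • y := by
  rw [← hc.act_eq hQ, hb, one_smul]

theorem eq_of_even (hQ : IsGenerator Q p w) (hc : IsMixedBasis p A x y X Y) {b : B}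
    (hb : A.act p b = (0 : k) • b) :
    b = A.counit b • A.one + X b • x := by
  have h := hc.act_eq hQ b
  rw [hb, zero_smul] at h
  conv_lhs => rw [hc.span b, ← h, add_zero]

/-- An even element of counit 0 is a multiple of `x`; the same reason gives `mul_yy`. An odd element
is a multiple of `y`, which gives `mul_xy` and `mul_yx`. -/
theorem mul_xx (hQ : IsGenerator Q p w) (hc : IsMixedBasis p A x y X Y)
    : A.mul (x ⊗ₜ x) = X (A.mul (x ⊗ₜ x)) • x := by
  have h := hQ.act_mul A.toYDAlgebra hc.act_x hc.act_x
  have := hc.eq_of_even hQ (b := A.mul (x ⊗ₜ x)) (by rw [h]; congr 1; ring)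
  rwa [A.counit_mul, hc.counit_x, zero_mul, zero_smul, zero_add] at this

theorem mul_yy (hQ : IsGenerator Q p w) (hc : IsMixedBasis p A x y X Y)
    : A.mul (y ⊗ₜ y) = X (A.mul (y ⊗ₜ y)) • x := by
  have h := hQ.act_mul A.toYDAlgebra hc.act_y hc.act_y
  have := hc.eq_of_even hQ (b := A.mul (y ⊗ₜ y)) (by rw [h]; congr 1; ring)
  rwa [A.counit_mul, hc.counit_y, zero_mul, zero_smul, zero_add] at this

theorem mul_xy (hQ : IsGenerator Q p w) (hc : IsMixedBasis p A x y X Y)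
    : A.mul (x ⊗ₜ y) = Y (A.mul (x ⊗ₜ y)) • y := by
  have h := hQ.act_mul A.toYDAlgebra hc.act_x hc.act_y
  exact hc.eq_of_odd hQ (by rw [h]; congr 1; ring)

theorem mul_yx (hQ : IsGenerator Q p w) (hc : IsMixedBasis p A x y X Y)
    : A.mul (y ⊗ₜ x) = Y (A.mul (y ⊗ₜ x)) • y := by
  have h := hQ.act_mul A.toYDAlgebra hc.act_y hc.act_x
  exact hc.eq_of_odd hQ (by rw [h]; congr 1; ring)

theorem characterAct_y (hQ : IsGenerator Q p w) (hc : IsMixedBasis p A x y X Y)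
    {π : H →ₐ[k] k} (hπ : π p = 1) :
    ∃ τ : k, A.characterAct π y = τ • y ∧ τ * τ = w := by
  have h := hc.eq_of_odd hQ (hQ.act_characterAct A.toYDModule hπ hc.act_y)
  refine ⟨_, h, ?_⟩
  have h2 := hQ.characterAct_sq A.toYDModule hπ (m := y) (by rw [hc.act_y, one_smul])
  rw [h, map_smul, h] at h2
  simpa [hc.Y_y] using congrArg Y h2

theorem X_act (hQ : IsGenerator Q p w) (hc : IsMixedBasis p A x y X Y)
    (b : B) : X (A.act p b) = 0 * X b := by rw [hc.act_eq hQ]; simp [hc.X_y]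

theorem Y_act (hQ : IsGenerator Q p w) (hc : IsMixedBasis p A x y X Y)
    (b : B) : Y (A.act p b) = 1 * Y b := by rw [hc.act_eq hQ]; simp [hc.Y_y]

/-- As `x` is even, the mixed coefficients of `x ⊗ y` and `y ⊗ x` vanish. -/
theorem comul_x (hQ : IsGenerator Q p w) (hc : IsMixedBasis p A x y X Y)
    : A.comul x = A.one ⊗ₜ x + x ⊗ₜ A.one + pairing X X (A.comul x) • (x ⊗ₜ x) +
    pairing Y Y (A.comul x) • (y ⊗ₜ[k] y) := by
  have h1 := hQ.pairing_comul_act A (hc.X_act hQ) (hc.Y_act hQ) x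
  have h2 := hQ.pairing_comul_act A (hc.Y_act hQ) (hc.X_act hQ) x
  simp [hc.act_x] at h1 h2
  conv_lhs => rw [A.comul_expansion hc.span x, hc.counit_x, hc.X_x, hc.Y_x, ← h1, ← h2]
  module

theorem comul_y (hQ : IsGenerator Q p w) (hc : IsMixedBasis p A x y X Y)
    : A.comul y = A.one ⊗ₜ y + y ⊗ₜ A.one + pairing X Y (A.comul y) • (x ⊗ₜ y) +
    pairing Y X (A.comul y) • (y ⊗ₜ[k] x) := by
  have h1 := hQ.pairing_comul_act A (hc.X_act hQ) (hc.X_act hQ) y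
  have h2 := hQ.pairing_comul_act A (hc.Y_act hQ) (hc.Y_act hQ) y
  rw [hc.act_y, one_smul] at h1 h2
  rw [show (0 : k) + 0 - 2 * 0 * 0 = 0 by ring, zero_mul] at h1
  rw [show (1 : k) + 1 - 2 * 1 * 1 = 0 by ring, zero_mul] at h2
  conv_lhs => rw [A.comul_expansion hc.span y, hc.counit_y, hc.X_y, hc.Y_y, h1, h2]
  module

end IsMixedBasis
end AdaptedBasis

/-! ### Structure constants in the mixed case -/

section MixedBasis

variable {k : Type*} [Field k] {H : Type*} [Ring H] [Algebra k H] {Q : QuasiBialgebra k H}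
  {p : H} {w : k} {B : Type*} [AddCommGroup B] [Module k B] {A : YDBialgebra Q B} {x y : B}
  {X Y : B →ₗ[k] k} {π : H →ₐ[k] k} {lam mu r s a b c e t : k}

namespace IsMixedBasis

/-- The coefficient of `x ⊗ x` in `Δ(x²) = Δ(x)Δ(x)`. The last term comes from `(y ⊗ y)(y ⊗ y)`,
where reassociators contribute `w² = 1` and the braiding contributes `t`. -/
theorem pairing_XX_mul_xx (hQ : IsGenerator Q p w) (hc : IsMixedBasis p A x y X Y) (hπ : π p = 1)
    (hxx : A.mul (x ⊗ₜ x) = lam • x) (hyy : A.mul (y ⊗ₜ y) = mu • x)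
    (hxy : A.mul (x ⊗ₜ y) = r • y) (hyx : A.mul (y ⊗ₜ x) = s • y)
    (ht : A.characterAct π y = t • y)
    (hx : A.comul x = A.one ⊗ₜ x + x ⊗ₜ A.one + a • (x ⊗ₜ x) + b • (y ⊗ₜ[k] y)) :
    lam * a = 2 + 4 * a * lam + a ^ 2 * lam ^ 2 + b ^ 2 * mu ^ 2 * t := by
  have h1 := hc.act_one hQ
  have hX := hc.act_x
  have hY := hc.act_y
  have h := A.comul_mul x x
  rw [hxx, map_smul, hx] at h
  simp only [TensorProduct.add_tmul, TensorProduct.tmul_add, ← TensorProduct.smul_tmul',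
    TensorProduct.tmul_smul, map_add, map_smul,
    hQ.braidedMul_tmul A.toYDAlgebra hπ 0 0 0 0 h1 hX h1 hX,
    hQ.braidedMul_tmul A.toYDAlgebra hπ 0 0 0 0 h1 hX hX h1,
    hQ.braidedMul_tmul A.toYDAlgebra hπ 0 0 0 0 h1 hX hX hX,
    hQ.braidedMul_tmul A.toYDAlgebra hπ 0 0 1 1 h1 hX hY hY,
    hQ.braidedMul_tmul A.toYDAlgebra hπ 0 0 0 0 hX h1 h1 hX,
    hQ.braidedMul_tmul A.toYDAlgebra hπ 0 0 0 0 hX h1 hX h1,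
    hQ.braidedMul_tmul A.toYDAlgebra hπ 0 0 0 0 hX h1 hX hX,
    hQ.braidedMul_tmul A.toYDAlgebra hπ 0 0 1 1 hX h1 hY hY,
    hQ.braidedMul_tmul A.toYDAlgebra hπ 0 0 0 0 hX hX h1 hX,
    hQ.braidedMul_tmul A.toYDAlgebra hπ 0 0 0 0 hX hX hX h1,
    hQ.braidedMul_tmul A.toYDAlgebra hπ 0 0 0 0 hX hX hX hX,
    hQ.braidedMul_tmul A.toYDAlgebra hπ 0 0 1 1 hX hX hY hY,
    hQ.braidedMul_tmul A.toYDAlgebra hπ 1 1 0 0 hY hY h1 hX,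
    hQ.braidedMul_tmul A.toYDAlgebra hπ 1 1 0 0 hY hY hX h1,
    hQ.braidedMul_tmul A.toYDAlgebra hπ 1 1 0 0 hY hY hX hX,
    hQ.braidedMul_tmul A.toYDAlgebra hπ 1 1 1 1 hY hY hY hY] at h
  have h' := congrArg (pairing X X) h
  simp [A.one_mul, A.mul_one, hxx, hyy, hxy, hyx, ht, hc.X_one, hc.X_x, hc.X_y,
    TensorProduct.sub_tmul, ← TensorProduct.smul_tmul'] at h'
  linear_combination h' + b ^ 2 * mu ^ 2 * t * hQ.scalar_sq

/-- The coefficient of `y ⊗ x` in `Δ(yx) = Δ(y)Δ(x)`, for use in the case `y² = 0`. -/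
theorem pairing_YX_mul_yx (hQ : IsGenerator Q p w) (hc : IsMixedBasis p A x y X Y) (hπ : π p = 1)
    (hxx : A.mul (x ⊗ₜ x) = lam • x) (hyy : A.mul (y ⊗ₜ y) = 0)
    (hxy : A.mul (x ⊗ₜ y) = r • y) (hyx : A.mul (y ⊗ₜ x) = s • y)
    (ht : A.characterAct π y = t • y)
    (hx : A.comul x = A.one ⊗ₜ x + x ⊗ₜ A.one + a • (x ⊗ₜ x) + b • (y ⊗ₜ[k] y))
    (hy : A.comul y = A.one ⊗ₜ y + y ⊗ₜ A.one + c • (x ⊗ₜ y) + e • (y ⊗ₜ[k] x)) :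
    s * e = 1 + a * s + e * lam + e * s + e * a * s * lam := by
  have h1 := hc.act_one hQ
  have hX := hc.act_x
  have hY := hc.act_y
  have h := A.comul_mul y x
  rw [hyx, map_smul, hx, hy] at h
  simp only [TensorProduct.add_tmul, TensorProduct.tmul_add, ← TensorProduct.smul_tmul',
    TensorProduct.tmul_smul, map_add, map_smul,
    hQ.braidedMul_tmul A.toYDAlgebra hπ 0 1 0 0 h1 hY h1 hX,
    hQ.braidedMul_tmul A.toYDAlgebra hπ 0 1 0 0 h1 hY hX h1,
    hQ.braidedMul_tmul A.toYDAlgebra hπ 0 1 0 0 h1 hY hX hX,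
    hQ.braidedMul_tmul A.toYDAlgebra hπ 0 1 1 1 h1 hY hY hY,
    hQ.braidedMul_tmul A.toYDAlgebra hπ 1 0 0 0 hY h1 h1 hX,
    hQ.braidedMul_tmul A.toYDAlgebra hπ 1 0 0 0 hY h1 hX h1,
    hQ.braidedMul_tmul A.toYDAlgebra hπ 1 0 0 0 hY h1 hX hX,
    hQ.braidedMul_tmul A.toYDAlgebra hπ 1 0 1 1 hY h1 hY hY,
    hQ.braidedMul_tmul A.toYDAlgebra hπ 0 1 0 0 hX hY h1 hX,
    hQ.braidedMul_tmul A.toYDAlgebra hπ 0 1 0 0 hX hY hX h1,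
    hQ.braidedMul_tmul A.toYDAlgebra hπ 0 1 0 0 hX hY hX hX,
    hQ.braidedMul_tmul A.toYDAlgebra hπ 0 1 1 1 hX hY hY hY,
    hQ.braidedMul_tmul A.toYDAlgebra hπ 1 0 0 0 hY hX h1 hX,
    hQ.braidedMul_tmul A.toYDAlgebra hπ 1 0 0 0 hY hX hX h1,
    hQ.braidedMul_tmul A.toYDAlgebra hπ 1 0 0 0 hY hX hX hX,
    hQ.braidedMul_tmul A.toYDAlgebra hπ 1 0 1 1 hY hX hY hY] at h
  have h' := congrArg (pairing Y X) h
  simp [A.one_mul, A.mul_one, hxx, hyy, hxy, hyx, ht, hc.X_one, hc.X_x, hc.X_y, hc.Y_one, hc.Y_x, hc.Y_y,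
    TensorProduct.sub_tmul, ← TensorProduct.smul_tmul'] at h'
  linear_combination h'

/-- The coefficient of `y ⊗ y` in `Δ(y²) = Δ(y)Δ(y)`. The 1 comes from `(y ⊗ 1)(1 ⊗ y)` and `t` from
the braided product `(1 ⊗ y)(y ⊗ 1)`. -/
theorem pairing_YY_mul_yy (hQ : IsGenerator Q p w) (hc : IsMixedBasis p A x y X Y) (hπ : π p = 1)
    (hxx : A.mul (x ⊗ₜ x) = 0) (hyy : A.mul (y ⊗ₜ y) = mu • x)
    (hxy : A.mul (x ⊗ₜ y) = 0) (hyx : A.mul (y ⊗ₜ x) = 0)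
    (ht : A.characterAct π y = t • y)
    (hx : A.comul x = A.one ⊗ₜ x + x ⊗ₜ A.one + a • (x ⊗ₜ x) + b • (y ⊗ₜ[k] y))
    (hy : A.comul y = A.one ⊗ₜ y + y ⊗ₜ A.one + c • (x ⊗ₜ y) + e • (y ⊗ₜ[k] x)) :
    mu * b = 1 + t := by
  have h1 := hc.act_one hQ
  have hX := hc.act_x
  have hY := hc.act_y
  have h := A.comul_mul y y
  rw [hyy, map_smul, hx, hy] at h
  simp only [TensorProduct.add_tmul, TensorProduct.tmul_add, ← TensorProduct.smul_tmul',
    TensorProduct.tmul_smul, map_add, map_smul,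
    hQ.braidedMul_tmul A.toYDAlgebra hπ 0 1 0 1 h1 hY h1 hY,
    hQ.braidedMul_tmul A.toYDAlgebra hπ 0 1 1 0 h1 hY hY h1,
    hQ.braidedMul_tmul A.toYDAlgebra hπ 0 1 0 1 h1 hY hX hY,
    hQ.braidedMul_tmul A.toYDAlgebra hπ 0 1 1 0 h1 hY hY hX,
    hQ.braidedMul_tmul A.toYDAlgebra hπ 1 0 0 1 hY h1 h1 hY,
    hQ.braidedMul_tmul A.toYDAlgebra hπ 1 0 1 0 hY h1 hY h1,
    hQ.braidedMul_tmul A.toYDAlgebra hπ 1 0 0 1 hY h1 hX hY,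
    hQ.braidedMul_tmul A.toYDAlgebra hπ 1 0 1 0 hY h1 hY hX,
    hQ.braidedMul_tmul A.toYDAlgebra hπ 0 1 0 1 hX hY h1 hY,
    hQ.braidedMul_tmul A.toYDAlgebra hπ 0 1 1 0 hX hY hY h1,
    hQ.braidedMul_tmul A.toYDAlgebra hπ 0 1 0 1 hX hY hX hY,
    hQ.braidedMul_tmul A.toYDAlgebra hπ 0 1 1 0 hX hY hY hX,
    hQ.braidedMul_tmul A.toYDAlgebra hπ 1 0 0 1 hY hX h1 hY,
    hQ.braidedMul_tmul A.toYDAlgebra hπ 1 0 1 0 hY hX hY h1,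
    hQ.braidedMul_tmul A.toYDAlgebra hπ 1 0 0 1 hY hX hX hY,
    hQ.braidedMul_tmul A.toYDAlgebra hπ 1 0 1 0 hY hX hY hX] at h
  have h' := congrArg (pairing Y Y) h
  simp [A.one_mul, A.mul_one, hxx, hyy, hxy, hyx, ht, hc.Y_one, hc.Y_x, hc.Y_y,
    TensorProduct.sub_tmul, ← TensorProduct.smul_tmul'] at h'
  linear_combination h'

/-- The coefficient of `x ⊗ y` in `Δ(xy) = 0`. The second term comes from `(y ⊗ y)(y ⊗ 1)`. -/
theorem pairing_XY_mul_xy (hQ : IsGenerator Q p w) (hc : IsMixedBasis p A x y X Y) (hπ : π p = 1)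
    (hxx : A.mul (x ⊗ₜ x) = 0) (hyy : A.mul (y ⊗ₜ y) = mu • x)
    (hxy : A.mul (x ⊗ₜ y) = 0) (hyx : A.mul (y ⊗ₜ x) = 0)
    (ht : A.characterAct π y = t • y)
    (hx : A.comul x = A.one ⊗ₜ x + x ⊗ₜ A.one + a • (x ⊗ₜ x) + b • (y ⊗ₜ[k] y))
    (hy : A.comul y = A.one ⊗ₜ y + y ⊗ₜ A.one + c • (x ⊗ₜ y) + e • (y ⊗ₜ[k] x)) :
    1 + b * mu * t = 0 := by
  have h1 := hc.act_one hQ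
  have hX := hc.act_x
  have hY := hc.act_y
  have h := A.comul_mul x y
  rw [hxy, map_zero, hx, hy] at h
  simp only [TensorProduct.add_tmul, TensorProduct.tmul_add, ← TensorProduct.smul_tmul',
    TensorProduct.tmul_smul, map_add, map_smul,
    hQ.braidedMul_tmul A.toYDAlgebra hπ 0 0 0 1 h1 hX h1 hY,
    hQ.braidedMul_tmul A.toYDAlgebra hπ 0 0 1 0 h1 hX hY h1,
    hQ.braidedMul_tmul A.toYDAlgebra hπ 0 0 0 1 h1 hX hX hY,
    hQ.braidedMul_tmul A.toYDAlgebra hπ 0 0 1 0 h1 hX hY hX,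
    hQ.braidedMul_tmul A.toYDAlgebra hπ 0 0 0 1 hX h1 h1 hY,
    hQ.braidedMul_tmul A.toYDAlgebra hπ 0 0 1 0 hX h1 hY h1,
    hQ.braidedMul_tmul A.toYDAlgebra hπ 0 0 0 1 hX h1 hX hY,
    hQ.braidedMul_tmul A.toYDAlgebra hπ 0 0 1 0 hX h1 hY hX,
    hQ.braidedMul_tmul A.toYDAlgebra hπ 0 0 0 1 hX hX h1 hY,
    hQ.braidedMul_tmul A.toYDAlgebra hπ 0 0 1 0 hX hX hY h1,
    hQ.braidedMul_tmul A.toYDAlgebra hπ 0 0 0 1 hX hX hX hY,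
    hQ.braidedMul_tmul A.toYDAlgebra hπ 0 0 1 0 hX hX hY hX,
    hQ.braidedMul_tmul A.toYDAlgebra hπ 1 1 0 1 hY hY h1 hY,
    hQ.braidedMul_tmul A.toYDAlgebra hπ 1 1 1 0 hY hY hY h1,
    hQ.braidedMul_tmul A.toYDAlgebra hπ 1 1 0 1 hY hY hX hY,
    hQ.braidedMul_tmul A.toYDAlgebra hπ 1 1 1 0 hY hY hY hX] at h
  have h' := congrArg (pairing X Y) h
  simp [A.one_mul, A.mul_one, hxx, hyy, hxy, hyx, ht, hc.X_x, hc.X_y, hc.Y_x, hc.Y_y,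
    TensorProduct.sub_tmul, ← TensorProduct.smul_tmul'] at h'
  linear_combination -h' - b * mu * t * hQ.scalar_sq

/-- The coefficient of `y ⊗ x ⊗ x` in the coassociativity of `y`. -/
theorem sq_eq_mul (hQ : IsGenerator Q p w) (hc : IsMixedBasis p A x y X Y)
    (hx : A.comul x = A.one ⊗ₜ x + x ⊗ₜ A.one + a • (x ⊗ₜ x) + b • (y ⊗ₜ[k] y))
    (hy : A.comul y = A.one ⊗ₜ y + y ⊗ₜ A.one + c • (x ⊗ₜ y) + e • (y ⊗ₜ[k] x)) :
    e * e = e * a := by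
  have h := congrArg (pairing Y (pairing X X)) (A.coassoc y)
  rw [hy] at h
  simp only [map_add, map_smul, LinearMap.rTensor_tmul, LinearMap.lTensor_tmul, A.comul_one, hx, hy,
    TensorProduct.add_tmul, TensorProduct.tmul_add, ← TensorProduct.smul_tmul',
    TensorProduct.tmul_smul, hQ.assocMap_apply, hc.act_x, hc.act_y, hQ.act_one] at h
  simp [hc.X_one, hc.X_x, hc.X_y, hc.Y_one, hc.Y_x, hc.Y_y] at h
  rcases h with rfl | rfl
  · rfl
  · rw [zero_mul, zero_mul]

/-- Associativity on `y, x, x`; with a single odd factor the reassociator is trivial. -/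
theorem mul_yx_sq (hQ : IsGenerator Q p w) (hc : IsMixedBasis p A x y X Y)
    (hxx : A.mul (x ⊗ₜ x) = lam • x) (hyx : A.mul (y ⊗ₜ x) = s • y) : s * s = lam * s := by
  have h := congrArg Y (hQ.mul_assoc A.toYDAlgebra hc.act_y hc.act_x hc.act_x)
  simpa [hxx, hyx, ← TensorProduct.smul_tmul', hc.Y_y] using h

theorem mul_xy_sq (hQ : IsGenerator Q p w) (hc : IsMixedBasis p A x y X Y)
    (hxx : A.mul (x ⊗ₜ x) = lam • x) (hxy : A.mul (x ⊗ₜ y) = r • y) : lam * r = r * r := by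
  have h := congrArg Y (hQ.mul_assoc A.toYDAlgebra hc.act_x hc.act_x hc.act_y)
  simpa [hxx, hxy, ← TensorProduct.smul_tmul', hc.Y_y] using h

/-- In a braided Hopf algebra with `y² = 0` the element `1 + aλ` does not vanish. -/
theorem one_add_ne_zero {A : YDHopfAlgebra Q B} (hQ : IsGenerator Q p w)
    (hc : IsMixedBasis p A.toYDBialgebra x y X Y)
    (hxx : A.mul (x ⊗ₜ x) = lam • x) (hyy : A.mul (y ⊗ₜ y) = 0)
    (hx : A.comul x = A.one ⊗ₜ x + x ⊗ₜ A.one + a • (x ⊗ₜ x) + b • (y ⊗ₜ[k] y)) :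
    1 + a * lam ≠ 0 := by
  intro h0
  have hS1 : A.antipode A.one = A.one := by
    have h := A.antipode_left A.one
    rwa [A.comul_one, LinearMap.rTensor_tmul, A.mul_one, A.counit_one, one_smul] at h
  have hSx := hc.eq_of_even hQ (b := A.antipode x) (by
    rw [← A.antipode_act, hc.act_x, zero_smul, map_zero, zero_smul])
  have hSy := hc.eq_of_odd hQ (b := A.antipode y) (by
    rw [← A.antipode_act, hc.act_y, one_smul, one_smul])
  have h := A.antipode_left x
  rw [hx, hc.counit_x, zero_smul] at h
  simp only [map_add, map_smul, LinearMap.rTensor_tmul, hS1, A.one_mul, A.mul_one] at h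
  -- The antipode preserves degrees, so `S(x)` is `u1 + vx` and `S(y)y` is a multiple of `y² = 0`.
  -- The counit gives `u = 0`, and the coefficient of `x` becomes `1 + v(1 + aλ) = 0`.
  rw [hSx, hSy] at h
  simp only [TensorProduct.add_tmul, ← TensorProduct.smul_tmul', map_add, map_smul,
    A.one_mul, hxx, hyy] at h
  have h2 := congrArg A.counit h
  have h3 := congrArg X h
  simp [hc.counit_x, hc.X_one, hc.X_x, A.counit_one] at h2 h3
  rw [h2] at h3
  exact one_ne_zero (by linear_combination h3 - X (A.antipode x) * h0 : (1 : k) = 0)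

variable [CharZero k]

/-- If `λ = 0`, associativity gives `xy = yx = 0`. The two coefficient identities combine to `1 + t
+ t² = 0`, so `t³ = 1`. Since `t² = w` and `w² = 1`, also `t⁴ = 1`, whence `t = 1` and `3 = 0`. -/
theorem mul_xx_ne_zero {A : YDHopfAlgebra Q B} (hQ : IsGenerator Q p w)
    (hc : IsMixedBasis p A.toYDBialgebra x y X Y) : X (A.mul (x ⊗ₜ x)) ≠ 0 := by
  intro hlam
  obtain ⟨π, hπ⟩ := hQ.exists_character
  obtain ⟨t, ht, htw⟩ := hc.characterAct_y hQ hπ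
  have hxx := hc.mul_xx hQ
  rw [hlam] at hxx
  have hyy := hc.mul_yy hQ
  have hr := hc.mul_xy_sq hQ hxx (hc.mul_xy hQ)
  have hs := hc.mul_yx_sq hQ hxx (hc.mul_yx hQ)
  rw [zero_mul, eq_comm, mul_self_eq_zero] at hr
  rw [zero_mul, mul_self_eq_zero] at hs
  have hxy := hc.mul_xy hQ
  have hyx := hc.mul_yx hQ
  have hDx := hc.comul_x hQ
  have hDy := hc.comul_y hQ
  have h := hc.pairing_XX_mul_xx hQ hπ hxx hyy hxy hyx ht hDx
  rw [hr, zero_smul] at hxy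
  rw [hs, zero_smul] at hyx
  rw [zero_smul] at hxx
  have h1 := hc.pairing_YY_mul_yy hQ hπ hxx hyy hxy hyx ht hDx hDy
  have h2 := hc.pairing_XY_mul_xy hQ hπ hxx hyy hxy hyx ht hDx hDy
  have h3 : 1 + t + t * t = 0 := by linear_combination h2 - t * h1
  have hw := hQ.scalar_sq
  have ht1 : t = 1 := by
    rw [← htw] at hw
    linear_combination hw - (t ^ 2 - t) * h3
  rw [ht1] at h3
  norm_num at h3

/-- If `μ = 0`, the `x ⊗ x` identity factors as `(1 + aλ)(aλ + 2) = 0`, and the antipode excludes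
the first factor, so `aλ = -2`. Associativity leaves `s = 0` or `s = λ`, and coassociativity leaves
`e = 0` or `e = a`. The `y ⊗ x` identity fails in all four cases. -/
theorem mul_yy_ne_zero {A : YDHopfAlgebra Q B} (hQ : IsGenerator Q p w)
    (hc : IsMixedBasis p A.toYDBialgebra x y X Y) : X (A.mul (y ⊗ₜ y)) ≠ 0 := by
  intro hmu
  obtain ⟨π, hπ⟩ := hQ.exists_character
  obtain ⟨t, ht, -⟩ := hc.characterAct_y hQ hπ
  have hxx := hc.mul_xx hQ
  have hyy := hc.mul_yy hQ
  have hxy := hc.mul_xy hQ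
  have hyx := hc.mul_yx hQ
  have hDx := hc.comul_x hQ
  have hDy := hc.comul_y hQ
  have hs := hc.mul_yx_sq hQ hxx hyx
  rw [hmu] at hyy
  have h := hc.pairing_XX_mul_xx hQ hπ hxx hyy hxy hyx ht hDx
  rw [zero_smul] at hyy
  have h1 := hc.one_add_ne_zero hQ hxx hyy hDx
  have h2 := hc.pairing_YX_mul_yx hQ hπ hxx hyy hxy hyx ht hDx hDy
  have h3 := hc.sq_eq_mul hQ hDx hDy
  generalize X (A.mul (x ⊗ₜ x)) = lam at *
  generalize Y (A.mul (y ⊗ₜ x)) = s at *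
  generalize pairing X X (A.comul x) = a at *
  generalize pairing Y X (A.comul y) = e at *
  have h4 : a * lam = -2 := by
    have : (1 + a * lam) * (a * lam + 2) = 0 := by linear_combination -h
    linear_combination (mul_eq_zero.1 this).resolve_left h1
  have h5 : 1 + e * lam + a * s - 2 * (e * s) = 0 := by linear_combination -h2 - e * s * h4
  have h6 : e = 0 ∨ e = a := by
    refine (mul_eq_zero.1 (show e * (e - a) = 0 by linear_combination h3)).imp_right sub_eq_zero.1
  have h7 : s = 0 ∨ s = lam := by
    refine (mul_eq_zero.1 (show s * (s - lam) = 0 by linear_combination hs)).imp_right sub_eq_zero.1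
  have h8 : (1 : k) = 0 := by
    rcases h6 with rfl | rfl <;> rcases h7 with rfl | rfl
    · linear_combination h5
    · linear_combination -h5 + h4
    · linear_combination -h5 + h4
    · linear_combination h5
  exact one_ne_zero h8

/-- Every nonzero homogeneous element has a homogeneous left multiple which is a nonzero
idempotent. -/
theorem exists_idempotent {A : YDHopfAlgebra Q B} (hQ : IsGenerator Q p w)
    (hc : IsMixedBasis p A.toYDBialgebra x y X Y) {i : k} (hi : i * i = i) {b : B}
    (hb : A.act p b = i • b) (hb0 : b ≠ 0) : ∃ c, A.act p c = i • c ∧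
      A.mul (A.mul (c ⊗ₜ b) ⊗ₜ A.mul (c ⊗ₜ b)) = A.mul (c ⊗ₜ b) ∧ A.mul (c ⊗ₜ b) ≠ 0 := by
  have hxx := hc.mul_xx hQ
  have hlam := hc.mul_xx_ne_zero hQ
  have hyy := hc.mul_yy hQ
  have hmu := hc.mul_yy_ne_zero hQ
  generalize X (A.mul (x ⊗ₜ x)) = lam at *
  generalize X (A.mul (y ⊗ₜ y)) = mu at *
  have hx0 : lam⁻¹ • x ≠ 0 := fun h => by
    have := congrArg X h
    simp [hc.X_x, hlam] at this
  have hI : A.mul ((lam⁻¹ • x) ⊗ₜ (lam⁻¹ • x)) = lam⁻¹ • x := by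
    rw [← TensorProduct.smul_tmul', TensorProduct.tmul_smul, map_smul, map_smul, hxx,
      smul_smul lam⁻¹ lam, inv_mul_cancel₀ hlam, one_smul]
  have hm : ∀ {z : B} {s d : k}, A.mul (z ⊗ₜ z) = s • x → s ≠ 0 → d ≠ 0 →
      A.mul (((lam⁻¹ * s⁻¹ * d⁻¹) • z) ⊗ₜ (d • z)) = lam⁻¹ • x := by
    intro z s d hz hs hd
    rw [← TensorProduct.smul_tmul', TensorProduct.tmul_smul, map_smul, map_smul, hz,
      smul_smul, smul_smul]
    congr 1
    field_simp
  rcases mul_eq_zero.1 (show i * (i - 1) = 0 by linear_combination hi) with rfl | hi1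
  · obtain ⟨d, s, rfl⟩ : ∃ d s : k, b = d • A.one + s • x := ⟨_, _, hc.eq_of_even hQ hb⟩
    by_cases hd : d = 0
    · rw [hd, zero_smul, zero_add] at hb0 ⊢
      refine ⟨(lam⁻¹ * lam⁻¹ * s⁻¹) • x, ?_, ?_⟩
      · rw [map_smul, hc.act_x, zero_smul, zero_smul, smul_zero]
      · rw [hm hxx hlam (left_ne_zero_of_smul hb0)]
        exact ⟨hI, hx0⟩
    -- The idempotent complementary to `λ⁻¹x` annihilates `x`, so it extracts the component of `b`
    -- along 1.
    · set f := A.one - lam⁻¹ • x with hf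
      have hfx : A.mul (f ⊗ₜ x) = 0 := by
        rw [hf, TensorProduct.sub_tmul, ← TensorProduct.smul_tmul', map_sub, map_smul, A.one_mul,
          hxx, smul_smul, inv_mul_cancel₀ hlam, one_smul, sub_self]
      have hff : A.mul (f ⊗ₜ f) = f := by
        conv_lhs => rw [hf, TensorProduct.tmul_sub, TensorProduct.tmul_smul, ← hf, map_sub,
          map_smul, hfx, A.mul_one, smul_zero, sub_zero]
      have hfb : A.mul ((d⁻¹ • f) ⊗ₜ (d • A.one + s • x)) = f := by
        rw [← TensorProduct.smul_tmul', TensorProduct.tmul_add, TensorProduct.tmul_smul,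
          TensorProduct.tmul_smul, map_smul, map_add, map_smul, map_smul, hfx, A.mul_one, smul_zero,
          add_zero, smul_smul, inv_mul_cancel₀ hd, one_smul]
      refine ⟨d⁻¹ • f, ?_, ?_⟩
      · rw [map_smul, hf, map_sub, map_smul, hQ.act_one, hc.act_x]
        simp
      · rw [hfb]
        refine ⟨hff, fun h => ?_⟩
        have := congrArg A.counit h
        simp [hf, A.counit_one, hc.counit_x] at this
  · obtain rfl : i = 1 := by linear_combination hi1
    obtain ⟨d, rfl⟩ : ∃ d : k, b = d • y := ⟨_, hc.eq_of_odd hQ hb⟩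
    -- Since `y² = μx`, this multiple of `y` carries `dy` to the idempotent `λ⁻¹x`.
    refine ⟨(lam⁻¹ * mu⁻¹ * d⁻¹) • y, ?_, ?_⟩
    · rw [map_smul, hc.act_y, one_smul, one_smul]
    · rw [hm hyy hmu (left_ne_zero_of_smul hb0)]
      exact ⟨hI, hx0⟩

end IsMixedBasis
end MixedBasis

/-! ### Three-dimensional braided Hopf algebras -/

section ThreeDimensional

variable {k : Type*} [Field k] {H : Type*} [Ring H] [Algebra k H]
  {Q : QuasiBialgebra k H} {p : H} {w : k} {B : Type*} [AddCommGroup B] [Module k B]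

/-- A three-dimensional braided Hopf algebra with nontrivial action has a basis `1, x, y` with `x`
even and `y` odd. -/
theorem IsGenerator.exists_isMixedBasis (hQ : IsGenerator Q p w) (A : YDHopfAlgebra Q B)
    (hB : Module.finrank k B = 3) {m : B} (hm : A.act p m ≠ 0) :
    ∃ (x y : B) (X Y : B →ₗ[k] k), IsMixedBasis p A.toYDBialgebra x y X Y := by
  have hpp : ∀ b, A.act p (A.act p b) = A.act p b := fun b => by
    rw [← Module.End.mul_apply, ← map_mul, hQ.sq]
  obtain ⟨y, hy, hy0⟩ : ∃ y, A.act p y = y ∧ y ≠ 0 := ⟨_, hpp m, hm⟩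
  have hεy : A.counit y = 0 := by rw [← hy]; exact hQ.counit_act A.toYDBialgebra y
  obtain ⟨z, hεz, hzy⟩ := exists_linearIndependent_pair hB A.counit hy0
  have hcoord : ∀ {x : B}, A.counit x = 0 → LinearIndependent k ![x, y] →
      ∃ X Y, IsCoordinates A.toYDBialgebra x y X Y := fun hx h => by
    obtain ⟨X, Y, h1, h2, h3, h4, h5, h6, h7⟩ := exists_coordinates hB A.counit_one hx hεy h
    exact ⟨X, Y, hx, hεy, h1, h2, h3, h4, h5, h6, h7⟩
  -- If `z` were odd, the augmentation ideal would be purely odd, which is impossible. Otherwise the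
  -- even part `z - pz` of `z` is nonzero and serves as `x`.
  by_cases hz : A.act p z = z
  · obtain ⟨X, Y, hc⟩ := hcoord hεz hzy
    exact (hQ.false_of_odd_basis A.toYDBialgebra hc (by rw [hz, one_smul])
      (by rw [hy, one_smul])).elim
  · set x := z - A.act p z with hx
    have hx0 : x ≠ 0 := fun h => hz (sub_eq_zero.1 h).symm
    have hpx : A.act p x = 0 := by rw [hx, map_sub, hpp, sub_self]
    have hεx : A.counit x = 0 := by
      rw [hx, map_sub, hεz, hQ.counit_act A.toYDBialgebra z, sub_self]
    obtain ⟨X, Y, hc⟩ := hcoord hεx (by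
      rw [LinearIndependent.pair_iff]
      intro s t h
      have ht := congrArg (A.act p) h
      rw [map_add, map_smul, map_smul, hpx, hy, smul_zero, zero_add, map_zero] at ht
      rw [ht, add_zero] at h
      exact ⟨(smul_eq_zero.1 h).resolve_right hx0, (smul_eq_zero.1 ht).resolve_right hy0⟩)
    exact ⟨x, y, X, Y, hc, by rw [hpx, zero_smul], by rw [hy, one_smul]⟩

/-- The biproduct of a three-dimensional braided Hopf algebra with a two-dimensional quasi-Hopf
algebra is semisimple. -/
theorem isSemisimpleRing_biproduct [CharZero k] (hH : Module.finrank k H = 2)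
    (hQ : IsGenerator Q p w) (A : YDHopfAlgebra Q B) (hB : Module.finrank k B = 3) : IsSemisimpleRing (Biproduct A) := by
  have : Module.Finite k H := Module.finite_of_finrank_pos (by omega)
  have : Module.Finite k B := Module.finite_of_finrank_pos (by omega)
  refine hQ.isSemisimpleRing_biproduct A fun i hi b hb hb0 => ?_
  by_cases hP : ∀ b, A.act p b = 0
  · obtain ⟨c, h1, h2⟩ := hQ.exists_idempotent_of_act_eq_zero A hB hP hb0
    rw [hP, eq_comm, smul_eq_zero] at hb
    exact ⟨c, by rw [hP, hb.resolve_right hb0, zero_smul], h1, h2⟩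
  · obtain ⟨m, hm⟩ := not_forall.1 hP
    obtain ⟨x, y, X, Y, hc⟩ := hQ.exists_isMixedBasis A hB hm
    exact hc.exists_idempotent hQ hi hb hb0

end ThreeDimensional

end QuasiHopf

end

theorem mainTheorem5 {k : Type*} [Field k] [IsAlgClosed k] [CharZero k]
    {H : Type*} [Ring H] [Algebra k H] (Q : QuasiHopf.QuasiHopfAlgebra k H)
    (hH : Module.finrank k H = 2) :
    (∀ (B : Type*) [AddCommGroup B] [Module k B]
      (A : QuasiHopf.YDHopfAlgebra Q.toQuasiBialgebra B),
      Module.finrank k B = 3 → IsSemisimpleRing (QuasiHopf.Biproduct A)) ∧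
    (∃ c : kˣ,
      (Q.rescale c).TwistEquivalent (QuasiHopf.groupC2 k) ∨
      (Q.rescale c).TwistEquivalent (QuasiHopf.H2 k)) := by
  obtain ⟨p, w, hQ⟩ := QuasiHopf.exists_isGenerator Q hH
  exact ⟨fun B _ _ A hB => QuasiHopf.isSemisimpleRing_biproduct hH hQ A hB,
    QuasiHopf.exists_twistEquivalent Q hH⟩
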